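/- **Conventions.** Graphs are finite and loopless; parallel edges are allowed. The order $n(G)$ is the number of vertices. A graph is *cubic* if every vertex is incident with exactly three edges. It is *3-connected* if it has at least two vertices and any two distinct vertices are joined by three distinct pairwise internally disjoint paths; in particular the graph with two vertices joined by three parallel edges is 3-connected. For a bipartite cubic graph $H$ with color classes $A,B$, a pair $(a,b)$ of distinct vertices is *$\lambda$-matchable* if $H$ has a spanning subgraph in which $a$ and $b$ have degree three and every other vertex has degree one. Let $\rho(H)$ be the number of $\lambda$-matchable pairs $(a,b)\in A\times B$, and for a vertex $v$ let $\rho_H(v)$ be the number of vertices $w$ such that $(v,w)$ is $\lambda$-matchable. A connected graph of order at least two is *matching covered* if each edge lies in a perfect matching. For $X\subseteq V(G)$, the cut $\partial(X)$ is the set of edges with exactly one end in $X$. In a matching covered graph it is *tight* if every perfect matching contains exactly one of its edges, and *nontrivial* if both $X$ and $V(G)\setminus X$ have at least two vertices. The *tight cut decomposition procedure* repeatedly replaces a graph having a nontrivial tight cut $\partial(X)$ by the two graphs obtained by shrinking $X$, respectively $V(G)\setminus X$, to a single vertex (deleting the resulting loops), until no nontrivial tight cut remains. A *brace* is a bipartite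 matching covered graph without nontrivial tight cuts. For the list of graphs produced by an application of the procedure to $H$, let $b'(H)$ be the number of braces of order at least six in the list, and let $$\tilde b(H)=\sum_{J}\left(\frac{n(J)}{2}\right)^2,$$ where $J$ runs over those braces. Let $G,G'$ be disjoint graphs with vertices $u\in V(G)$ and $v\in V(G')$ of equal degree, and let $\pi$ be a bijection from the edges of $G$ at $u$ to the edges of $G'$ at $v$. *Splicing* $G$ at $u$ with $G'$ at $v$ with respect to $\pi$ means taking the union of $G-u$ and $G'-v$ and adding, for every edge $e$ at $u$, an edge joining the end of $e$ other than $u$ to the end of $\pi(e)$ other than $v$. Let $\mathcal J$ be the class of simple cubic braces. Let $\mathcal K$ be the smallest class of graphs closed under isomorphism such that $K_{3,3}\in\mathcal K$ and, whenever $G\in\mathcal K$ and $u\in V(G)$ satisfies $\rho_G(u)=3$, every graph obtained by splicing $G$ at $u$ with $K_{3,3}$ at any of its vertices, with respect to any bijection, is in $\mathcal K$. **Theorem.** Let $H$ be a 3-connected bipartite cubic graph. Then the tight cut decomposition procedure can be applied to $H$ and, whichever application is used to compute $\tilde b(H)$ and $b'(H)$, $$\rho(H)\ \ge\ \tilde b(H)+3b'(H)-3\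 \ge\ 3n(H)-9 .$$ Furthermore: (i) the first inequality holds with equality if and only if $H\in\mathcal J\cup\mathcal K$; (ii) equality holds in both inequalities if and only if $H\in\mathcal K$. -/

import Mathlib

open scoped Graph

universe u v

namespace CubicGraphs

section Basics

/-- `(A, B)` are the color classes of a bipartition of `G`. In particular `G` is loopless. -/
structure IsBipartition {α : Type u} {β : Type v} (G : Graph α β) (A B : Set α) : Prop where
  union_eq : A ∪ B = V(G)
  disjoint : Disjoint A B
  isLink : ∀ e x y, G.IsLink e x y → (x ∈ A ∧ y ∈ B) ∨ (x ∈ B ∧ y ∈ A)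

def IsBipartite {α : Type u} {β : Type v} (G : Graph α β) : Prop :=
  ∃ A B : Set α, IsBipartition G A B

/-- The degree of `x` in the spanning subgraph of `G` with edge set `M` (for loopless `G`). -/
noncomputable def degIn {α : Type u} {β : Type v} (G : Graph α β) (M : Set β) (x : α) : ℕ :=
  (M ∩ G.incidenceSet x).ncard

/-- A (loopless, possibly with parallel edges) graph all of whose vertices have degree three. -/
structure IsCubic {α : Type u} {β : Type v} (G : Graph α β) : Prop where
  loopless : G.Loopless
  deg_eq : ∀ x ∈ V(G), degIn G E(G) x = 3

/-- The order of `G`, its number of vertices. -/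
noncomputable def order {α : Type u} {β : Type v} (G : Graph α β) : ℕ := V(G).ncard

def IsConnected {α : Type u} {β : Type v} (G : Graph α β) : Prop :=
  V(G).Nonempty ∧ ∀ x ∈ V(G), ∀ y ∈ V(G), Relation.ReflTransGen G.Adj x y

/-- `IsWalk G x w y`: the list `w = [(e₁, x₁), …, (eₖ, xₖ)]` describes a walk
`x e₁ x₁ e₂ x₂ … eₖ xₖ` in `G` with `xₖ = y`. -/
inductive IsWalk {α : Type u} {β : Type v} (G : Graph α β) : α → List (β × α) → α → Prop
  | nil (x : α) (hx : x ∈ V(G)) : IsWalk G x [] x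
  | cons (x y z : α) (e : β) (w : List (β × α)) (he : G.IsLink e x y) (hw : IsWalk G y w z) :
      IsWalk G x ((e, y) :: w) z

/-- A walk without repeated vertices. -/
def IsPath {α : Type u} {β : Type v} (G : Graph α β) (x : α) (w : List (β × α)) (y : α) : Prop :=
  IsWalk G x w y ∧ (x :: w.map Prod.snd).Nodup

/-- The internal vertices of a path between two distinct vertices. -/
def internalVertices {α : Type u} {β : Type v} (w : List (β × α)) : List α :=
  (w.map Prod.snd).dropLast

/-- Vertex-connectivity of multigraphs: `G` has at least two vertices, and any two distinct
vertices are joined by `k` distinct, pairwise internally disjoint paths. (Parallel edges are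
distinct paths, so the graph with two vertices and three parallel edges is 3-connected.) -/
def IsKConnected {α : Type u} {β : Type v} (G : Graph α β) (k : ℕ) : Prop :=
  V(G).Nontrivial ∧ ∀ x ∈ V(G), ∀ y ∈ V(G), x ≠ y →
    ∃ P : Fin k → List (β × α), Function.Injective P ∧ (∀ i, IsPath G x (P i) y) ∧
      ∀ i j, i ≠ j → (internalVertices (P i)).Disjoint (internalVertices (P j))

/-- Isomorphism of multigraphs. -/
def IsIso {α : Type u} {β : Type v} {α' : Type*} {β' : Type*}
    (G : Graph α β) (H : Graph α' β') : Prop :=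
  ∃ (f : V(G) ≃ V(H)) (g : E(G) ≃ E(H)), ∀ (e : E(G)) (x y : V(G)),
    G.IsLink (e : β) (x : α) (y : α) ↔ H.IsLink (g e : β') (f x : α') (f y : α')

end Basics

section Matchings

/-- A perfect matching, as a set of edges. -/
def IsPerfectMatching {α : Type u} {β : Type v} (G : Graph α β) (M : Set β) : Prop :=
  M ⊆ E(G) ∧ ∀ x ∈ V(G), degIn G M x = 1

/-- An `(a, b)`-matching: a spanning subgraph in which `a` and `b` have degree three whereas
every other vertex has degree one. -/
def IsPairMatching {α : Type u} {β : Type v} (G : Graph α β) (a b : α) (M : Set β) : Prop :=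
  M ⊆ E(G) ∧ degIn G M a = 3 ∧ degIn G M b = 3 ∧
    ∀ x ∈ V(G), x ≠ a → x ≠ b → degIn G M x = 1

/-- The pair of (distinct) vertices `a`, `b` is `λ`-matchable. -/
def IsLambdaMatchable {α : Type u} {β : Type v} (G : Graph α β) (a b : α) : Prop :=
  a ∈ V(G) ∧ b ∈ V(G) ∧ a ≠ b ∧ ∃ M, IsPairMatching G a b M

/-- The number `ρ` of `λ`-matchable pairs `(a, b)`, with `a ∈ A` and `b ∈ B`, of a graph with
color classes `A` and `B`. -/
noncomputable def rho {α : Type u} {β : Type v} (G : Graph α β) (A B : Set α) : ℕ :=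
  {p : α × α | p.1 ∈ A ∧ p.2 ∈ B ∧ IsLambdaMatchable G p.1 p.2}.ncard

/-- The number of vertices `w` such that the pair `(x, w)` is `λ`-matchable. -/
noncomputable def numPartners {α : Type u} {β : Type v} (G : Graph α β) (x : α) : ℕ :=
  {w : α | IsLambdaMatchable G x w}.ncard

/-- A connected graph of order at least two each of whose edges is in a perfect matching. -/
structure IsMatchingCovered {α : Type u} {β : Type v} (G : Graph α β) : Prop where
  connected : IsConnected G
  nontrivial : V(G).Nontrivial
  covered : ∀ e ∈ E(G), ∃ M, IsPerfectMatching G M ∧ e ∈ M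

end Matchings

section TightCuts

/-- The cut with shores `X` and `V(G) \ X`. -/
def cut {α : Type u} {β : Type v} (G : Graph α β) (X : Set α) : Set β :=
  {e | ∃ x y, G.IsLink e x y ∧ x ∈ X ∧ y ∉ X}

/-- `X` is a shore of a nontrivial tight cut of `G`: both shores contain at least two vertices,
and every perfect matching contains exactly one edge of the cut. -/
structure IsNontrivialTightCut {α : Type u} {β : Type v} (G : Graph α β) (X : Set α) : Prop where
  subset : X ⊆ V(G)
  nontrivial : X.Nontrivial
  nontrivial_compl : (V(G) \ X).Nontrivial
  tight : ∀ M, IsPerfectMatching G M → (cut G X ∩ M).ncard = 1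

open Classical in
/-- The graph `G / X → x` obtained by shrinking `X` into a single vertex and removing the
resulting loops. The contraction vertex is named `x`, where `x` is any chosen element of `X`. -/
noncomputable def contract {α : Type u} {β : Type v} (G : Graph α β) (X : Set α) (x : α) :
    Graph α β :=
  (G.map (fun z => if z ∈ X then x else z)).deleteEdges
    {e | ∃ y z, G.IsLink e y z ∧ y ∈ X ∧ z ∈ X}

/-- `IsTightCutDecomposition G L`: some application of the tight cut decomposition procedure to
the matching covered graph `G` yields the list `L` of graphs free of nontrivial tight cuts. -/
inductive IsTightCutDecomposition {α : Type u} {β : Type v} :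
    Graph α β → Multiset (Graph α β) → Prop
  | leaf (G : Graph α β) (hG : IsMatchingCovered G)
      (hfree : ∀ X : Set α, ¬ IsNontrivialTightCut G X) : IsTightCutDecomposition G {G}
  | node (G : Graph α β) (hG : IsMatchingCovered G) (X : Set α) (hX : IsNontrivialTightCut G X)
      (x y : α) (hx : x ∈ X) (hy : y ∈ V(G) \ X) (L₁ L₂ : Multiset (Graph α β))
      (h₁ : IsTightCutDecomposition (contract G (V(G) \ X) y) L₁)
      (h₂ : IsTightCutDecomposition (contract G X x) L₂) :
      IsTightCutDecomposition G (L₁ + L₂)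

/-- A brace: a bipartite matching covered graph free of nontrivial tight cuts. -/
structure IsBrace {α : Type u} {β : Type v} (G : Graph α β) : Prop where
  matchingCovered : IsMatchingCovered G
  bipartite : IsBipartite G
  free : ∀ X : Set α, ¬ IsNontrivialTightCut G X

open Classical in
/-- The members of `L` that are braces of order at least six. -/
noncomputable def largeBraces {α : Type u} {β : Type v} (L : Multiset (Graph α β)) :
    Multiset (Graph α β) :=
  L.filter (fun G => IsBrace G ∧ 6 ≤ order G)

/-- The number `b'` of braces of order at least six. -/
noncomputable def bPrime {α : Type u} {β : Type v} (L : Multiset (Graph α β)) : ℕ :=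
  (largeBraces L).card

/-- The sum of `(n / 2) ^ 2` over the braces of order at least six, `n` being the order. -/
noncomputable def bTilde {α : Type u} {β : Type v} (L : Multiset (Graph α β)) : ℚ :=
  ((largeBraces L).map (fun G => ((order G : ℚ) / 2) ^ 2)).sum

end TightCuts

section Families

/-- The incidence relation of the splicing of `G` at `a` with `H` at `b` with respect to `π`.
The edges of `G` not at `a` and the edges of `H` not at `b` are kept, and each edge `e` of `G`
at `a` now joins its other end in `G` to the other end of `π e` in `H`. -/
inductive SpliceLink {α : Type u} {β : Type v} {α' : Type*} {β' : Type*}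
    (G : Graph α β) (H : Graph α' β') (a : α) (b : α') (π : β → β') :
    β ⊕ β' → α ⊕ α' → α ⊕ α' → Prop
  | left (e : β) (x y : α) (h : G.IsLink e x y) (hx : x ≠ a) (hy : y ≠ a) :
      SpliceLink G H a b π (Sum.inl e) (Sum.inl x) (Sum.inl y)
  | right (e : β') (x y : α') (h : H.IsLink e x y) (hx : x ≠ b) (hy : y ≠ b) :
      SpliceLink G H a b π (Sum.inr e) (Sum.inr x) (Sum.inr y)
  | across (e : β) (x : α) (y : α') (h : G.IsLink e x a) (hx : x ≠ a)
      (h' : H.IsLink (π e) y b) (hy : y ≠ b) :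
      SpliceLink G H a b π (Sum.inl e) (Sum.inl x) (Sum.inr y)
  | across_symm (e : β) (x : α) (y : α') (h : G.IsLink e x a) (hx : x ≠ a)
      (h' : H.IsLink (π e) y b) (hy : y ≠ b) :
      SpliceLink G H a b π (Sum.inl e) (Sum.inr y) (Sum.inl x)

/-- The splicing `(G ⊙ H)_{a,b,π}` of `G` at `a` with `H` at `b`; here `π` should map the edges
of `G` at `a` bijectively to the edges of `H` at `b`. -/
def splice {α : Type u} {β : Type v} {α' : Type*} {β' : Type*}
    (G : Graph α β) (H : Graph α' β') (a : α) (b : α') (π : β → β') :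
    Graph (α ⊕ α') (β ⊕ β') where
  vertexSet := Sum.inl '' (V(G) \ {a}) ∪ Sum.inr '' (V(H) \ {b})
  IsLink := SpliceLink G H a b π
  isLink_symm := by
    rintro e -
    refine ⟨?_⟩
    rintro _ _ (⟨e, x, y, h, hx, hy⟩ | ⟨e, x, y, h, hx, hy⟩ | ⟨e, x, y, h, hx, h', hy⟩ |
      ⟨e, x, y, h, hx, h', hy⟩)
    · exact .left e y x h.symm hy hx
    · exact .right e y x h.symm hy hx
    · exact .across_symm e x y h hx h' hy
    · exact .across e x y h hx h' hy
  eq_or_eq_of_isLink_of_isLink := by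
    rintro _ _ _ _ _ (⟨e, x, y, h, hx, hy⟩ | ⟨e, x, y, h, hx, hy⟩ | ⟨e, x, y, h, hx, h', hy⟩ |
      ⟨e, x, y, h, hx, h', hy⟩) k <;>
    cases k <;> grind [Graph.IsLink.left_eq_or_eq, Graph.IsLink.symm]
  left_mem_of_isLink := by
    rintro _ _ _ (⟨e, x, y, h, hx, hy⟩ | ⟨e, x, y, h, hx, hy⟩ | ⟨e, x, y, h, hx, h', hy⟩ |
      ⟨e, x, y, h, hx, h', hy⟩)
    · exact Or.inl ⟨x, ⟨h.left_mem, hx⟩, rfl⟩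
    · exact Or.inr ⟨x, ⟨h.left_mem, hx⟩, rfl⟩
    · exact Or.inl ⟨x, ⟨h.left_mem, hx⟩, rfl⟩
    · exact Or.inr ⟨y, ⟨h'.left_mem, hy⟩, rfl⟩

/-- The complete bipartite graph `K_{3,3}`. -/
def K33 : Graph (Fin 3 ⊕ Fin 3) (Sym2 (Fin 3 ⊕ Fin 3)) :=
  Graph.ofSimpleGraph (completeBipartiteGraph (Fin 3) (Fin 3))

/-- The family `𝒥` of simple cubic braces. -/
structure FamilyJ {α : Type u} {β : Type v} (G : Graph α β) : Prop where
  simple : G.Simple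
  cubic : IsCubic G
  brace : IsBrace G

/-- The family `𝒦` (closed under isomorphism): it contains `K_{3,3}`, and if `G` is a member and
`a` is a vertex of `G` with exactly three partners, then each splicing of `G` at `a` with
`K_{3,3}` is a member. -/
inductive FamilyK : ∀ {α : Type u} {β : Type v}, Graph α β → Prop
  | base {α : Type u} {β : Type v} (G : Graph α β) (h : IsIso G K33) : FamilyK G
  | step {α α' : Type u} {β β' : Type v} (G : Graph α β) (hG : FamilyK G)
      (a : α) (ha : a ∈ V(G)) (ha3 : numPartners G a = 3)
      (b : Fin 3 ⊕ Fin 3) (hb : b ∈ V(K33))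
      (π : β → Sym2 (Fin 3 ⊕ Fin 3))
      (hπ : Set.BijOn π (G.incidenceSet a) (K33.incidenceSet b))
      (J : Graph α' β') (hJ : IsIso J (splice G K33 a b π)) : FamilyK J

end Families

end CubicGraphs

open CubicGraphs

namespace CubicGraphs

/-! ### Degree counts in finite bipartite cubic graphs. -/

section Counting

variable {α : Type u} {β : Type v} {G : Graph α β} {A B : Set α}

/-! The proof rests on an exact formula for splicings. Let H be a splicing of G₁ at v₁ with G₂ at
v₂, all bipartite and cubic, and let sᵢ be the number of partners of vᵢ. A pair of vertices inside
one part is λ-matchable in H iff it is so in that part, and a pair across the splicing is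
λ-matchable iff each member is a partner of the splicing vertex of its part. Hence ρ(H) = ρ(G₁) +
ρ(G₂) + (s₁ - 1)(s₂ - 1) - 1; `IsGluing.numPairs_eq` is this formula for ordered pairs.

Of 3-connectivity only 3-edge-connectivity is used (`IsKConnected.le_ncard_cut`), because
contractions inherit it directly. A nontrivial tight cut has three edges, all leaving a shore from
one color class (`IsBipCubic.exists_halfCut_eq_empty`). So both contractions are again bipartite,
cubic and 3-edge-connected, of smaller order but more than two, and the graph is a splicing of them
(`isGluing_contract`).

By Hall's theorem adjacent vertices are partners once the order exceeds two, so sᵢ ≥ 3 and ρ(H) ≥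
ρ(G₁) + ρ(G₂) + 3. Both b̃ + 3b' - 3 and 3n - 9 satisfy this recursion with equality. In a brace of
order 2k > 2, again by Hall, all k² pairs of opposite colors are λ-matchable, and k² ≥ 6k - 9
because (k - 3)² ≥ 0. Induction on the decomposition gives both inequalities
(`IsTightCutDecomposition.bounds`).

If the first inequality is tight and H has a nontrivial tight cut, then s₁ = s₂ = 3 and both parts
attain equality. A part that is a brace has k = sᵢ = 3 and so attains 3n - 9, and by induction H
attains it too. Conversely, let ρ(H) = 3n - 9. Contracting the complement of a minimal shore leaves
a brace attaining 3n - 9, that is, `K33`. The other contraction is in 𝒦 by induction, and its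
splicing vertex has three partners, so H is in 𝒦 (`IsBipCubic.familyK`). -/

lemma IsBipartition.symm (h : IsBipartition G A B) : IsBipartition G B A :=
  ⟨by rw [Set.union_comm]; exact h.union_eq, h.disjoint.symm,
    fun e x y hl => (h.isLink e x y hl).symm⟩

lemma IsBipartition.left_subset (h : IsBipartition G A B) : A ⊆ V(G) :=
  h.union_eq ▸ Set.subset_union_left

lemma IsBipartition.right_subset (h : IsBipartition G A B) : B ⊆ V(G) :=
  h.union_eq ▸ Set.subset_union_right

lemma IsBipartition.mem_or (h : IsBipartition G A B) {x : α} (hx : x ∈ V(G)) : x ∈ A ∨ x ∈ B := by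
  rw [← h.union_eq] at hx; exact hx

lemma IsBipartition.notMem_right (h : IsBipartition G A B) {x : α} (hx : x ∈ A) : x ∉ B :=
  Set.disjoint_left.1 h.disjoint hx

lemma IsBipartition.notMem_left (h : IsBipartition G A B) {x : α} (hx : x ∈ B) : x ∉ A :=
  Set.disjoint_right.1 h.disjoint hx

lemma IsBipartition.mem_right_of_isLink (h : IsBipartition G A B) {e : β} {x y : α}
    (hl : G.IsLink e x y) (hx : x ∈ A) : y ∈ B := by
  rcases h.isLink e x y hl with h1 | h1
  · exact h1.2
  · exact absurd h1.1 (h.notMem_right hx)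

lemma IsBipartition.mem_left_of_isLink (h : IsBipartition G A B) {e : β} {x y : α}
    (hl : G.IsLink e x y) (hx : x ∈ B) : y ∈ A := h.symm.mem_right_of_isLink hl hx

lemma IsBipartition.ne_of_isLink (h : IsBipartition G A B) {e : β} {x y : α}
    (hl : G.IsLink e x y) : x ≠ y := by
  rintro rfl
  rcases h.isLink e x x hl with h1 | h1
  · exact h.notMem_right h1.1 h1.2
  · exact h.notMem_right h1.2 h1.1

lemma IsBipartition.exists_isLink (h : IsBipartition G A B) {e : β} (he : e ∈ E(G)) :
    ∃ a ∈ A, ∃ b ∈ B, G.IsLink e a b := by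
  obtain ⟨x, y, hl⟩ := G.exists_isLink_of_mem_edgeSet he
  rcases h.isLink e x y hl with h1 | h1
  · exact ⟨x, h1.1, y, h1.2, hl⟩
  · exact ⟨y, h1.2, x, h1.1, hl.symm⟩

lemma IsBipartition.eq_of_inc (h : IsBipartition G A B) {e : β} {x y : α}
    (hx : G.Inc e x) (hy : G.Inc e y) (hxA : x ∈ A) (hyA : y ∈ A) : x = y := by
  obtain ⟨z, hz⟩ := hx
  rcases hy.eq_or_eq_of_isLink hz with h1 | h1
  · exact h1.symm
  · subst h1; exact absurd (h.mem_right_of_isLink hz hxA) (h.notMem_right hyA)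

/-- The edges of `M` with an end in `S`. -/
def touching (G : Graph α β) (M : Set β) (S : Set α) : Set β := {e ∈ M | ∃ x ∈ S, G.Inc e x}

lemma ncard_touching (h : IsBipartition G A B) {M : Set β} (hM : M.Finite) (S : Finset α)
    (hS : (S : Set α) ⊆ A) : (touching G M S).ncard = ∑ x ∈ S, degIn G M x := by
  classical
  induction S using Finset.induction_on with
  | empty => simp [touching]
  | insert a S ha ih =>
    rw [Finset.sum_insert ha, ← ih (fun x hx => hS (by simp_all))]
    have h1 : touching G M (insert a S : Finset α) = (M ∩ G.incidenceSet a) ∪ touching G M S := by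
      ext e
      simp only [touching, Finset.coe_insert, Set.mem_insert_iff, Finset.mem_coe, Set.mem_union,
        Set.mem_inter_iff, Graph.mem_incidenceSet, Set.mem_ofPred_eq]
      constructor
      · rintro ⟨hm, x, rfl | hx, hi⟩
        · exact Or.inl ⟨hm, hi⟩
        · exact Or.inr ⟨hm, x, hx, hi⟩
      · rintro (⟨hm, hi⟩ | ⟨hm, x, hx, hi⟩)
        · exact ⟨hm, a, Or.inl rfl, hi⟩
        · exact ⟨hm, x, Or.inr hx, hi⟩
    rw [h1, Set.ncard_union_eq _ (hM.subset Set.inter_subset_left) (hM.subset fun e he => he.1)]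
    · rfl
    · rw [Set.disjoint_left]
      rintro e ⟨_, hi⟩ ⟨_, x, hx, hi'⟩
      have := h.eq_of_inc hi hi' (hS (by simp)) (hS (by simp_all))
      subst this; exact ha hx

/-- The edges of `M` leaving `X` from a vertex in `A`. -/
def halfCut (G : Graph α β) (A X : Set α) (M : Set β) : Set β :=
  {e ∈ M | ∃ x y, G.IsLink e x y ∧ x ∈ A ∧ x ∈ X ∧ y ∉ X}

lemma cut_inter_eq (h : IsBipartition G A B) (X : Set α) (M : Set β) :
    cut G X ∩ M = halfCut G A X M ∪ halfCut G B X M := by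
  ext e
  simp only [cut, halfCut, Set.mem_inter_iff, Set.mem_union, Set.mem_ofPred_eq]
  constructor
  · rintro ⟨⟨x, y, hl, hx, hy⟩, hM⟩
    rcases h.mem_or hl.left_mem with h1 | h1
    · exact Or.inl ⟨hM, x, y, hl, h1, hx, hy⟩
    · exact Or.inr ⟨hM, x, y, hl, h1, hx, hy⟩
  · rintro (⟨hM, x, y, hl, _, hx, hy⟩ | ⟨hM, x, y, hl, _, hx, hy⟩) <;>
    exact ⟨⟨x, y, hl, hx, hy⟩, hM⟩

lemma ncard_cut_inter (h : IsBipartition G A B) (X : Set α) {M : Set β} (hM : M.Finite) :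
    (cut G X ∩ M).ncard = (halfCut G A X M).ncard + (halfCut G B X M).ncard := by
  rw [cut_inter_eq h, Set.ncard_union_eq _ (hM.subset fun e he => he.1)
    (hM.subset fun e he => he.1)]
  rw [Set.disjoint_left]
  rintro e ⟨_, x, y, hl, hA, hx, hy⟩ ⟨_, x', y', hl', hB, hx', hy'⟩
  rcases hl.left_eq_or_eq hl' with rfl | rfl
  · exact h.notMem_right hA hB
  · exact hy' hx

/-- Count the edges of `M` with both ends in `X` from either color class: each class sees all of
them, together with the edges leaving `X` from that class. Every parity and size argument below is
an instance of this balance. -/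
lemma sum_degIn_halfCut (h : IsBipartition G A B) {M : Set β} (hM : M.Finite)
    (SA SB : Finset α) (X : Set α) (hA : (SA : Set α) = A ∩ X) (hB : (SB : Set α) = B ∩ X) :
    ∑ x ∈ SA, degIn G M x + (halfCut G B X M).ncard =
      ∑ x ∈ SB, degIn G M x + (halfCut G A X M).ncard := by
  have key : ∀ {A B : Set α} (h : IsBipartition G A B) (S : Finset α) (hS : (S : Set α) = A ∩ X),
      (touching G M S).ncard = {e ∈ M | ∃ x y, G.IsLink e x y ∧ x ∈ X ∧ y ∈ X}.ncard +
        (halfCut G A X M).ncard := by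
    intro A B h S hS
    rw [← Set.ncard_union_eq _ (hM.subset fun e he => he.1) (hM.subset fun e he => he.1)]
    · congr 1
      ext e
      simp only [touching, hS, halfCut, Set.mem_union, Set.mem_ofPred_eq]
      constructor
      · rintro ⟨hm, x, ⟨hxA, hxX⟩, y, hl⟩
        by_cases hy : y ∈ X
        · exact Or.inl ⟨hm, x, y, hl, hxX, hy⟩
        · exact Or.inr ⟨hm, x, y, hl, hxA, hxX, hy⟩
      · rintro (⟨hm, x, y, hl, hx, hy⟩ | ⟨hm, x, y, hl, hxA, hx, hy⟩)
        · rcases h.isLink e x y hl with h1 | h1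
          · exact ⟨hm, x, ⟨h1.1, hx⟩, y, hl⟩
          · exact ⟨hm, y, ⟨h1.2, hy⟩, x, hl.symm⟩
        · exact ⟨hm, x, ⟨hxA, hx⟩, y, hl⟩
    · rw [Set.disjoint_left]
      rintro e ⟨_, x, y, hl, hx, hy⟩ ⟨_, x', y', hl', _, hx', hy'⟩
      rcases hl'.right_eq_or_eq hl with rfl | rfl
      · exact hy' hx
      · exact hy' hy
  rw [← ncard_touching h hM SA (hA ▸ Set.inter_subset_left),
    ← ncard_touching h.symm hM SB (hB ▸ Set.inter_subset_left), key h SA hA, key h.symm SB hB]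
  omega

/-- A finite bipartite cubic graph with color classes `A` and `B`. -/
structure IsBipCubic (G : Graph α β) (A B : Set α) : Prop where
  finite : V(G).Finite
  bip : IsBipartition G A B
  cubic : IsCubic G

lemma IsBipCubic.symm (h : IsBipCubic G A B) : IsBipCubic G B A := ⟨h.finite, h.bip.symm, h.cubic⟩

lemma IsCubic.ncard_incidenceSet (h : IsCubic G) {x : α} (hx : x ∈ V(G)) :
    (G.incidenceSet x).ncard = 3 := by
  have := h.deg_eq x hx
  rwa [degIn, Set.inter_eq_right.2 (G.incidenceSet_subset_edgeSet x)] at this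

lemma IsCubic.finite_incidenceSet (h : IsCubic G) {x : α} (hx : x ∈ V(G)) :
    (G.incidenceSet x).Finite :=
  Set.finite_of_ncard_ne_zero (by rw [h.ncard_incidenceSet hx]; norm_num)

lemma IsBipCubic.finite_edgeSet (h : IsBipCubic G A B) : E(G).Finite := by
  refine (h.finite.biUnion fun x hx => h.cubic.finite_incidenceSet hx).subset ?_
  intro e he
  obtain ⟨x, y, hl⟩ := G.exists_isLink_of_mem_edgeSet he
  simp only [Set.mem_iUnion]
  exact ⟨x, hl.left_mem, hl.inc_left⟩

lemma IsBipCubic.finite_left (h : IsBipCubic G A B) : A.Finite := h.finite.subset h.bip.left_subset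

lemma IsBipCubic.finite_right (h : IsBipCubic G A B) : B.Finite := h.symm.finite_left

lemma halfCut_of_superset {X : Set α} (hX : V(G) ⊆ X) (M : Set β) : halfCut G A X M = ∅ := by
  ext e
  simp only [halfCut, Set.mem_ofPred_eq, Set.mem_empty_iff_false, iff_false]
  rintro ⟨_, x, y, hl, _, _, hy⟩
  exact hy (hX hl.right_mem)

/-- Counting the edges of a cubic graph leaving `X`. -/
lemma IsBipCubic.halfCut_edgeSet (h : IsBipCubic G A B) (X : Set α) :
    3 * (A ∩ X).ncard + (halfCut G B X E(G)).ncard =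
      3 * (B ∩ X).ncard + (halfCut G A X E(G)).ncard := by
  have hA := h.finite_left.inter_of_left X
  have hB := h.finite_right.inter_of_left X
  have := sum_degIn_halfCut h.bip h.finite_edgeSet hA.toFinset hB.toFinset X (by simp) (by simp)
  rw [Finset.sum_congr rfl (g := fun _ => 3), Finset.sum_congr rfl (s₁ := hB.toFinset)
    (g := fun _ => 3)] at this
  · simpa [Set.ncard_eq_toFinset_card _ hA, Set.ncard_eq_toFinset_card _ hB, mul_comm] using this
  · intro x hx
    exact h.cubic.deg_eq x (h.bip.right_subset (by simp_all))
  · intro x hx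
    exact h.cubic.deg_eq x (h.bip.left_subset (by simp_all))

lemma IsBipCubic.ncard_eq (h : IsBipCubic G A B) : A.ncard = B.ncard := by
  have := h.halfCut_edgeSet V(G)
  rw [halfCut_of_superset subset_rfl, halfCut_of_superset subset_rfl,
    Set.inter_eq_left.2 h.bip.left_subset, Set.inter_eq_left.2 h.bip.right_subset] at this
  simp at this
  omega

lemma IsBipCubic.order_eq (h : IsBipCubic G A B) : order G = 2 * A.ncard := by
  rw [order, ← h.bip.union_eq, Set.ncard_union_eq h.bip.disjoint h.finite_left h.finite_right,
    ← h.ncard_eq]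
  omega

/-- Counting the edges of a perfect matching leaving `X`. -/
lemma IsBipCubic.halfCut_matching (h : IsBipCubic G A B) (X : Set α) {M : Set β}
    (hM : IsPerfectMatching G M) :
    (A ∩ X).ncard + (halfCut G B X M).ncard = (B ∩ X).ncard + (halfCut G A X M).ncard := by
  have hA := h.finite_left.inter_of_left X
  have hB := h.finite_right.inter_of_left X
  have := sum_degIn_halfCut h.bip (h.finite_edgeSet.subset hM.1) hA.toFinset hB.toFinset X
    (by simp) (by simp)
  rw [Finset.sum_congr rfl (g := fun _ => 1), Finset.sum_congr rfl (s₁ := hB.toFinset)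
    (g := fun _ => 1)] at this
  · simpa [Set.ncard_eq_toFinset_card _ hA, Set.ncard_eq_toFinset_card _ hB] using this
  · intro x hx
    exact hM.2 x (h.bip.right_subset (by simp_all))
  · intro x hx
    exact hM.2 x (h.bip.left_subset (by simp_all))

open Classical in
/-- The excess of the degrees over one is the same in both color classes. -/
lemma IsBipCubic.sum_excess (h : IsBipCubic G A B) {M : Set β} (hM : M ⊆ E(G)) (f : α → ℤ)
    (hf : ∀ x ∈ V(G), (degIn G M x : ℤ) = 1 + f x) :
    ∑ x ∈ h.finite_left.toFinset, f x = ∑ x ∈ h.finite_right.toFinset, f x := by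
  have := sum_degIn_halfCut h.bip (h.finite_edgeSet.subset hM) h.finite_left.toFinset
    h.finite_right.toFinset V(G) (by simp [h.bip.left_subset]) (by simp [h.bip.right_subset])
  rw [halfCut_of_superset subset_rfl, halfCut_of_superset subset_rfl] at this
  simp only [Set.ncard_empty, add_zero] at this
  have h2 : (∑ x ∈ h.finite_left.toFinset, (degIn G M x : ℤ)) =
      ∑ x ∈ h.finite_right.toFinset, (degIn G M x : ℤ) := by exact_mod_cast this
  rw [Finset.sum_congr rfl (g := fun x => 1 + f x), Finset.sum_congr rfl
    (s₁ := h.finite_right.toFinset) (g := fun x => 1 + f x), Finset.sum_add_distrib,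
    Finset.sum_add_distrib] at h2
  · have h3 := h.ncard_eq
    rw [Set.ncard_eq_toFinset_card _ h.finite_left, Set.ncard_eq_toFinset_card _ h.finite_right]
      at h3
    simp only [Finset.sum_const, h3] at h2
    linarith
  · intro x hx
    exact hf x (h.bip.right_subset (by simp_all))
  · intro x hx
    exact hf x (h.bip.left_subset (by simp_all))

lemma IsBipCubic.degIn_le (h : IsBipCubic G A B) {M : Set β} {x : α} (hx : x ∈ V(G)) :
    degIn G M x ≤ 3 := by
  rw [← h.cubic.ncard_incidenceSet hx]
  exact Set.ncard_le_ncard Set.inter_subset_right (h.cubic.finite_incidenceSet hx)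

lemma IsBipCubic.incidenceSet_subset (h : IsBipCubic G A B) {M : Set β} {x : α} (hx : x ∈ V(G))
    (hd : degIn G M x = 3) : G.incidenceSet x ⊆ M := by
  have := Set.eq_of_subset_of_ncard_le (Set.inter_subset_right (s := M) (t := G.incidenceSet x))
    (by rw [h.cubic.ncard_incidenceSet hx]; exact hd.ge) (h.cubic.finite_incidenceSet hx)
  rw [← this]; exact Set.inter_subset_left

/-- If all degrees but that of `v` are one, then so is that of `v`. -/
lemma IsBipCubic.degIn_eq_one (h : IsBipCubic G A B) {M : Set β} (hM : M ⊆ E(G)) {v : α}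
    (hv : v ∈ V(G)) (h1 : ∀ x ∈ V(G), x ≠ v → degIn G M x = 1) : degIn G M v = 1 := by
  classical
  have := h.sum_excess hM (fun x => if x = v then (degIn G M v : ℤ) - 1 else 0) (by
    intro x hx
    split_ifs with hxv
    · subst hxv; ring
    · simp [h1 x hx hxv])
  simp only [Finset.sum_ite_eq', Set.Finite.mem_toFinset] at this
  rcases h.bip.mem_or hv with hA | hA
  · simp [hA, h.bip.notMem_right hA] at this; omega
  · simp [hA, h.bip.notMem_left hA] at this; omega

/-- If all degrees are one but for `a` of degree three and `v`, then `v` has degree three too. -/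
lemma IsBipCubic.degIn_eq_three (h : IsBipCubic G A B) {M : Set β} (hM : M ⊆ E(G)) {a v : α}
    (ha : a ∈ V(G)) (hv : v ∈ V(G)) (hav : a ≠ v) (h3 : degIn G M a = 3)
    (h1 : ∀ x ∈ V(G), x ≠ v → x ≠ a → degIn G M x = 1) :
    degIn G M v = 3 ∧ (a ∈ A ↔ v ∈ B) := by
  classical
  have := h.sum_excess hM (fun x => (if x = v then (degIn G M v : ℤ) - 1 else 0) +
      (if x = a then 2 else 0)) (by
    intro x hx
    by_cases hxv : x = v
    · subst hxv; simp [hav.symm]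
    · by_cases hxa : x = a
      · subst hxa; simp [hav, h3]
      · simp [h1 x hx hxv hxa, hxa, hxv])
  simp only [Finset.sum_add_distrib, Finset.sum_ite_eq', Set.Finite.mem_toFinset] at this
  rcases h.bip.mem_or hv with hA | hA <;> rcases h.bip.mem_or ha with hB | hB
  · simp [hA, h.bip.notMem_right hA, hB, h.bip.notMem_right hB] at this; omega
  · simp [hA, h.bip.notMem_right hA, hB, h.bip.notMem_left hB] at this ⊢; omega
  · simp [hA, h.bip.notMem_left hA, hB, h.bip.notMem_right hB] at this ⊢; omega
  · simp [hA, h.bip.notMem_left hA, hB, h.bip.notMem_left hB] at this; omega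

/-- If all degrees are one but for those of `a` and `b`, which are three, and that of `v`, then
`v` has degree one. -/
lemma IsBipCubic.degIn_eq_one' (h : IsBipCubic G A B) {M : Set β} (hM : M ⊆ E(G)) {a b v : α}
    (ha : a ∈ V(G)) (hb : b ∈ V(G)) (hv : v ∈ V(G)) (hab : a ≠ b) (hav : a ≠ v) (hbv : b ≠ v)
    (h3 : degIn G M a = 3) (h3' : degIn G M b = 3)
    (h1 : ∀ x ∈ V(G), x ≠ v → x ≠ a → x ≠ b → degIn G M x = 1) :
    degIn G M v = 1 := by
  classical
  have := h.sum_excess hM (fun x => (if x = v then (degIn G M v : ℤ) - 1 else 0) +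
      ((if x = a then 2 else 0) + (if x = b then 2 else 0))) (by
    intro x hx
    by_cases hxv : x = v
    · subst hxv; simp [hav.symm, hbv.symm]
    · by_cases hxa : x = a
      · subst hxa; simp [hav, h3, hab]
      · by_cases hxb : x = b
        · subst hxb; simp [hbv, h3', hab.symm]
        · simp [h1 x hx hxv hxa hxb, hxa, hxv, hxb])
  simp only [Finset.sum_add_distrib, Finset.sum_ite_eq', Set.Finite.mem_toFinset] at this
  -- This bound is needed when `a` and `b` share a color and `v` has the other one: the balance of
  -- excesses would then give `v` degree five.
  have hle := h.degIn_le (M := M) hv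
  rcases h.bip.mem_or hv with hA | hA <;> rcases h.bip.mem_or ha with hB | hB <;>
    rcases h.bip.mem_or hb with hC | hC
  all_goals
    first
      | rw [if_pos hA, if_neg (h.bip.notMem_right hA)] at this
      | rw [if_neg (h.bip.notMem_left hA), if_pos hA] at this
    first
      | rw [if_pos hB, if_neg (h.bip.notMem_right hB)] at this
      | rw [if_neg (h.bip.notMem_left hB), if_pos hB] at this
    first
      | rw [if_pos hC, if_neg (h.bip.notMem_right hC)] at this
      | rw [if_neg (h.bip.notMem_left hC), if_pos hC] at this
    omega

lemma IsLambdaMatchable.symm {a b : α} (h : IsLambdaMatchable G a b) : IsLambdaMatchable G b a := by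
  obtain ⟨ha, hb, hab, M, hM, h1, h2, h3⟩ := h
  exact ⟨hb, ha, hab.symm, M, hM, h2, h1, fun x hx hxb hxa => h3 x hx hxa hxb⟩

/-- The excess two at `a` can only be balanced by the excess two at `b` in the other color class. -/
lemma IsBipCubic.mem_iff_of_isLambdaMatchable (h : IsBipCubic G A B) {a b : α}
    (hm : IsLambdaMatchable G a b) : a ∈ A ↔ b ∈ B := by
  obtain ⟨ha, hb, hab, M, hM, h1, h2, h3⟩ := hm
  exact (h.degIn_eq_three hM ha hb hab h1 fun x hx hxb hxa => h3 x hx hxa hxb).2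

/-- The number of ordered `λ`-matchable pairs. -/
noncomputable def numPairs (G : Graph α β) : ℕ :=
  {p : α × α | IsLambdaMatchable G p.1 p.2}.ncard

lemma finite_pairs (h : V(G).Finite) : {p : α × α | IsLambdaMatchable G p.1 p.2}.Finite :=
  (h.prod h).subset fun _ hp => ⟨hp.1, hp.2.1⟩

/-- Counting ordered pairs removes the color classes from the statement, so contractions can be
handled without tracking which class became which. -/
lemma IsBipCubic.numPairs_eq (h : IsBipCubic G A B) : numPairs G = 2 * rho G A B := by
  have hfin := finite_pairs h.finite
  have h1 : {p : α × α | IsLambdaMatchable G p.1 p.2} =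
      {p : α × α | p.1 ∈ A ∧ p.2 ∈ B ∧ IsLambdaMatchable G p.1 p.2} ∪
      Prod.swap '' {p : α × α | p.1 ∈ A ∧ p.2 ∈ B ∧ IsLambdaMatchable G p.1 p.2} := by
    ext ⟨x, y⟩
    simp only [Set.mem_ofPred_eq, Set.mem_union, Set.mem_image, Prod.exists, Prod.swap_prod_mk,
      Prod.mk.injEq]
    constructor
    · intro hm
      rcases h.bip.mem_or hm.1 with hA | hA
      · exact Or.inl ⟨hA, (h.mem_iff_of_isLambdaMatchable hm).1 hA, hm⟩
      · exact Or.inr ⟨y, x, ⟨(h.symm.mem_iff_of_isLambdaMatchable hm).1 hA, hA, hm.symm⟩, rfl, rfl⟩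
    · rintro (h1 | ⟨y', x', h1, rfl, rfl⟩)
      · exact h1.2.2
      · exact h1.2.2.symm
  have hfin' : {p : α × α | p.1 ∈ A ∧ p.2 ∈ B ∧ IsLambdaMatchable G p.1 p.2}.Finite :=
    hfin.subset fun _ hp => hp.2.2
  rw [numPairs, h1, Set.ncard_union_eq _ hfin' (hfin'.image _),
    Set.ncard_image_of_injective _ Prod.swap_injective, rho]
  · ring
  · rw [Set.disjoint_left]
    rintro ⟨x, y⟩ h1 ⟨⟨y', x'⟩, h2, h3⟩
    simp only [Prod.swap_prod_mk, Prod.mk.injEq] at h3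
    obtain ⟨rfl, rfl⟩ := h3
    exact h.bip.notMem_right h1.1 h2.2.1

end Counting

/-! ### Hall's theorem and perfect matchings. -/

section Hall

variable {α : Type u} {β : Type v} {G : Graph α β} {A B : Set α}

/-- Hall's theorem for a bipartite multigraph, between subsets `A'`, `B'` of the color classes. -/
lemma exists_matching_between (h : IsBipartition G A B) {A' B' : Set α} (hA' : A' ⊆ A)
    (hB' : B' ⊆ B) (hfA : A'.Finite) (hfB : B'.Finite) (hcard : A'.ncard = B'.ncard)
    (hall : ∀ S ⊆ A', S.ncard ≤ {y ∈ B' | ∃ x ∈ S, G.Adj x y}.ncard) :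
    ∃ M ⊆ E(G), (∀ x ∈ A' ∪ B', degIn G M x = 1) ∧
      ∀ x ∉ A' ∪ B', M ∩ G.incidenceSet x = ∅ := by
  classical
  have : Fintype A' := hfA.fintype
  let t : A' → Finset α := fun x => hfB.toFinset.filter fun y => G.Adj x y
  have ht : ∀ s : Finset A', s.card ≤ (s.biUnion t).card := by
    intro s
    have h1 := hall (Subtype.val '' (s : Set A')) (by rintro _ ⟨x, _, rfl⟩; exact x.2)
    rw [Set.ncard_image_of_injective _ Subtype.val_injective, Set.ncard_coe_finset] at h1
    refine h1.trans (le_of_eq ?_)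
    rw [← Set.ncard_coe_finset]
    congr 1
    ext y
    simp only [Set.mem_image, Finset.mem_coe, Set.mem_ofPred_eq, Finset.coe_biUnion, t,
      Set.mem_iUnion, Finset.mem_filter, Set.Finite.mem_toFinset]
    constructor
    · rintro ⟨hy, _, ⟨x, hx, rfl⟩, hxy⟩
      exact ⟨x, hx, hy, hxy⟩
    · rintro ⟨x, hx, hy, hxy⟩
      exact ⟨hy, x, ⟨x, hx, rfl⟩, hxy⟩
  obtain ⟨f, hf, hft⟩ := (Finset.all_card_le_biUnion_card_iff_exists_injective t).1 ht
  have hfB' : ∀ x, f x ∈ B' := fun x => by have := hft x; simp [t] at this; exact this.1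
  have hadj : ∀ x : A', G.Adj x (f x) := fun x => by have := hft x; simp [t] at this; exact this.2
  choose g hg using hadj
  -- Equal sizes make the injection given by Hall's theorem a bijection onto `B'`.
  have hsurj : ∀ y ∈ B', ∃ x, f x = y := by
    have h1 : Set.range f = B' := by
      refine Set.eq_of_subset_of_ncard_le (by rintro _ ⟨x, rfl⟩; exact hfB' x) ?_ hfB
      rw [← Set.image_univ, Set.ncard_image_of_injective _ hf, Set.ncard_univ,
        Nat.card_coe_set_eq, hcard]
    intro y hy
    rw [← h1] at hy; exact hy
  have hincA : ∀ (x : A') (z : α), z ∈ A → G.Inc (g x) z → z = x := fun x z hz hi =>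
    h.eq_of_inc hi (hg x).inc_left hz (hA' x.2)
  have hincB : ∀ (x : A') (z : α), z ∈ B → G.Inc (g x) z → z = f x := fun x z hz hi =>
    h.symm.eq_of_inc hi (hg x).inc_right hz (hB' (hfB' x))
  refine ⟨Set.range g, ?_, ?_, ?_⟩
  · rintro _ ⟨x, rfl⟩; exact (hg x).edge_mem
  · rintro z (hz | hz)
    · have : Set.range g ∩ G.incidenceSet z = {g ⟨z, hz⟩} := by
        ext e
        constructor
        · rintro ⟨⟨x, rfl⟩, hi⟩
          have h1 := hincA x z (hA' hz) hi
          subst h1; rfl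
        · rintro rfl
          exact ⟨⟨_, rfl⟩, (hg ⟨z, hz⟩).inc_left⟩
      rw [degIn, this, Set.ncard_singleton]
    · obtain ⟨x, rfl⟩ := hsurj z hz
      have : Set.range g ∩ G.incidenceSet (f x) = {g x} := by
        ext e
        constructor
        · rintro ⟨⟨x', rfl⟩, hi⟩
          have h1 := hf (hincB x' (f x) (hB' hz) hi)
          subst h1; rfl
        · rintro rfl
          exact ⟨⟨_, rfl⟩, (hg x).inc_right⟩
      rw [degIn, this, Set.ncard_singleton]
  · intro z hz
    ext e
    simp only [Set.mem_inter_iff, Set.mem_range, Graph.mem_incidenceSet, Set.mem_empty_iff_false,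
      iff_false]
    rintro ⟨⟨x, rfl⟩, hi⟩
    apply hz
    rcases h.mem_or hi.vertex_mem with h1 | h1
    · rw [hincA x z h1 hi]; exact Or.inl x.2
    · rw [hincB x z h1 hi]; exact Or.inr (hfB' x)

lemma degIn_union_of_inter_eq_empty {M N : Set β} {x : α} (h : M ∩ G.incidenceSet x = ∅) :
    degIn G (M ∪ N) x = degIn G N x := by
  rw [degIn, degIn, Set.union_inter_distrib_right, h, Set.empty_union]

lemma degIn_union_of_inter_eq_empty' {M N : Set β} {x : α} (h : N ∩ G.incidenceSet x = ∅) :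
    degIn G (M ∪ N) x = degIn G M x := by
  rw [Set.union_comm, degIn_union_of_inter_eq_empty h]

/-- In a finite bipartite cubic graph each edge is in a perfect matching. -/
lemma IsBipCubic.exists_isPerfectMatching (h : IsBipCubic G A B) {e : β} (he : e ∈ E(G)) :
    ∃ M, IsPerfectMatching G M ∧ e ∈ M := by
  obtain ⟨a, ha, b, hb, hl⟩ := h.bip.exists_isLink he
  have hfA := h.finite_left
  have hfB := h.finite_right
  obtain ⟨M, hM, h1, h0⟩ := exists_matching_between h.bip (A' := A \ {a}) (B' := B \ {b})
    Set.sdiff_subset Set.sdiff_subset (hfA.subset Set.sdiff_subset) (hfB.subset Set.sdiff_subset)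
    (by rw [Set.ncard_sdiff_singleton_of_mem ha, Set.ncard_sdiff_singleton_of_mem hb, h.ncard_eq])
    (by
      intro S hS
      by_contra! hlt
      -- No edge leaves `S ∪ insert b T` from `A`, and the edge `e` leaves it from `b`. Hence `3 *
      -- |S| < 3 * (|T| + 1)`, against `|T| < |S|`.
      set T := {y ∈ B \ {b} | ∃ x ∈ S, G.Adj x y} with hT
      have hTB : T ⊆ B \ {b} := fun y hy => hy.1
      have hAX : A ∩ (S ∪ insert b T) = S := by
        ext x
        have h2 : x ∈ T → x ∈ B := fun hx => (hTB hx).1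
        have h3 : x ∈ S → x ∈ A := fun hx => (hS hx).1
        have h4 : x ∈ A → x ∉ B := h.bip.notMem_right
        simp only [Set.mem_inter_iff, Set.mem_union, Set.mem_insert_iff]
        grind
      have hBX : B ∩ (S ∪ insert b T) = insert b T := by
        ext x
        have h2 : x ∈ T → x ∈ B := fun hx => (hTB hx).1
        have h3 : x ∈ S → x ∈ A := fun hx => (hS hx).1
        have h4 : x ∈ A → x ∉ B := h.bip.notMem_right
        simp only [Set.mem_inter_iff, Set.mem_union, Set.mem_insert_iff]
        grind
      have hcut := h.halfCut_edgeSet (S ∪ insert b T)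
      have hempty : halfCut G A (S ∪ insert b T) E(G) = ∅ := by
        rw [Set.eq_empty_iff_forall_notMem]
        rintro f ⟨hf, x, y, hxy, hx, hxX, hy⟩
        have hxS : x ∈ S := by rw [← hAX]; exact ⟨hx, hxX⟩
        apply hy
        by_cases hyb : y = b
        · exact Or.inr (Or.inl hyb)
        · exact Or.inr (Or.inr ⟨⟨h.bip.mem_right_of_isLink hxy hx, hyb⟩, x, hxS, f, hxy⟩)
      have hpos : 0 < (halfCut G B (S ∪ insert b T) E(G)).ncard := by
        rw [Set.ncard_pos (h.finite_edgeSet.subset fun e he => he.1)]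
        refine ⟨e, he, b, a, hl.symm, hb, by simp, ?_⟩
        rintro (h2 | h2 | h2)
        · exact (hS h2).2 rfl
        · subst h2; exact h.bip.notMem_right ha hb
        · exact h.bip.notMem_right ha (hTB h2).1
      rw [hAX, hBX, hempty, Set.ncard_insert_of_notMem (fun h2 => (hTB h2).2 rfl)
        (hfB.subset (hTB.trans Set.sdiff_subset)), Set.ncard_empty] at hcut
      omega)
  refine ⟨{e} ∪ M, ⟨?_, ?_⟩, by simp⟩
  · simp [Set.insert_subset_iff, he, hM]
  · intro x hx
    by_cases hxab : x = a ∨ x = b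
    · rw [degIn_union_of_inter_eq_empty' (h0 x _)]
      · have : {e} ∩ G.incidenceSet x = {e} := by
          rw [Set.inter_eq_left, Set.singleton_subset_iff]
          rcases hxab with rfl | rfl
          · exact hl.inc_left
          · exact hl.inc_right
        rw [degIn, this, Set.ncard_singleton]
      · rcases hxab with rfl | rfl
        · simp [h.bip.notMem_right ha]
        · simp [h.bip.notMem_left hb]
    · rw [degIn_union_of_inter_eq_empty, h1]
      · rcases h.bip.mem_or hx with hA | hA
        · left; exact ⟨hA, fun h2 => hxab (Or.inl h2)⟩
        · right; exact ⟨hA, fun h2 => hxab (Or.inr h2)⟩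
      · rw [Set.eq_empty_iff_forall_notMem]
        rintro f ⟨rfl, hi⟩
        exact hxab (Graph.Inc.eq_or_eq_of_isLink hi hl)

end Hall

/-! ### 3-edge-connectivity, and Hall's condition for λ-matchable pairs. -/

section ThreeCuts

variable {α : Type u} {β : Type v} {G : Graph α β} {A B : Set α}

/-- All cuts of `G` (with nonempty shores) have at least three edges. -/
def IsThreeEdgeConnected (G : Graph α β) : Prop :=
  ∀ X ⊆ V(G), X.Nonempty → X ≠ V(G) → 3 ≤ (cut G X).ncard

lemma cut_subset (X : Set α) : cut G X ⊆ E(G) := by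
  rintro e ⟨x, y, hl, _, _⟩; exact hl.edge_mem

lemma IsBipCubic.ncard_cut (h : IsBipCubic G A B) (X : Set α) :
    (cut G X).ncard = (halfCut G A X E(G)).ncard + (halfCut G B X E(G)).ncard := by
  rw [← ncard_cut_inter h.bip X h.finite_edgeSet, Set.inter_eq_left.2 (cut_subset X)]

/-- A shore with one more vertex in `B` than in `A` and all cut edges at `B` is tight. -/
lemma IsBipCubic.isNontrivialTightCut (h : IsBipCubic G A B) {X : Set α} (hX : X ⊆ V(G))
    (hn : X.Nontrivial) (hn' : (V(G) \ X).Nontrivial) (h0 : halfCut G A X E(G) = ∅)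
    (hc : (B ∩ X).ncard = (A ∩ X).ncard + 1) : IsNontrivialTightCut G X := by
  refine ⟨hX, hn, hn', fun M hM => ?_⟩
  rw [ncard_cut_inter h.bip X (h.finite_edgeSet.subset hM.1)]
  have h1 := h.halfCut_matching X hM
  have h2 : halfCut G A X M = ∅ := by
    rw [Set.eq_empty_iff_forall_notMem] at h0 ⊢
    exact fun e he => h0 e ⟨hM.1 he.1, he.2⟩
  rw [h2, Set.ncard_empty] at h1 ⊢
  omega

lemma IsBipCubic.exists_ne (h : IsBipCubic G A B) {x : α} (hx : x ∈ V(G)) :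
    ∃ y ∈ V(G), y ≠ x := by
  have h3 := h.cubic.ncard_incidenceSet hx
  obtain ⟨e, y, hl⟩ : (G.incidenceSet x).Nonempty := by
    rw [Set.nonempty_iff_ne_empty]; intro h0; rw [h0] at h3; simp at h3
  exact ⟨y, hl.right_mem, (h.bip.ne_of_isLink hl).symm⟩

/-- A 3-edge-connected bipartite cubic graph of order more than two is simple. -/
lemma IsBipCubic.eq_of_isLink (h : IsBipCubic G A B) (h3 : IsThreeEdgeConnected G)
    (hn : 2 < order G) {e f : β} {x y : α} (he : G.IsLink e x y) (hf : G.IsLink f x y) :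
    e = f := by
  wlog hxA : x ∈ A generalizing A B
  · exact this h.symm ((h.bip.mem_or he.left_mem).resolve_left hxA)
  have hyB := h.bip.mem_right_of_isLink he hxA
  by_contra hne
  have hxy := h.bip.ne_of_isLink he
  -- With two parallel edges between them, `x` and `y` send at most one further edge each out of
  -- `{x, y}`, which would be a cut of at most two edges.
  have hX := h3 {x, y} (by simp [Set.insert_subset_iff, he.left_mem, he.right_mem]) (by simp) (by
    intro hV
    rw [order, ← hV, Set.ncard_pair hxy] at hn
    exact lt_irrefl _ hn)
  have hsub : cut G {x, y} ⊆ (G.incidenceSet x \ {e, f}) ∪ (G.incidenceSet y \ {e, f}) := by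
    rintro g ⟨z, w, hl, hz, hw⟩
    have h1 : ∀ g', G.IsLink g' x y → g ≠ g' := by
      rintro g' hg' rfl
      rcases hl.right_eq_or_eq hg' with rfl | rfl <;> simp at hw
    have h2 : g ∉ ({e, f} : Set β) := by
      rintro (rfl | rfl)
      · exact h1 _ he rfl
      · exact h1 _ hf rfl
    rcases hz with rfl | rfl
    · exact Or.inl ⟨hl.inc_left, h2⟩
    · exact Or.inr ⟨hl.inc_left, h2⟩
  have hfx := h.cubic.finite_incidenceSet he.left_mem
  have hfy := h.cubic.finite_incidenceSet he.right_mem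
  have hle := Set.ncard_le_ncard hsub
    ((hfx.subset Set.sdiff_subset).union (hfy.subset Set.sdiff_subset))
  have hu := Set.ncard_union_le (G.incidenceSet x \ {e, f}) (G.incidenceSet y \ {e, f})
  rw [Set.ncard_sdiff (by
      simp [Set.insert_subset_iff, he.inc_left, hf.inc_left]) (by simp),
    Set.ncard_sdiff (by
      simp [Set.insert_subset_iff, he.inc_right, hf.inc_right]) (by simp),
    Set.ncard_pair hne, h.cubic.ncard_incidenceSet he.left_mem,
    h.cubic.ncard_incidenceSet he.right_mem] at hu
  omega

/-- The set of neighbors of a vertex. -/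
def nbrs (G : Graph α β) (x : α) : Set α := {y | G.Adj x y}

lemma IsBipCubic.ncard_nbrs (h : IsBipCubic G A B) (h3 : IsThreeEdgeConnected G)
    (hn : 2 < order G) {x : α} (hx : x ∈ V(G)) : (nbrs G x).ncard = 3 := by
  rw [← h.cubic.ncard_incidenceSet hx]
  refine (Set.ncard_congr (fun e (he : G.Inc e x) => he.other) ?_ ?_ ?_).symm
  · intro e he
    exact ⟨e, Graph.Inc.isLink_other he⟩
  · intro e f he hf hef
    have h1 := Graph.Inc.isLink_other he
    have h2 := Graph.Inc.isLink_other hf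
    rw [← hef] at h2
    exact h.eq_of_isLink h3 hn h1 h2
  · rintro y ⟨e, hl⟩
    exact ⟨e, hl.inc_left, (Graph.Inc.isLink_other hl.inc_left).right_unique hl⟩

lemma IsBipartition.nbrs_subset (h : IsBipartition G A B) {x : α} (hx : x ∈ A) :
    nbrs G x ⊆ B := by
  rintro y ⟨e, hl⟩; exact h.mem_right_of_isLink hl hx

lemma IsBipCubic.degIn_incidenceSet_of_adj (h : IsBipCubic G A B) (h3 : IsThreeEdgeConnected G)
    (hn : 2 < order G) {a x : α} (hax : G.Adj a x) : degIn G (G.incidenceSet a) x = 1 := by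
  obtain ⟨e, he⟩ := hax
  rw [degIn, Set.ncard_eq_one]
  refine ⟨e, ?_⟩
  ext f
  simp only [Set.mem_inter_iff, Graph.mem_incidenceSet, Set.mem_singleton_iff]
  constructor
  · rintro ⟨hfa, hfx⟩
    obtain ⟨y, hy⟩ := hfa
    rcases hfx.eq_or_eq_of_isLink hy with rfl | rfl
    · exact absurd rfl (h.bip.ne_of_isLink he)
    · exact h.eq_of_isLink h3 hn hy he
  · rintro rfl
    exact ⟨he.inc_left, he.inc_right⟩

lemma incidenceSet_inter_eq_empty {a x : α} (hax : ¬ G.Adj a x) (hne : a ≠ x) :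
    G.incidenceSet a ∩ G.incidenceSet x = ∅ := by
  rw [Set.eq_empty_iff_forall_notMem]
  rintro f ⟨⟨y, hy⟩, hfx⟩
  rcases Graph.Inc.eq_or_eq_of_isLink hfx hy with rfl | rfl
  · exact hne rfl
  · exact hax ⟨f, hy⟩

/-- Extending the stars of `a` and `b` by a matching. -/
lemma IsBipCubic.isLambdaMatchable_of_hall (h : IsBipCubic G A B) (h3 : IsThreeEdgeConnected G)
    (hn : 2 < order G) {a b : α} (ha : a ∈ A) (hb : b ∈ B)
    (hall : ∀ S ⊆ A \ insert a (nbrs G b),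
      S.ncard ≤ {y ∈ B \ insert b (nbrs G a) | ∃ x ∈ S, G.Adj x y}.ncard) :
    IsLambdaMatchable G a b := by
  have hfA := h.finite_left
  have hfB := h.finite_right
  have haV := h.bip.left_subset ha
  have hbV := h.bip.right_subset hb
  have hab : a ≠ b := by rintro rfl; exact h.bip.notMem_right ha hb
  have hsubA : insert a (nbrs G b) ⊆ A := Set.insert_subset ha (h.symm.bip.nbrs_subset hb)
  have hsubB : insert b (nbrs G a) ⊆ B := Set.insert_subset hb (h.bip.nbrs_subset ha)
  -- The stars cover three vertices of each color if `a` and `b` are adjacent and four otherwise, so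
  -- equally many remain to be matched.
  have hcard : (insert a (nbrs G b)).ncard = (insert b (nbrs G a)).ncard := by
    by_cases hadj : G.Adj a b
    · rw [Set.insert_eq_of_mem (show a ∈ nbrs G b from hadj.symm),
        Set.insert_eq_of_mem (show b ∈ nbrs G a from hadj), h.ncard_nbrs h3 hn haV,
        h.ncard_nbrs h3 hn hbV]
    · rw [Set.ncard_insert_of_notMem (show a ∉ nbrs G b from fun h1 => hadj (Graph.Adj.symm h1))
        (hfA.subset (h.symm.bip.nbrs_subset hb)), Set.ncard_insert_of_notMem (show b ∉ nbrs G a from hadj)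
        (hfB.subset (h.bip.nbrs_subset ha)), h.ncard_nbrs h3 hn haV, h.ncard_nbrs h3 hn hbV]
  obtain ⟨M, hM, h1, h0⟩ := exists_matching_between h.bip (A' := A \ insert a (nbrs G b))
    (B' := B \ insert b (nbrs G a))
    Set.sdiff_subset Set.sdiff_subset (hfA.subset Set.sdiff_subset) (hfB.subset Set.sdiff_subset)
    (by rw [Set.ncard_sdiff hsubA (hfA.subset hsubA), Set.ncard_sdiff hsubB (hfB.subset hsubB),
      hcard, h.ncard_eq]) hall
  have hx3 : ∀ N : Set β, ∀ x ∈ V(G), G.incidenceSet x ⊆ N → degIn G N x = 3 := by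
    intro N x hx hsub
    rw [degIn, Set.inter_eq_right.2 hsub, h.cubic.ncard_incidenceSet hx]
  refine ⟨haV, hbV, hab, (G.incidenceSet a ∪ G.incidenceSet b) ∪ M, ?_, ?_, ?_, ?_⟩
  · exact Set.union_subset (Set.union_subset (G.incidenceSet_subset_edgeSet a)
      (G.incidenceSet_subset_edgeSet b)) hM
  · exact hx3 _ a haV fun e he => Or.inl (Or.inl he)
  · exact hx3 _ b hbV fun e he => Or.inl (Or.inr he)
  · intro x hx hxa hxb
    rcases h.bip.mem_or hx with hxA | hxB
    · have hna : G.incidenceSet a ∩ G.incidenceSet x = ∅ := incidenceSet_inter_eq_empty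
        (fun hadj => h.bip.notMem_right hxA (h.bip.nbrs_subset ha hadj)) hxa.symm
      by_cases hadj : G.Adj b x
      · rw [degIn_union_of_inter_eq_empty' (h0 x _), degIn_union_of_inter_eq_empty hna,
          h.degIn_incidenceSet_of_adj h3 hn hadj]
        simp [nbrs, hadj, h.bip.notMem_right hxA]
      · rw [degIn_union_of_inter_eq_empty, h1]
        · left; exact ⟨hxA, by simp [nbrs, hadj, hxa]⟩
        · rw [Set.union_inter_distrib_right, hna, incidenceSet_inter_eq_empty hadj hxb.symm,
            Set.union_empty]
    · have hnb : G.incidenceSet b ∩ G.incidenceSet x = ∅ := incidenceSet_inter_eq_empty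
        (fun hadj => h.bip.notMem_left hxB (h.symm.bip.nbrs_subset hb hadj)) hxb.symm
      by_cases hadj : G.Adj a x
      · rw [degIn_union_of_inter_eq_empty' (h0 x _), degIn_union_of_inter_eq_empty' hnb,
          h.degIn_incidenceSet_of_adj h3 hn hadj]
        simp [nbrs, hadj, h.bip.notMem_left hxB]
      · rw [degIn_union_of_inter_eq_empty, h1]
        · right; exact ⟨hxB, by simp [nbrs, hadj, hxb]⟩
        · rw [Set.union_inter_distrib_right, hnb, incidenceSet_inter_eq_empty hadj hxa.symm,
            Set.union_empty]

/-- Adjacent vertices form a `λ`-matchable pair. -/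
lemma IsBipCubic.isLambdaMatchable_of_adj (h : IsBipCubic G A B) (h3 : IsThreeEdgeConnected G)
    (hn : 2 < order G) {a b : α} (ha : a ∈ A) (hab : G.Adj a b) : IsLambdaMatchable G a b := by
  have hb : b ∈ B := h.bip.nbrs_subset ha hab
  have hfA := h.finite_left
  have hfB := h.finite_right
  have haV := h.bip.left_subset ha
  have hbV := h.bip.right_subset hb
  refine h.isLambdaMatchable_of_hall h3 hn ha hb fun S hS => ?_
  by_contra! hlt
  set T := {y ∈ B \ insert b (nbrs G a) | ∃ x ∈ S, G.Adj x y} with hT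
  have hTB : T ⊆ B \ insert b (nbrs G a) := fun y hy => hy.1
  set N := nbrs G a \ {b} with hN
  have hNB : N ⊆ B := Set.sdiff_subset.trans (h.bip.nbrs_subset ha)
  -- A violator `S` of Hall's condition yields a cut that is too small. As `|N| = 2` and `|T| <
  -- |S|`, the set `X` has no more vertices in `B` than in `A`. Only the edge `ab` can leave it from
  -- `A`, so at most one edge leaves it from `B`, and the cut has at most two edges.
  set X := insert a S ∪ (N ∪ T) with hX
  have hAX : A ∩ X = insert a S := by
    ext x
    have h1 : x ∈ S → x ∈ A := fun hx => (hS hx).1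
    have h2 : x ∈ N → x ∈ B := fun hx => hNB hx
    have h3 : x ∈ T → x ∈ B := fun hx => (hTB hx).1
    have h4 : x ∈ A → x ∉ B := h.bip.notMem_right
    simp only [hX, Set.mem_inter_iff, Set.mem_union, Set.mem_insert_iff]
    grind
  have hBX : B ∩ X = N ∪ T := by
    ext x
    have h1 : x ∈ S → x ∈ A := fun hx => (hS hx).1
    have h2 : x ∈ N → x ∈ B := fun hx => hNB hx
    have h3 : x ∈ T → x ∈ B := fun hx => (hTB hx).1
    have h4 : x ∈ A → x ∉ B := h.bip.notMem_right
    simp only [hX, Set.mem_inter_iff, Set.mem_union, Set.mem_insert_iff]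
    grind
  have hbX : b ∉ X := by
    intro hbX
    rcases (hBX ▸ (⟨hb, hbX⟩ : b ∈ B ∩ X) : b ∈ N ∪ T) with h1 | h1
    · exact h1.2 rfl
    · exact (hTB h1).2 (Or.inl rfl)
  have hXV : X ⊆ V(G) := by
    rintro x ((rfl | hx) | hx | hx)
    · exact haV
    · exact h.bip.left_subset (hS hx).1
    · exact h.bip.right_subset (hNB hx)
    · exact h.bip.right_subset (hTB hx).1
  have hc := h3 X hXV ⟨a, by simp [hX]⟩ (fun hV => hbX (hV ▸ hbV))
  rw [h.ncard_cut] at hc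
  obtain ⟨e, he⟩ := hab
  have hhalf : (halfCut G A X E(G)).ncard ≤ 1 := by
    rw [← Set.ncard_singleton e]
    refine Set.ncard_le_ncard ?_ (by simp)
    rintro f ⟨hf, x, y, hxy, hx, hxX, hy⟩
    have hxS : x ∈ insert a S := hAX ▸ ⟨hx, hxX⟩
    have hyB := h.bip.mem_right_of_isLink hxy hx
    rcases hxS with rfl | hxS
    · have : y = b := by
        by_contra hyb
        exact hy (Or.inr (Or.inl ⟨⟨f, hxy⟩, hyb⟩))
      subst this
      exact h.eq_of_isLink h3 hn hxy he
    · exfalso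
      have hyb : y ≠ b := by
        rintro rfl
        exact (hS hxS).2 (Or.inr ⟨f, hxy.symm⟩)
      refine hy (Or.inr ?_)
      by_cases hya : G.Adj a y
      · exact Or.inl ⟨hya, hyb⟩
      · exact Or.inr ⟨⟨hyB, by simp [nbrs, hya, hyb]⟩, x, hxS, f, hxy⟩
  have hcut := h.halfCut_edgeSet X
  have hcN : N.ncard = 2 := by
    rw [hN, Set.ncard_sdiff_singleton_of_mem (show b ∈ nbrs G a from ⟨e, he⟩),
      h.ncard_nbrs h3 hn haV]
  have hcS : (insert a S).ncard = S.ncard + 1 := Set.ncard_insert_of_notMem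
    (fun h1 => (hS h1).2 (Or.inl rfl)) (hfA.subset (hS.trans Set.sdiff_subset))
  have hcNT := Set.ncard_union_le N T
  rw [hAX, hBX, hcS] at hcut
  omega

/-- In a brace of order more than two all pairs of vertices of distinct colors are
`λ`-matchable. -/
lemma IsBipCubic.isLambdaMatchable_of_free (h : IsBipCubic G A B) (h3 : IsThreeEdgeConnected G)
    (hn : 2 < order G) (hfree : ∀ X, ¬ IsNontrivialTightCut G X) {a b : α} (ha : a ∈ A)
    (hb : b ∈ B) : IsLambdaMatchable G a b := by
  by_cases hab : G.Adj a b
  · exact h.isLambdaMatchable_of_adj h3 hn ha hab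
  have hfA := h.finite_left
  have hfB := h.finite_right
  have haV := h.bip.left_subset ha
  have hbV := h.bip.right_subset hb
  refine h.isLambdaMatchable_of_hall h3 hn ha hb fun S hS => ?_
  by_contra! hlt
  set T := {y ∈ B \ insert b (nbrs G a) | ∃ x ∈ S, G.Adj x y} with hT
  have hTB : T ⊆ B \ insert b (nbrs G a) := fun y hy => hy.1
  set N := nbrs G a with hN
  have hNB : N ⊆ B := h.bip.nbrs_subset ha
  -- Here `|N| = 3`, so `X` has at most one more vertex in `B` than in `A`, and no edge leaves it
  -- from `A`. By 3-edge-connectivity the surplus is exactly one, which makes the cut tight.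
  set X := insert a S ∪ (N ∪ T) with hX
  have hAX : A ∩ X = insert a S := by
    ext x
    have h1 : x ∈ S → x ∈ A := fun hx => (hS hx).1
    have h2 : x ∈ N → x ∈ B := fun hx => hNB hx
    have h3 : x ∈ T → x ∈ B := fun hx => (hTB hx).1
    have h4 : x ∈ A → x ∉ B := h.bip.notMem_right
    simp only [hX, Set.mem_inter_iff, Set.mem_union, Set.mem_insert_iff]
    grind
  have hBX : B ∩ X = N ∪ T := by
    ext x
    have h1 : x ∈ S → x ∈ A := fun hx => (hS hx).1
    have h2 : x ∈ N → x ∈ B := fun hx => hNB hx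
    have h3 : x ∈ T → x ∈ B := fun hx => (hTB hx).1
    have h4 : x ∈ A → x ∉ B := h.bip.notMem_right
    simp only [hX, Set.mem_inter_iff, Set.mem_union, Set.mem_insert_iff]
    grind
  have hbX : b ∉ X := by
    intro hbX
    rcases (hBX ▸ (⟨hb, hbX⟩ : b ∈ B ∩ X) : b ∈ N ∪ T) with h1 | h1
    · exact hab h1
    · exact (hTB h1).2 (Or.inl rfl)
  have hXV : X ⊆ V(G) := by
    rintro x ((rfl | hx) | hx | hx)
    · exact haV
    · exact h.bip.left_subset (hS hx).1
    · exact h.bip.right_subset (hNB hx)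
    · exact h.bip.right_subset (hTB hx).1
  have hc := h3 X hXV ⟨a, by simp [hX]⟩ (fun hV => hbX (hV ▸ hbV))
  rw [h.ncard_cut] at hc
  have hhalf : halfCut G A X E(G) = ∅ := by
    rw [Set.eq_empty_iff_forall_notMem]
    rintro f ⟨hf, x, y, hxy, hx, hxX, hy⟩
    have hxS : x ∈ insert a S := hAX ▸ ⟨hx, hxX⟩
    have hyB := h.bip.mem_right_of_isLink hxy hx
    refine hy (Or.inr ?_)
    by_cases hya : G.Adj a y
    · exact Or.inl hya
    · rcases hxS with rfl | hxS
      · exact absurd ⟨f, hxy⟩ hya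
      · have hyb : y ≠ b := by
          rintro rfl
          exact (hS hxS).2 (Or.inr ⟨f, hxy.symm⟩)
        exact Or.inr ⟨⟨hyB, by rintro (h1 | h1); exacts [hyb h1, hya h1]⟩, x, hxS, f, hxy⟩
  have hcut := h.halfCut_edgeSet X
  have hcN : N.ncard = 3 := h.ncard_nbrs h3 hn haV
  have hcS : (insert a S).ncard = S.ncard + 1 := Set.ncard_insert_of_notMem
    (fun h1 => (hS h1).2 (Or.inl rfl)) (hfA.subset (hS.trans Set.sdiff_subset))
  have hcNT := Set.ncard_union_le N T
  rw [hAX, hBX, hcS] at hcut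
  rw [hhalf, Set.ncard_empty] at hc hcut
  refine hfree X (h.isNontrivialTightCut hXV ?_ ?_ hhalf (by rw [hAX, hBX, hcS]; omega))
  · obtain ⟨y, hy⟩ : N.Nonempty := by
      rw [← Set.ncard_pos (hfB.subset hNB)]; omega
    exact ⟨a, by simp [hX], y, by simp [hX, hy], by
      rintro rfl; exact h.bip.notMem_right ha (hNB hy)⟩
  -- Outside `X` lie `b` and any neighbor of `b`: such a neighbor is not `a`, and `S` avoids the
  -- neighbors of `b`.
  · obtain ⟨y, hy⟩ : (nbrs G b).Nonempty := by
      rw [← Set.ncard_pos (hfA.subset (h.symm.bip.nbrs_subset hb)), h.ncard_nbrs h3 hn hbV]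
      norm_num
    have hyA := h.symm.bip.nbrs_subset hb hy
    refine ⟨b, ⟨hbV, hbX⟩, y, ⟨h.bip.left_subset hyA, fun hyX => ?_⟩, by
      rintro rfl; exact h.bip.notMem_right hyA hb⟩
    rcases (hAX ▸ (⟨hyA, hyX⟩ : y ∈ A ∩ X) : y ∈ insert a S) with rfl | h1
    · exact hab hy.symm
    · exact (hS h1).2 (Or.inr hy)

end ThreeCuts

/-! ### Splicings in abstract form, and their λ-matchable pairs. -/

section Gluing

universe u₁ v₁ u₂ v₂

/-- `H` arises from `G₁` and `G₂` by splicing at `v₁` and `v₂`: the vertices of `G₁` and `G₂` other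
than `v₁` and `v₂`, and all edges, are mapped to those of `H`, where the edges at `v₁` are
identified with those at `v₂`. -/
structure IsGluing {α : Type u} {β : Type v} {α₁ : Type u₁} {β₁ : Type v₁} {α₂ : Type u₂}
    {β₂ : Type v₂} (H : Graph α β) (G₁ : Graph α₁ β₁) (G₂ : Graph α₂ β₂) (v₁ : α₁) (v₂ : α₂)
    (f₁ : α₁ → α) (f₂ : α₂ → α) (g₁ : β₁ → β) (g₂ : β₂ → β) : Prop where
  mem₁ : v₁ ∈ V(G₁)
  mem₂ : v₂ ∈ V(G₂)
  injV₁ : Set.InjOn f₁ (V(G₁) \ {v₁})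
  injV₂ : Set.InjOn f₂ (V(G₂) \ {v₂})
  ne : ∀ x ∈ V(G₁) \ {v₁}, ∀ y ∈ V(G₂) \ {v₂}, f₁ x ≠ f₂ y
  vertexSet_eq : V(H) = f₁ '' (V(G₁) \ {v₁}) ∪ f₂ '' (V(G₂) \ {v₂})
  injE₁ : Set.InjOn g₁ E(G₁)
  injE₂ : Set.InjOn g₂ E(G₂)
  edgeSet_eq : E(H) = g₁ '' E(G₁) ∪ g₂ '' E(G₂)
  inc_of_eq : ∀ e ∈ E(G₁), ∀ e' ∈ E(G₂), g₁ e = g₂ e' → G₁.Inc e v₁ ∧ G₂.Inc e' v₂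
  star : g₁ '' G₁.incidenceSet v₁ = g₂ '' G₂.incidenceSet v₂
  inc₁ : ∀ x ∈ V(G₁) \ {v₁}, H.incidenceSet (f₁ x) = g₁ '' G₁.incidenceSet x
  inc₂ : ∀ x ∈ V(G₂) \ {v₂}, H.incidenceSet (f₂ x) = g₂ '' G₂.incidenceSet x

variable {α : Type u} {β : Type v} {α₁ : Type u₁} {β₁ : Type v₁} {α₂ : Type u₂}
  {β₂ : Type v₂} {H : Graph α β} {G₁ : Graph α₁ β₁} {G₂ : Graph α₂ β₂} {v₁ : α₁} {v₂ : α₂}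
  {f₁ : α₁ → α} {f₂ : α₂ → α} {g₁ : β₁ → β} {g₂ : β₂ → β}
  {A₁ B₁ : Set α₁} {A₂ B₂ : Set α₂}

lemma IsGluing.symm (h : IsGluing H G₁ G₂ v₁ v₂ f₁ f₂ g₁ g₂) :
    IsGluing H G₂ G₁ v₂ v₁ f₂ f₁ g₂ g₁ where
  mem₁ := h.mem₂
  mem₂ := h.mem₁
  injV₁ := h.injV₂
  injV₂ := h.injV₁
  ne x hx y hy := (h.ne y hy x hx).symm
  vertexSet_eq := by rw [h.vertexSet_eq, Set.union_comm]
  injE₁ := h.injE₂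
  injE₂ := h.injE₁
  edgeSet_eq := by rw [h.edgeSet_eq, Set.union_comm]
  inc_of_eq e he e' he' hee := (h.inc_of_eq e' he' e he hee.symm).symm
  star := h.star.symm
  inc₁ := h.inc₂
  inc₂ := h.inc₁

lemma IsGluing.map_mem (h : IsGluing H G₁ G₂ v₁ v₂ f₁ f₂ g₁ g₂) {x : α₁} (hx : x ∈ V(G₁))
    (hxv : x ≠ v₁) : f₁ x ∈ V(H) := by
  rw [h.vertexSet_eq]; exact Or.inl ⟨x, ⟨hx, hxv⟩, rfl⟩

lemma IsGluing.degIn_map (h : IsGluing H G₁ G₂ v₁ v₂ f₁ f₂ g₁ g₂) (M : Set β) {x : α₁}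
    (hx : x ∈ V(G₁)) (hxv : x ≠ v₁) :
    degIn H M (f₁ x) = degIn G₁ (E(G₁) ∩ g₁ ⁻¹' M) x := by
  rw [degIn, degIn, h.inc₁ x ⟨hx, hxv⟩, ← Set.InjOn.ncard_image (f := g₁)
    (h.injE₁.mono (Set.inter_subset_left.trans Set.inter_subset_left))]
  congr 1
  ext e
  constructor
  · rintro ⟨hm, e, he, rfl⟩
    exact ⟨e, ⟨⟨G₁.incidenceSet_subset_edgeSet x he, hm⟩, he⟩, rfl⟩
  · rintro ⟨e, ⟨⟨_, hm⟩, he⟩, rfl⟩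
    exact ⟨hm, e, he, rfl⟩

lemma IsGluing.preimage_join (h : IsGluing H G₁ G₂ v₁ v₂ f₁ f₂ g₁ g₂) {M₁ : Set β₁} {M₂ : Set β₂}
    (hM₁ : M₁ ⊆ E(G₁)) (hM₂ : M₂ ⊆ E(G₂))
    (heq : g₁ '' (M₁ ∩ G₁.incidenceSet v₁) = g₂ '' (M₂ ∩ G₂.incidenceSet v₂)) :
    E(G₁) ∩ g₁ ⁻¹' (g₁ '' M₁ ∪ g₂ '' M₂) = M₁ := by
  ext e
  constructor
  · rintro ⟨he, ⟨e', he', hee⟩ | ⟨e', he', hee⟩⟩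
    · rwa [← h.injE₁ (hM₁ he') he hee]
    · have h1 := h.inc_of_eq e he e' (hM₂ he') hee.symm
      have h2 : g₁ e ∈ g₂ '' (M₂ ∩ G₂.incidenceSet v₂) := ⟨e', ⟨he', h1.2⟩, hee⟩
      rw [← heq] at h2
      obtain ⟨e'', he'', h3⟩ := h2
      rw [← h.injE₁ (hM₁ he''.1) he h3]
      exact he''.1
  · intro he
    exact ⟨hM₁ he, Or.inl ⟨e, he, rfl⟩⟩

lemma IsGluing.join_subset (h : IsGluing H G₁ G₂ v₁ v₂ f₁ f₂ g₁ g₂) {M₁ : Set β₁} {M₂ : Set β₂}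
    (hM₁ : M₁ ⊆ E(G₁)) (hM₂ : M₂ ⊆ E(G₂)) : g₁ '' M₁ ∪ g₂ '' M₂ ⊆ E(H) := by
  rw [h.edgeSet_eq]
  exact Set.union_subset_union (Set.image_mono hM₁) (Set.image_mono hM₂)

lemma IsGluing.degIn_join₁ (h : IsGluing H G₁ G₂ v₁ v₂ f₁ f₂ g₁ g₂) {M₁ : Set β₁} {M₂ : Set β₂}
    (hM₁ : M₁ ⊆ E(G₁)) (hM₂ : M₂ ⊆ E(G₂))
    (heq : g₁ '' (M₁ ∩ G₁.incidenceSet v₁) = g₂ '' (M₂ ∩ G₂.incidenceSet v₂)) {x : α₁}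
    (hx : x ∈ V(G₁)) (hxv : x ≠ v₁) :
    degIn H (g₁ '' M₁ ∪ g₂ '' M₂) (f₁ x) = degIn G₁ M₁ x := by
  rw [h.degIn_map _ hx hxv, h.preimage_join hM₁ hM₂ heq]

lemma IsGluing.degIn_join₂ (h : IsGluing H G₁ G₂ v₁ v₂ f₁ f₂ g₁ g₂) {M₁ : Set β₁} {M₂ : Set β₂}
    (hM₁ : M₁ ⊆ E(G₁)) (hM₂ : M₂ ⊆ E(G₂))
    (heq : g₁ '' (M₁ ∩ G₁.incidenceSet v₁) = g₂ '' (M₂ ∩ G₂.incidenceSet v₂)) {x : α₂}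
    (hx : x ∈ V(G₂)) (hxv : x ≠ v₂) :
    degIn H (g₁ '' M₁ ∪ g₂ '' M₂) (f₂ x) = degIn G₂ M₂ x := by
  rw [Set.union_comm, h.symm.degIn_join₁ hM₂ hM₁ heq.symm hx hxv]

lemma IsGluing.forall_vertex (h : IsGluing H G₁ G₂ v₁ v₂ f₁ f₂ g₁ g₂) {p : α → Prop}
    (h₁ : ∀ x ∈ V(G₁), x ≠ v₁ → p (f₁ x)) (h₂ : ∀ x ∈ V(G₂), x ≠ v₂ → p (f₂ x)) :
    ∀ x ∈ V(H), p x := by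
  intro x hx
  rw [h.vertexSet_eq] at hx
  rcases hx with ⟨x, hx, rfl⟩ | ⟨x, hx, rfl⟩
  · exact h₁ x hx.1 hx.2
  · exact h₂ x hx.1 hx.2

lemma IsGluing.finite (h : IsGluing H G₁ G₂ v₁ v₂ f₁ f₂ g₁ g₂) (h₁ : V(G₁).Finite)
    (h₂ : V(G₂).Finite) : V(H).Finite := by
  rw [h.vertexSet_eq]
  exact ((h₁.subset Set.sdiff_subset).image _).union ((h₂.subset Set.sdiff_subset).image _)

lemma IsGluing.order_add_two (h : IsGluing H G₁ G₂ v₁ v₂ f₁ f₂ g₁ g₂) (h₁ : V(G₁).Finite)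
    (h₂ : V(G₂).Finite) : order H + 2 = order G₁ + order G₂ := by
  have e₁ := Set.ncard_sdiff_singleton_add_one h.mem₁ h₁
  have e₂ := Set.ncard_sdiff_singleton_add_one h.mem₂ h₂
  rw [order, h.vertexSet_eq, Set.ncard_union_eq _ ((h₁.subset Set.sdiff_subset).image _)
    ((h₂.subset Set.sdiff_subset).image _), Set.InjOn.ncard_image h.injV₁,
    Set.InjOn.ncard_image h.injV₂, order, order]
  · omega
  · rw [Set.disjoint_left]
    rintro _ ⟨x, hx, rfl⟩ ⟨y, hy, hxy⟩
    exact h.ne x hx y hy hxy.symm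

/-- An edge of the splicing star takes its `A`-end from `G₁`, since `v₁` is in `B₁`, and its `B`-end
from `G₂`, since `v₂` is in `A₂`. Every other edge keeps both of its ends. -/
lemma IsGluing.exists_inc_inc (h : IsGluing H G₁ G₂ v₁ v₂ f₁ f₂ g₁ g₂)
    (hb₁ : IsBipartition G₁ A₁ B₁) (hb₂ : IsBipartition G₂ A₂ B₂) (hv₁ : v₁ ∈ B₁) (hv₂ : v₂ ∈ A₂)
    {e : β} (he : e ∈ E(H)) :
    ∃ x ∈ f₁ '' A₁ ∪ f₂ '' (A₂ \ {v₂}), ∃ y ∈ f₁ '' (B₁ \ {v₁}) ∪ f₂ '' B₂,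
      H.Inc e x ∧ H.Inc e y := by
  have i₁ : ∀ {e x}, G₁.Inc e x → x ≠ v₁ → H.Inc (g₁ e) (f₁ x) := by
    intro e x hi hx
    rw [← Graph.mem_incidenceSet, h.inc₁ x ⟨hi.vertex_mem, hx⟩]
    exact ⟨e, hi, rfl⟩
  have i₂ : ∀ {e x}, G₂.Inc e x → x ≠ v₂ → H.Inc (g₂ e) (f₂ x) := by
    intro e x hi hx
    rw [← Graph.mem_incidenceSet, h.inc₂ x ⟨hi.vertex_mem, hx⟩]
    exact ⟨e, hi, rfl⟩
  have hA : ∀ {a}, a ∈ A₁ → a ≠ v₁ := by rintro a ha rfl; exact hb₁.notMem_right ha hv₁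
  have hB : ∀ {b}, b ∈ B₂ → b ≠ v₂ := by rintro a ha rfl; exact hb₂.notMem_right hv₂ ha
  have star : ∀ e₁ e₂, G₁.Inc e₁ v₁ → G₂.Inc e₂ v₂ → g₁ e₁ = g₂ e₂ →
      ∃ x ∈ f₁ '' A₁ ∪ f₂ '' (A₂ \ {v₂}), ∃ y ∈ f₁ '' (B₁ \ {v₁}) ∪ f₂ '' B₂,
      H.Inc (g₁ e₁) x ∧ H.Inc (g₁ e₁) y := by
    rintro e₁ e₂ ⟨a, ha⟩ ⟨b, hb⟩ hee
    have haA := hb₁.mem_left_of_isLink ha hv₁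
    have hbB := hb₂.mem_right_of_isLink hb hv₂
    refine ⟨f₁ a, Or.inl ⟨a, haA, rfl⟩, f₂ b, Or.inr ⟨b, hbB, rfl⟩, i₁ ha.inc_right (hA haA), ?_⟩
    rw [hee]; exact i₂ hb.inc_right (hB hbB)
  rw [h.edgeSet_eq] at he
  rcases he with ⟨e, he, rfl⟩ | ⟨e, he, rfl⟩
  · by_cases hv : G₁.Inc e v₁
    · obtain ⟨e', he', hee⟩ : g₁ e ∈ g₂ '' G₂.incidenceSet v₂ := by
        rw [← h.star]; exact ⟨e, hv, rfl⟩
      exact star e e' hv he' hee.symm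
    · obtain ⟨a, ha, b, hb, hl⟩ := hb₁.exists_isLink he
      have hbv : b ≠ v₁ := by rintro rfl; exact hv hl.inc_right
      exact ⟨f₁ a, Or.inl ⟨a, ha, rfl⟩, f₁ b, Or.inl ⟨b, ⟨hb, hbv⟩, rfl⟩, i₁ hl.inc_left (hA ha),
        i₁ hl.inc_right hbv⟩
  · by_cases hv : G₂.Inc e v₂
    · obtain ⟨e', he', hee⟩ : g₂ e ∈ g₁ '' G₁.incidenceSet v₁ := by
        rw [h.star]; exact ⟨e, hv, rfl⟩
      rw [← hee]
      exact star e' e he' hv hee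
    · obtain ⟨a, ha, b, hb, hl⟩ := hb₂.exists_isLink he
      have hav : a ≠ v₂ := by rintro rfl; exact hv hl.inc_left
      exact ⟨f₂ a, Or.inr ⟨a, ⟨ha, hav⟩, rfl⟩, f₂ b, Or.inr ⟨b, hb, rfl⟩, i₂ hl.inc_left hav,
        i₂ hl.inc_right (hB hb)⟩

lemma IsGluing.isBipartition (h : IsGluing H G₁ G₂ v₁ v₂ f₁ f₂ g₁ g₂)
    (hb₁ : IsBipartition G₁ A₁ B₁) (hb₂ : IsBipartition G₂ A₂ B₂) (hv₁ : v₁ ∈ B₁)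
    (hv₂ : v₂ ∈ A₂) :
    IsBipartition H (f₁ '' A₁ ∪ f₂ '' (A₂ \ {v₂})) (f₁ '' (B₁ \ {v₁}) ∪ f₂ '' B₂) := by
  have hA : ∀ {a}, a ∈ A₁ → a ∈ V(G₁) \ {v₁} := fun {a} ha =>
    ⟨hb₁.left_subset ha, by rintro rfl; exact hb₁.notMem_right ha hv₁⟩
  have hB : ∀ {a}, a ∈ B₂ → a ∈ V(G₂) \ {v₂} := fun {a} ha =>
    ⟨hb₂.right_subset ha, by rintro rfl; exact hb₂.notMem_right hv₂ ha⟩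
  have hA' : ∀ {a}, a ∈ B₁ \ {v₁} → a ∈ V(G₁) \ {v₁} := fun {a} ha =>
    ⟨hb₁.right_subset ha.1, ha.2⟩
  have hB' : ∀ {a}, a ∈ A₂ \ {v₂} → a ∈ V(G₂) \ {v₂} := fun {a} ha =>
    ⟨hb₂.left_subset ha.1, ha.2⟩
  have hdisj : Disjoint (f₁ '' A₁ ∪ f₂ '' (A₂ \ {v₂})) (f₁ '' (B₁ \ {v₁}) ∪ f₂ '' B₂) := by
    rw [Set.disjoint_left]
    rintro _ (⟨x, hx, rfl⟩ | ⟨x, hx, rfl⟩) (⟨y, hy, hxy⟩ | ⟨y, hy, hxy⟩)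
    · rw [h.injV₁ (hA' hy) (hA hx) hxy] at hy
      exact hb₁.notMem_right hx hy.1
    · exact h.ne x (hA hx) y (hB hy) hxy.symm
    · exact h.ne y (hA' hy) x (hB' hx) hxy
    · rw [h.injV₂ (hB hy) (hB' hx) hxy] at hy
      exact hb₂.notMem_right hx.1 hy
  refine ⟨?_, hdisj, ?_⟩
  · rw [h.vertexSet_eq]
    ext z
    constructor
    · rintro ((⟨x, hx, rfl⟩ | ⟨x, hx, rfl⟩) | (⟨x, hx, rfl⟩ | ⟨x, hx, rfl⟩))
      · exact Or.inl ⟨x, hA hx, rfl⟩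
      · exact Or.inr ⟨x, hB' hx, rfl⟩
      · exact Or.inl ⟨x, hA' hx, rfl⟩
      · exact Or.inr ⟨x, hB hx, rfl⟩
    · rintro (⟨x, hx, rfl⟩ | ⟨x, hx, rfl⟩)
      · rcases hb₁.mem_or hx.1 with h1 | h1
        · exact Or.inl (Or.inl ⟨x, h1, rfl⟩)
        · exact Or.inr (Or.inl ⟨x, ⟨h1, hx.2⟩, rfl⟩)
      · rcases hb₂.mem_or hx.1 with h1 | h1
        · exact Or.inl (Or.inr ⟨x, ⟨h1, hx.2⟩, rfl⟩)
        · exact Or.inr (Or.inr ⟨x, h1, rfl⟩)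
  · intro e p q hl
    obtain ⟨x, hx, y, hy, hix, hiy⟩ := h.exists_inc_inc hb₁ hb₂ hv₁ hv₂ hl.edge_mem
    have hxy : x ≠ y := by rintro rfl; exact Set.disjoint_left.1 hdisj hx hy
    rcases hix.eq_or_eq_of_isLink hl with rfl | rfl <;>
      rcases hiy.eq_or_eq_of_isLink hl with rfl | rfl
    · exact absurd rfl hxy
    · exact Or.inl ⟨hx, hy⟩
    · exact Or.inr ⟨hy, hx⟩
    · exact absurd rfl hxy

lemma IsGluing.isCubic (h : IsGluing H G₁ G₂ v₁ v₂ f₁ f₂ g₁ g₂) (h₁ : IsCubic G₁)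
    (h₂ : IsCubic G₂) (hl : H.Loopless) : IsCubic H := by
  refine ⟨hl, h.forall_vertex ?_ ?_⟩
  · intro x hx hxv
    rw [degIn, Set.inter_eq_right.2 (H.incidenceSet_subset_edgeSet _), h.inc₁ x ⟨hx, hxv⟩,
      Set.InjOn.ncard_image (h.injE₁.mono (G₁.incidenceSet_subset_edgeSet _)),
      h₁.ncard_incidenceSet hx]
  · intro x hx hxv
    rw [degIn, Set.inter_eq_right.2 (H.incidenceSet_subset_edgeSet _), h.inc₂ x ⟨hx, hxv⟩,
      Set.InjOn.ncard_image (h.injE₂.mono (G₂.incidenceSet_subset_edgeSet _)),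
      h₂.ncard_incidenceSet hx]

lemma IsBipartition.loopless {A B : Set α} (h : IsBipartition H A B) : H.Loopless :=
  ⟨fun _ _ hl => h.ne_of_isLink hl rfl⟩

lemma IsGluing.isBipCubic (h : IsGluing H G₁ G₂ v₁ v₂ f₁ f₂ g₁ g₂)
    (h₁ : IsBipCubic G₁ A₁ B₁) (h₂ : IsBipCubic G₂ A₂ B₂) (hv₁ : v₁ ∈ B₁) (hv₂ : v₂ ∈ A₂) :
    IsBipCubic H (f₁ '' A₁ ∪ f₂ '' (A₂ \ {v₂})) (f₁ '' (B₁ \ {v₁}) ∪ f₂ '' B₂) :=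
  have hb := h.isBipartition h₁.bip h₂.bip hv₁ hv₂
  ⟨h.finite h₁.finite h₂.finite, hb, h.isCubic h₁.cubic h₂.cubic hb.loopless⟩

lemma image_preimage_inter_incidenceSet {α : Type u} {β : Type v} {γ : Type v₁} (G : Graph α β)
    (x : α) (g : β → γ) (M : Set γ) :
    g '' (E(G) ∩ g ⁻¹' M ∩ G.incidenceSet x) = M ∩ g '' G.incidenceSet x := by
  ext e
  constructor
  · rintro ⟨e, ⟨⟨_, hm⟩, he⟩, rfl⟩
    exact ⟨hm, e, he, rfl⟩
  · rintro ⟨hm, e, he, rfl⟩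
    exact ⟨e, ⟨⟨G.incidenceSet_subset_edgeSet x he, hm⟩, he⟩, rfl⟩

/-- The edges of `M` at the splicing vertices correspond to each other. -/
lemma IsGluing.star_preimage (h : IsGluing H G₁ G₂ v₁ v₂ f₁ f₂ g₁ g₂) (M : Set β) :
    degIn G₁ (E(G₁) ∩ g₁ ⁻¹' M) v₁ = degIn G₂ (E(G₂) ∩ g₂ ⁻¹' M) v₂ := by
  rw [degIn, degIn, ← Set.InjOn.ncard_image (f := g₁)
    (h.injE₁.mono (Set.inter_subset_left.trans Set.inter_subset_left)), image_preimage_inter_incidenceSet,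
    ← Set.InjOn.ncard_image (f := g₂)
    (h.injE₂.mono (Set.inter_subset_left.trans Set.inter_subset_left)), image_preimage_inter_incidenceSet, h.star]

/-- The balance of the color classes forces exactly one edge of the splicing star to be used.
Restricting to `G₁` therefore gives `v₁` degree one. Conversely, a matching of `G₁` extends by a
perfect matching of `G₂` through the corresponding edge. -/
lemma IsGluing.isLambdaMatchable_left_iff (h : IsGluing H G₁ G₂ v₁ v₂ f₁ f₂ g₁ g₂)
    (h₁ : IsBipCubic G₁ A₁ B₁) (h₂ : IsBipCubic G₂ A₂ B₂) {a b : α₁} (ha : a ∈ V(G₁))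
    (hb : b ∈ V(G₁)) (hav : a ≠ v₁) (hbv : b ≠ v₁) :
    IsLambdaMatchable H (f₁ a) (f₁ b) ↔ IsLambdaMatchable G₁ a b := by
  have hinj : ∀ {x y}, x ∈ V(G₁) → x ≠ v₁ → y ∈ V(G₁) → y ≠ v₁ → x ≠ y → f₁ x ≠ f₁ y :=
    fun hx hxv hy hyv hne he => hne (h.injV₁ ⟨hx, hxv⟩ ⟨hy, hyv⟩ he)
  have hne : ∀ {x y}, x ∈ V(G₁) → x ≠ v₁ → y ∈ V(G₂) → y ≠ v₂ → f₁ x ≠ f₂ y :=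
    fun hx hxv hy hyv => h.ne _ ⟨hx, hxv⟩ _ ⟨hy, hyv⟩
  constructor
  · rintro ⟨_, _, hab, M, hM, h3, h3', h1⟩
    have hab' : a ≠ b := by rintro rfl; exact hab rfl
    refine ⟨ha, hb, hab', E(G₁) ∩ g₁ ⁻¹' M, Set.inter_subset_left, ?_, ?_, ?_⟩
    · rw [← h.degIn_map M ha hav, h3]
    · rw [← h.degIn_map M hb hbv, h3']
    · intro x hx hxa hxb
      by_cases hxv : x = v₁
      · subst hxv
        rw [h.star_preimage]
        refine h₂.degIn_eq_one Set.inter_subset_left h.mem₂ fun y hy hyv => ?_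
        rw [← h.symm.degIn_map M hy hyv]
        exact h1 _ (h.symm.map_mem hy hyv) (hne ha hav hy hyv).symm (hne hb hbv hy hyv).symm
      · rw [← h.degIn_map M hx hxv]
        exact h1 _ (h.map_mem hx hxv) (hinj hx hxv ha hav hxa) (hinj hx hxv hb hbv hxb)
  · rintro ⟨_, _, hab, M, hM, h3, h3', h1⟩
    have hd := h₁.degIn_eq_one' hM ha hb h.mem₁ hab hav hbv h3 h3' fun x hx _ => h1 x hx
    obtain ⟨e, he⟩ := Set.ncard_eq_one.1 hd
    have heM : e ∈ M ∩ G₁.incidenceSet v₁ := he ▸ rfl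
    obtain ⟨e', he', hee⟩ : g₁ e ∈ g₂ '' G₂.incidenceSet v₂ := by
      rw [← h.star]; exact ⟨e, heM.2, rfl⟩
    obtain ⟨M', hM', heM'⟩ := h₂.exists_isPerfectMatching (G₂.incidenceSet_subset_edgeSet v₂ he')
    obtain ⟨e'', he''⟩ := Set.ncard_eq_one.1 (hM'.2 v₂ h.mem₂)
    have h4 : e' ∈ M' ∩ G₂.incidenceSet v₂ := ⟨heM', he'⟩
    have h5 : e' = e'' := by rw [he''] at h4; exact h4
    subst h5
    have heq : g₁ '' (M ∩ G₁.incidenceSet v₁) = g₂ '' (M' ∩ G₂.incidenceSet v₂) := by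
      rw [he, he'', Set.image_singleton, Set.image_singleton, hee]
    refine ⟨h.map_mem ha hav, h.map_mem hb hbv, hinj ha hav hb hbv hab, g₁ '' M ∪ g₂ '' M',
      h.join_subset hM hM'.1, ?_, ?_, h.forall_vertex ?_ ?_⟩
    · rw [h.degIn_join₁ hM hM'.1 heq ha hav, h3]
    · rw [h.degIn_join₁ hM hM'.1 heq hb hbv, h3']
    · intro x hx hxv hxa hxb
      rw [h.degIn_join₁ hM hM'.1 heq hx hxv]
      exact h1 x hx (by rintro rfl; exact hxa rfl) (by rintro rfl; exact hxb rfl)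
    · intro x hx hxv _ _
      rw [h.degIn_join₂ hM hM'.1 heq hx hxv]
      exact hM'.2 x hx

/-- In each part a single vertex of degree three is left, so the balance forces degree three at the
splicing vertex as well. The whole star is then used on both sides, and any two such matchings fit
together. -/
lemma IsGluing.isLambdaMatchable_cross_iff (h : IsGluing H G₁ G₂ v₁ v₂ f₁ f₂ g₁ g₂)
    (h₁ : IsBipCubic G₁ A₁ B₁) (h₂ : IsBipCubic G₂ A₂ B₂) {a : α₁} {b : α₂} (ha : a ∈ V(G₁))
    (hb : b ∈ V(G₂)) (hav : a ≠ v₁) (hbv : b ≠ v₂) :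
    IsLambdaMatchable H (f₁ a) (f₂ b) ↔
      IsLambdaMatchable G₁ v₁ a ∧ IsLambdaMatchable G₂ v₂ b := by
  have hinj : ∀ {x y}, x ∈ V(G₁) → x ≠ v₁ → y ∈ V(G₁) → y ≠ v₁ → x ≠ y → f₁ x ≠ f₁ y :=
    fun hx hxv hy hyv hne he => hne (h.injV₁ ⟨hx, hxv⟩ ⟨hy, hyv⟩ he)
  have hinj' : ∀ {x y}, x ∈ V(G₂) → x ≠ v₂ → y ∈ V(G₂) → y ≠ v₂ → x ≠ y → f₂ x ≠ f₂ y :=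
    fun hx hxv hy hyv hne he => hne (h.injV₂ ⟨hx, hxv⟩ ⟨hy, hyv⟩ he)
  have hne : ∀ {x y}, x ∈ V(G₁) → x ≠ v₁ → y ∈ V(G₂) → y ≠ v₂ → f₁ x ≠ f₂ y :=
    fun hx hxv hy hyv => h.ne _ ⟨hx, hxv⟩ _ ⟨hy, hyv⟩
  constructor
  · rintro ⟨_, _, hab, M, hM, h3, h3', h1⟩
    have d₁ : ∀ x ∈ V(G₁), x ≠ v₁ → x ≠ a → degIn G₁ (E(G₁) ∩ g₁ ⁻¹' M) x = 1 := by
      intro x hx hxv hxa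
      rw [← h.degIn_map M hx hxv]
      exact h1 _ (h.map_mem hx hxv) (hinj hx hxv ha hav hxa) (hne hx hxv hb hbv)
    have d₂ : ∀ x ∈ V(G₂), x ≠ v₂ → x ≠ b → degIn G₂ (E(G₂) ∩ g₂ ⁻¹' M) x = 1 := by
      intro x hx hxv hxb
      rw [← h.symm.degIn_map M hx hxv]
      exact h1 _ (h.symm.map_mem hx hxv) (hne ha hav hx hxv).symm (hinj' hx hxv hb hbv hxb)
    rw [h.degIn_map M ha hav] at h3
    rw [h.symm.degIn_map M hb hbv] at h3'
    have e₁ := h₁.degIn_eq_three Set.inter_subset_left ha h.mem₁ hav h3 d₁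
    have e₂ := h₂.degIn_eq_three Set.inter_subset_left hb h.mem₂ hbv h3' d₂
    exact ⟨⟨h.mem₁, ha, hav.symm, _, Set.inter_subset_left, e₁.1, h3, d₁⟩,
      ⟨h.mem₂, hb, hbv.symm, _, Set.inter_subset_left, e₂.1, h3', d₂⟩⟩
  · rintro ⟨⟨_, _, _, M, hM, h3, h3', h1⟩, ⟨_, _, _, M', hM', k3, k3', k1⟩⟩
    have heq : g₁ '' (M ∩ G₁.incidenceSet v₁) = g₂ '' (M' ∩ G₂.incidenceSet v₂) := by
      rw [Set.inter_eq_right.2 (h₁.incidenceSet_subset h.mem₁ h3),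
        Set.inter_eq_right.2 (h₂.incidenceSet_subset h.mem₂ k3), h.star]
    refine ⟨h.map_mem ha hav, h.symm.map_mem hb hbv, hne ha hav hb hbv, g₁ '' M ∪ g₂ '' M',
      h.join_subset hM hM', ?_, ?_, h.forall_vertex ?_ ?_⟩
    · rw [h.degIn_join₁ hM hM' heq ha hav, h3']
    · rw [h.degIn_join₂ hM hM' heq hb hbv, k3']
    · intro x hx hxv hxa _
      rw [h.degIn_join₁ hM hM' heq hx hxv]
      exact h1 x hx hxv (by rintro rfl; exact hxa rfl)
    · intro x hx hxv _ hxb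
      rw [h.degIn_join₂ hM hM' heq hx hxv]
      exact k1 x hx hxv (by rintro rfl; exact hxb rfl)

/-- The pairs avoiding a vertex. -/
lemma ncard_pairs_avoiding {α : Type u} {β : Type v} {G : Graph α β} (hfin : V(G).Finite) (x : α) :
    {p : α × α | IsLambdaMatchable G p.1 p.2 ∧ p.1 ≠ x ∧ p.2 ≠ x}.ncard + 2 * numPartners G x =
      numPairs G := by
  have hP := finite_pairs hfin
  have hQ : {w | IsLambdaMatchable G x w}.Finite := hfin.subset fun w hw => hw.2.1
  have heq : {p : α × α | IsLambdaMatchable G p.1 p.2} =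
      {p : α × α | IsLambdaMatchable G p.1 p.2 ∧ p.1 ≠ x ∧ p.2 ≠ x} ∪
      ((fun w => (x, w)) '' {w | IsLambdaMatchable G x w} ∪
        (fun w => (w, x)) '' {w | IsLambdaMatchable G x w}) := by
    ext ⟨a, b⟩
    constructor
    · intro hm
      by_cases ha : a = x
      · subst ha; exact Or.inr (Or.inl ⟨b, hm, rfl⟩)
      · by_cases hb : b = x
        · subst hb; exact Or.inr (Or.inr ⟨a, hm.symm, rfl⟩)
        · exact Or.inl ⟨hm, ha, hb⟩
    · rintro (hm | ⟨w, hw, hm⟩ | ⟨w, hw, hm⟩)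
      · exact hm.1
      · cases hm; exact hw
      · cases hm; exact hw.symm
  rw [numPairs, heq, Set.ncard_union_eq _ (hP.subset fun p hp => hp.1)
    ((hQ.image _).union (hQ.image _)), Set.ncard_union_eq _ (hQ.image _) (hQ.image _),
    Set.ncard_image_of_injective _ (fun a b hab => (Prod.mk.inj hab).2),
    Set.ncard_image_of_injective _ (fun a b hab => (Prod.mk.inj hab).1), numPartners]
  · ring
  · rw [Set.disjoint_left]
    rintro _ ⟨w, hw, rfl⟩ ⟨w', hw', hm⟩
    cases hm; exact hw.2.2.1 rfl
  · rw [Set.disjoint_left]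
    rintro _ hp (⟨w, hw, rfl⟩ | ⟨w, hw, rfl⟩)
    · exact hp.2.1 rfl
    · exact hp.2.2 rfl

/-- The number of `λ`-matchable pairs of a splicing. -/
lemma IsGluing.numPairs_eq (h : IsGluing H G₁ G₂ v₁ v₂ f₁ f₂ g₁ g₂)
    (h₁ : IsBipCubic G₁ A₁ B₁) (h₂ : IsBipCubic G₂ A₂ B₂) :
    numPairs H + 2 * numPartners G₁ v₁ + 2 * numPartners G₂ v₂ =
      numPairs G₁ + numPairs G₂ + 2 * (numPartners G₁ v₁ * numPartners G₂ v₂) := by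
  set P₁ := {p : α₁ × α₁ | IsLambdaMatchable G₁ p.1 p.2 ∧ p.1 ≠ v₁ ∧ p.2 ≠ v₁} with hP₁
  set P₂ := {p : α₂ × α₂ | IsLambdaMatchable G₂ p.1 p.2 ∧ p.1 ≠ v₂ ∧ p.2 ≠ v₂} with hP₂
  set Q : Set (α₁ × α₂) := {w | IsLambdaMatchable G₁ v₁ w} ×ˢ {w | IsLambdaMatchable G₂ v₂ w}
    with hQ
  have fP₁ : P₁.Finite := (finite_pairs h₁.finite).subset fun p hp => hp.1
  have fP₂ : P₂.Finite := (finite_pairs h₂.finite).subset fun p hp => hp.1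
  have fQ : Q.Finite := Set.Finite.prod (h₁.finite.subset fun w hw => hw.2.1)
    (h₂.finite.subset fun w hw => hw.2.1)
  -- Pairs inside either part avoid its splicing vertex; pairs across form a product of two sets of
  -- partners, taken in both orders.
  have heq : {p : α × α | IsLambdaMatchable H p.1 p.2} =
      (Prod.map f₁ f₁ '' P₁ ∪ Prod.map f₂ f₂ '' P₂) ∪
        (Prod.map f₁ f₂ '' Q ∪ (fun p => (f₂ p.2, f₁ p.1)) '' Q) := by
    ext ⟨a, b⟩
    constructor
    · intro hm
      have ha := hm.1
      have hb := hm.2.1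
      rw [h.vertexSet_eq] at ha hb
      rcases ha with ⟨a, ha, rfl⟩ | ⟨a, ha, rfl⟩ <;> rcases hb with ⟨b, hb, rfl⟩ | ⟨b, hb, rfl⟩
      · exact Or.inl (Or.inl ⟨(a, b), ⟨(h.isLambdaMatchable_left_iff h₁ h₂ ha.1 hb.1 ha.2 hb.2).1
          hm, ha.2, hb.2⟩, rfl⟩)
      · exact Or.inr (Or.inl ⟨(a, b), (h.isLambdaMatchable_cross_iff h₁ h₂ ha.1 hb.1 ha.2 hb.2).1
          hm, rfl⟩)
      · exact Or.inr (Or.inr ⟨(b, a), (h.isLambdaMatchable_cross_iff h₁ h₂ hb.1 ha.1 hb.2 ha.2).1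
          hm.symm, rfl⟩)
      · exact Or.inl (Or.inr ⟨(a, b), ⟨(h.symm.isLambdaMatchable_left_iff h₂ h₁ ha.1 hb.1 ha.2
          hb.2).1 hm, ha.2, hb.2⟩, rfl⟩)
    · rintro ((⟨p, hp, hm⟩ | ⟨p, hp, hm⟩) | (⟨p, hp, hm⟩ | ⟨p, hp, hm⟩)) <;> cases hm
      · exact (h.isLambdaMatchable_left_iff h₁ h₂ hp.1.1 hp.1.2.1 hp.2.1 hp.2.2).2 hp.1
      · exact (h.symm.isLambdaMatchable_left_iff h₂ h₁ hp.1.1 hp.1.2.1 hp.2.1 hp.2.2).2 hp.1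
      · exact (h.isLambdaMatchable_cross_iff h₁ h₂ hp.1.2.1 hp.2.2.1 hp.1.2.2.1.symm
          hp.2.2.2.1.symm).2 hp
      · exact ((h.isLambdaMatchable_cross_iff h₁ h₂ hp.1.2.1 hp.2.2.1 hp.1.2.2.1.symm
          hp.2.2.2.1.symm).2 hp).symm
  have mP₁ : ∀ p ∈ P₁, p.1 ∈ V(G₁) \ {v₁} ∧ p.2 ∈ V(G₁) \ {v₁} := fun p hp =>
    ⟨⟨hp.1.1, hp.2.1⟩, ⟨hp.1.2.1, hp.2.2⟩⟩
  have mP₂ : ∀ p ∈ P₂, p.1 ∈ V(G₂) \ {v₂} ∧ p.2 ∈ V(G₂) \ {v₂} := fun p hp =>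
    ⟨⟨hp.1.1, hp.2.1⟩, ⟨hp.1.2.1, hp.2.2⟩⟩
  have mQ : ∀ p ∈ Q, p.1 ∈ V(G₁) \ {v₁} ∧ p.2 ∈ V(G₂) \ {v₂} := fun p hp =>
    ⟨⟨hp.1.2.1, hp.1.2.2.1.symm⟩, ⟨hp.2.2.1, hp.2.2.2.1.symm⟩⟩
  have c₁ : P₁.ncard + _ = _ := ncard_pairs_avoiding h₁.finite v₁
  have c₂ : P₂.ncard + _ = _ := ncard_pairs_avoiding h₂.finite v₂
  have cQ : Q.ncard = numPartners G₁ v₁ * numPartners G₂ v₂ := Set.ncard_prod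
  have hc : numPairs H = (P₁.ncard + P₂.ncard) + (Q.ncard + Q.ncard) := by
    rw [numPairs, heq, Set.ncard_union_eq _ ((fP₁.image _).union (fP₂.image _))
      ((fQ.image _).union (fQ.image _)), Set.ncard_union_eq _ (fP₁.image _) (fP₂.image _),
      Set.ncard_union_eq _ (fQ.image _) (fQ.image _), Set.InjOn.ncard_image,
      Set.InjOn.ncard_image, Set.InjOn.ncard_image, Set.InjOn.ncard_image]
    · rintro p hp q hq hpq
      have h1 := Prod.mk.inj hpq
      exact Prod.ext (h.injV₁ (mQ p hp).1 (mQ q hq).1 h1.2) (h.injV₂ (mQ p hp).2 (mQ q hq).2 h1.1)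
    · rintro p hp q hq hpq
      have h1 := Prod.mk.inj hpq
      exact Prod.ext (h.injV₁ (mQ p hp).1 (mQ q hq).1 h1.1) (h.injV₂ (mQ p hp).2 (mQ q hq).2 h1.2)
    · rintro p hp q hq hpq
      have h1 := Prod.mk.inj hpq
      exact Prod.ext (h.injV₂ (mP₂ p hp).1 (mP₂ q hq).1 h1.1)
        (h.injV₂ (mP₂ p hp).2 (mP₂ q hq).2 h1.2)
    · rintro p hp q hq hpq
      have h1 := Prod.mk.inj hpq
      exact Prod.ext (h.injV₁ (mP₁ p hp).1 (mP₁ q hq).1 h1.1)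
        (h.injV₁ (mP₁ p hp).2 (mP₁ q hq).2 h1.2)
    · rw [Set.disjoint_left]
      rintro _ ⟨p, hp, rfl⟩ ⟨q, hq, hpq⟩
      exact h.ne _ (mQ p hp).1 _ (mQ q hq).2 (Prod.mk.inj hpq).1.symm
    · rw [Set.disjoint_left]
      rintro _ ⟨p, hp, rfl⟩ ⟨q, hq, hpq⟩
      exact h.ne _ (mP₁ p hp).1 _ (mP₂ q hq).1 (Prod.mk.inj hpq).1.symm
    · rw [Set.disjoint_left]
      rintro _ (⟨p, hp, rfl⟩ | ⟨p, hp, rfl⟩) (⟨q, hq, hpq⟩ | ⟨q, hq, hpq⟩)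
      · exact h.ne _ (mP₁ p hp).2 _ (mQ q hq).2 (Prod.mk.inj hpq).2.symm
      · exact h.ne _ (mP₁ p hp).1 _ (mQ q hq).2 (Prod.mk.inj hpq).1.symm
      · exact h.ne _ (mQ q hq).1 _ (mP₂ p hp).1 (Prod.mk.inj hpq).1
      · exact h.ne _ (mQ q hq).1 _ (mP₂ p hp).2 (Prod.mk.inj hpq).2
  rw [cQ] at hc
  omega

end Gluing

/-! ### Contractions of tight cuts. -/

section Contraction

variable {α : Type u} {β : Type v} {G : Graph α β} {A B X Y : Set α} {x y : α}

lemma contract_isLink_iff {e : β} {p q : α} : (contract G Y y).IsLink e p q ↔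
    ∃ a b, G.IsLink e a b ∧ ¬ (a ∈ Y ∧ b ∈ Y) ∧ (a ∈ Y → p = y) ∧ (a ∉ Y → p = a) ∧
      (b ∈ Y → q = y) ∧ (b ∉ Y → q = b) := by
  classical
  simp only [contract, Graph.deleteEdges_isLink, Graph.map_isLink, Relation.map_apply,
    Set.mem_ofPred_eq]
  constructor
  · rintro ⟨⟨a, b, hl, rfl, rfl⟩, hn⟩
    refine ⟨a, b, hl, fun hab => hn ⟨a, b, hl, hab⟩, ?_, ?_, ?_, ?_⟩ <;> intro h <;> simp [h]
  · rintro ⟨a, b, hl, hn, h1, h2, h3, h4⟩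
    refine ⟨⟨a, b, hl, ?_, ?_⟩, ?_⟩
    · split_ifs with h; exacts [(h1 h).symm, (h2 h).symm]
    · split_ifs with h; exacts [(h3 h).symm, (h4 h).symm]
    · rintro ⟨c, d, hl', hc, hd⟩
      rcases hl.eq_and_eq_or_eq_and_eq hl' with ⟨rfl, rfl⟩ | ⟨rfl, rfl⟩
      · exact hn ⟨hc, hd⟩
      · exact hn ⟨hd, hc⟩

lemma vertexSet_contract (hY : Y ⊆ V(G)) (hy : y ∈ Y) :
    V(contract G Y y) = insert y (V(G) \ Y) := by
  classical
  ext z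
  simp only [contract, Graph.vertexSet_deleteEdges, Graph.vertexSet_map, Set.mem_image,
    Set.mem_insert_iff, Set.mem_sdiff]
  constructor
  · rintro ⟨w, hw, rfl⟩
    split_ifs with h
    · exact Or.inl rfl
    · exact Or.inr ⟨hw, h⟩
  · rintro (rfl | ⟨hz, hzY⟩)
    · exact ⟨z, hY hy, by simp⟩
    · exact ⟨z, hz, by simp [hzY]⟩

lemma contract_inc_iff (hy : y ∈ Y) {e : β} {z : α} (hz : z ∉ Y) :
    (contract G Y y).Inc e z ↔ G.Inc e z := by
  constructor
  · rintro ⟨w, hw⟩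
    obtain ⟨a, b, hl, _, h1, h2, _, _⟩ := contract_isLink_iff.1 hw
    by_cases ha : a ∈ Y
    · rw [h1 ha] at hz; exact absurd hy hz
    · rw [h2 ha]; exact hl.inc_left
  · rintro ⟨w, hw⟩
    by_cases hwY : w ∈ Y
    · exact ⟨y, contract_isLink_iff.2 ⟨z, w, hw, fun h => hz h.1, fun h => absurd h hz,
        fun _ => rfl, fun _ => rfl, fun h => absurd hwY h⟩⟩
    · exact ⟨w, contract_isLink_iff.2 ⟨z, w, hw, fun h => hz h.1, fun h => absurd h hz,
        fun _ => rfl, fun h => absurd h hwY, fun _ => rfl⟩⟩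

lemma contract_inc_self_iff (hy : y ∈ Y) {e : β} :
    (contract G Y y).Inc e y ↔ e ∈ cut G Y := by
  constructor
  · rintro ⟨w, hw⟩
    obtain ⟨a, b, hl, hn, h1, h2, _, _⟩ := contract_isLink_iff.1 hw
    by_cases ha : a ∈ Y
    · exact ⟨a, b, hl, ha, fun hb => hn ⟨ha, hb⟩⟩
    · rw [← h2 ha] at ha; exact absurd hy ha
  · rintro ⟨a, b, hl, ha, hb⟩
    exact ⟨b, contract_isLink_iff.2 ⟨a, b, hl, fun h => hb h.2, fun _ => rfl,
      fun h => absurd ha h, fun h => absurd h hb, fun _ => rfl⟩⟩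

lemma incidenceSet_contract (hy : y ∈ Y) {z : α} (hz : z ∉ Y) :
    (contract G Y y).incidenceSet z = G.incidenceSet z := by
  ext e; exact contract_inc_iff hy hz

lemma incidenceSet_contract_self (hy : y ∈ Y) :
    (contract G Y y).incidenceSet y = cut G Y := by
  ext e; exact contract_inc_self_iff hy

lemma mem_edgeSet_contract {e : β} :
    e ∈ E(contract G Y y) ↔ ∃ a b, G.IsLink e a b ∧ a ∉ Y := by
  constructor
  · intro he
    obtain ⟨p, q, hl⟩ := Graph.exists_isLink_of_mem_edgeSet he
    obtain ⟨a, b, hl, hn, -⟩ := contract_isLink_iff.1 hl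
    by_cases ha : a ∈ Y
    · exact ⟨b, a, hl.symm, fun hb => hn ⟨ha, hb⟩⟩
    · exact ⟨a, b, hl, ha⟩
  · rintro ⟨a, b, hl, ha⟩
    by_cases hb : b ∈ Y
    · exact (contract_isLink_iff.2 ⟨a, b, hl, fun h => ha h.1, fun h => absurd h ha, fun _ => rfl,
        fun _ => rfl, fun h => absurd hb h⟩ : (contract G Y y).IsLink e a y).edge_mem
    · exact (contract_isLink_iff.2 ⟨a, b, hl, fun h => ha h.1, fun h => absurd h ha, fun _ => rfl,
        fun h => absurd h hb, fun _ => rfl⟩ : (contract G Y y).IsLink e a b).edge_mem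

lemma edgeSet_contract_subset : E(contract G Y y) ⊆ E(G) := by
  intro e he
  obtain ⟨a, b, hl, _⟩ := mem_edgeSet_contract.1 he
  exact hl.edge_mem

lemma cut_compl (G : Graph α β) (X : Set α) : cut G (V(G) \ X) = cut G X := by
  ext e
  constructor
  · rintro ⟨a, b, hl, ha, hb⟩
    refine ⟨b, a, hl.symm, ?_, ha.2⟩
    by_contra h; exact hb ⟨hl.right_mem, h⟩
  · rintro ⟨a, b, hl, ha, hb⟩
    exact ⟨b, a, hl.symm, ⟨hl.right_mem, hb⟩, fun h => h.2 ha⟩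

lemma cut_contract (hy : y ∈ Y) {Z : Set α} (hZ : Disjoint Z Y) :
    cut (contract G Y y) Z = cut G Z := by
  ext e
  constructor
  · rintro ⟨p, q, hl, hp, hq⟩
    obtain ⟨a, b, hl, hn, h1, h2, h3, h4⟩ := contract_isLink_iff.1 hl
    have ha : a ∉ Y := by
      intro ha; rw [h1 ha] at hp; exact Set.disjoint_left.1 hZ hp hy
    rw [h2 ha] at hp
    refine ⟨a, b, hl, hp, fun hb => ?_⟩
    have hbY := Set.disjoint_left.1 hZ hb
    rw [h4 hbY] at hq
    exact hq hb
  · rintro ⟨a, b, hl, ha, hb⟩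
    have haY := Set.disjoint_left.1 hZ ha
    by_cases hbY : b ∈ Y
    · exact ⟨a, y, contract_isLink_iff.2 ⟨a, b, hl, fun h => haY h.1, fun h => absurd h haY,
        fun _ => rfl, fun _ => rfl, fun h => absurd hbY h⟩, ha, Set.disjoint_right.1 hZ hy⟩
    · exact ⟨a, b, contract_isLink_iff.2 ⟨a, b, hl, fun h => haY h.1, fun h => absurd h haY,
        fun _ => rfl, fun h => absurd h hbY, fun _ => rfl⟩, ha, hb⟩

/-- A graph is a splicing of its two contractions with respect to a cut. -/
lemma isGluing_contract (hX : X ⊆ V(G)) (hx : x ∈ X) (hy : y ∈ V(G) \ X) :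
    IsGluing G (contract G (V(G) \ X) y) (contract G X x) y x id id id id where
  mem₁ := by rw [vertexSet_contract Set.sdiff_subset hy]; exact Or.inl rfl
  mem₂ := by rw [vertexSet_contract hX hx]; exact Or.inl rfl
  injV₁ := Set.injOn_id _
  injV₂ := Set.injOn_id _
  injE₁ := Set.injOn_id _
  injE₂ := Set.injOn_id _
  ne := by
    rw [vertexSet_contract Set.sdiff_subset hy, vertexSet_contract hX hx]
    rintro z ⟨hz | hz, hzy⟩ w ⟨hw | hw, hwx⟩ h
    · exact hzy hz
    · exact hzy hz
    · exact hwx hw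
    · exact hz.2 ⟨hz.1, by rw [show z = w from h]; exact hw.2⟩
  vertexSet_eq := by
    rw [vertexSet_contract Set.sdiff_subset hy, vertexSet_contract hX hx]
    ext z
    simp only [Set.image_id, Set.mem_union, Set.mem_sdiff, Set.mem_insert_iff,
      Set.mem_singleton_iff]
    constructor
    · intro hz
      by_cases hzX : z ∈ X
      · exact Or.inl ⟨Or.inr ⟨hz, fun h => h.2 hzX⟩, fun h => hy.2 (h ▸ hzX)⟩
      · exact Or.inr ⟨Or.inr ⟨hz, hzX⟩, fun h => hzX (h ▸ hx)⟩
    · rintro (⟨rfl | h, _⟩ | ⟨rfl | h, _⟩)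
      · exact hy.1
      · exact h.1
      · exact hX hx
      · exact h.1
  edgeSet_eq := by
    ext e
    simp only [Set.image_id, Set.mem_union]
    constructor
    · intro he
      obtain ⟨a, b, hl⟩ := G.exists_isLink_of_mem_edgeSet he
      by_cases ha : a ∈ X
      · exact Or.inl (mem_edgeSet_contract.2 ⟨a, b, hl, fun h => h.2 ha⟩)
      · exact Or.inr (mem_edgeSet_contract.2 ⟨a, b, hl, ha⟩)
    · rintro (he | he) <;> exact edgeSet_contract_subset he
  inc_of_eq := by
    rintro e he _ he' rfl
    rw [contract_inc_self_iff hy, id, contract_inc_self_iff hx, cut_compl, and_self]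
    obtain ⟨a, b, hl, ha⟩ := mem_edgeSet_contract.1 he
    obtain ⟨c, d, hl', hc⟩ := mem_edgeSet_contract.1 he'
    -- An edge surviving both contractions has an end in each shore, so it belongs to the cut.
    have haX : a ∈ X := by by_contra h; exact ha ⟨hl.left_mem, h⟩
    refine ⟨a, b, hl, haX, fun hb => ?_⟩
    rcases Graph.IsLink.left_eq_or_eq hl' hl with rfl | rfl
    · exact hc haX
    · exact hc hb
  star := by
    rw [Set.image_id, Set.image_id, incidenceSet_contract_self hy, incidenceSet_contract_self hx,
      cut_compl]
  inc₁ := by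
    rw [vertexSet_contract Set.sdiff_subset hy]
    rintro z ⟨hz | hz, hzy⟩
    · exact absurd hz hzy
    · rw [Set.image_id, incidenceSet_contract hy hz.2, id]
  inc₂ := by
    rw [vertexSet_contract hX hx]
    rintro z ⟨hz | hz, hzy⟩
    · exact absurd hz hzy
    · rw [Set.image_id, incidenceSet_contract hx hz.2, id]

lemma IsNontrivialTightCut.compl (h : IsNontrivialTightCut G X) :
    IsNontrivialTightCut G (V(G) \ X) where
  subset := Set.sdiff_subset
  nontrivial := h.nontrivial_compl
  nontrivial_compl := by rw [Set.sdiff_sdiff_cancel_left h.subset]; exact h.nontrivial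
  tight := by rw [cut_compl]; exact h.tight

lemma IsBipCubic.exists_isPerfectMatching' (h : IsBipCubic G A B) {x : α} (hx : x ∈ V(G)) :
    ∃ M, IsPerfectMatching G M := by
  have h3 := h.cubic.ncard_incidenceSet hx
  obtain ⟨e, he⟩ : (G.incidenceSet x).Nonempty := by
    rw [Set.nonempty_iff_ne_empty]; intro h0; rw [h0] at h3; simp at h3
  obtain ⟨M, hM, _⟩ := h.exists_isPerfectMatching (G.incidenceSet_subset_edgeSet x he)
  exact ⟨M, hM⟩

/-- The edges of a tight cut leave its shores from vertices of one color each, and there are three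
of them. -/
lemma IsBipCubic.exists_halfCut_eq_empty (h : IsBipCubic G A B) (hX : IsNontrivialTightCut G X) :
    ∃ A B, IsBipCubic G A B ∧ halfCut G B X E(G) = ∅ ∧ (cut G X).ncard = 3 := by
  -- The difference of the sizes of `A ∩ X` and `B ∩ X` fixes from which color the single cut edge
  -- of a perfect matching leaves. As every edge is in some perfect matching, all cut edges leave
  -- from that color, and the degree count gives three of them.
  have key : ∀ {A B : Set α}, IsBipCubic G A B → ∀ M, IsPerfectMatching G M →
      (halfCut G B X M).ncard = 0 → halfCut G B X E(G) = ∅ ∧ (cut G X).ncard = 3 := by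
    intro A B h M hM h0
    have c1 := hX.tight M hM
    rw [ncard_cut_inter h.bip X (h.finite_edgeSet.subset hM.1)] at c1
    have c2 := h.halfCut_matching X hM
    have hE : halfCut G B X E(G) = ∅ := by
      rw [Set.eq_empty_iff_forall_notMem]
      rintro e ⟨he, hl⟩
      obtain ⟨N, hN, heN⟩ := h.exists_isPerfectMatching he
      have d1 := hX.tight N hN
      rw [ncard_cut_inter h.bip X (h.finite_edgeSet.subset hN.1)] at d1
      have d2 := h.halfCut_matching X hN
      have d3 : 0 < (halfCut G B X N).ncard := by
        rw [Set.ncard_pos ((h.finite_edgeSet.subset hN.1).subset fun e he => he.1)]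
        exact ⟨e, heN, hl⟩
      omega
    refine ⟨hE, ?_⟩
    have c3 := h.halfCut_edgeSet X
    rw [h.ncard_cut, hE, Set.ncard_empty]
    rw [hE, Set.ncard_empty] at c3
    omega
  obtain ⟨x, hx⟩ := hX.nontrivial.nonempty
  obtain ⟨M, hM⟩ := h.exists_isPerfectMatching' (hX.subset hx)
  have c1 := hX.tight M hM
  rw [ncard_cut_inter h.bip X (h.finite_edgeSet.subset hM.1)] at c1
  by_cases h0 : (halfCut G B X M).ncard = 0
  · exact ⟨A, B, h, key h M hM h0⟩
  · exact ⟨B, A, h.symm, key h.symm M hM (by omega)⟩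

/-- All cut edges leave `Y` from `A`, so the contraction vertex takes the color `A`. Its name `y`
may be that of a vertex of either color. -/
lemma IsBipCubic.isBipCubic_contract (h : IsBipCubic G A B) (hY : Y ⊆ V(G)) (hy : y ∈ Y)
    (h0 : halfCut G B Y E(G) = ∅) (hc : (cut G Y).ncard = 3) :
    IsBipCubic (contract G Y y) (insert y (A \ Y)) (B \ Y) := by
  have hV := vertexSet_contract hY hy
  have hyB : y ∉ B \ Y := fun h => h.2 hy
  have hbip : IsBipartition (CubicGraphs.contract G Y y) (insert y (A \ Y)) (B \ Y) := by
    refine ⟨?_, ?_, ?_⟩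
    · rw [hV, ← h.bip.union_eq, Set.union_sdiff_distrib, Set.insert_union]
    · rw [Set.disjoint_left]
      rintro z (rfl | hz) hzB
      · exact hyB hzB
      · exact h.bip.notMem_right hz.1 hzB.1
    · intro e p q hl
      obtain ⟨a, b, hl, hn, h1, h2, h3, h4⟩ := contract_isLink_iff.1 hl
      have hBY : ∀ {a b}, G.IsLink e a b → a ∈ Y → b ∉ Y → b ∈ B := by
        intro a b hl ha hb
        rcases h.bip.isLink e a b hl with h5 | h5
        · exact h5.2
        · have : e ∈ halfCut G B Y E(G) := ⟨hl.edge_mem, a, b, hl, h5.1, ha, hb⟩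
          rw [h0] at this; exact absurd this (Set.notMem_empty e)
      by_cases ha : a ∈ Y
      · have hb : b ∉ Y := fun hb => hn ⟨ha, hb⟩
        rw [h1 ha, h4 hb]
        exact Or.inl ⟨Or.inl rfl, hBY hl ha hb, hb⟩
      · by_cases hb : b ∈ Y
        · rw [h2 ha, h3 hb]
          exact Or.inr ⟨⟨hBY hl.symm hb ha, ha⟩, Or.inl rfl⟩
        · rw [h2 ha, h4 hb]
          rcases h.bip.isLink e a b hl with h5 | h5
          · exact Or.inl ⟨Or.inr ⟨h5.1, ha⟩, h5.2, hb⟩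
          · exact Or.inr ⟨⟨h5.1, ha⟩, Or.inr ⟨h5.2, hb⟩⟩
  refine ⟨?_, hbip, hbip.loopless, ?_⟩
  · rw [hV]; exact (h.finite.subset Set.sdiff_subset).insert y
  · intro z hz
    rw [degIn, Set.inter_eq_right.2 (Graph.incidenceSet_subset_edgeSet z)]
    rw [hV] at hz
    rcases hz with rfl | hz
    · rw [incidenceSet_contract_self hy, hc]
    · rw [incidenceSet_contract hy hz.2, h.cubic.ncard_incidenceSet hz.1]

/-- Every cut has a shore avoiding the contraction vertex, and such a shore has the same cut in `G`.
-/
lemma IsThreeEdgeConnected.contract (h3 : IsThreeEdgeConnected G) (hY : Y ⊆ V(G)) (hy : y ∈ Y) :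
    IsThreeEdgeConnected (contract G Y y) := by
  have hV := vertexSet_contract hY hy
  have key : ∀ Z ⊆ V(CubicGraphs.contract G Y y), Z.Nonempty → y ∉ Z →
      3 ≤ (cut (CubicGraphs.contract G Y y) Z).ncard := by
    intro Z hZ hne hyZ
    have hZ' : Z ⊆ V(G) \ Y := by
      intro z hz
      have := hZ hz
      rw [hV] at this
      rcases this with rfl | h
      · exact absurd hz hyZ
      · exact h
    rw [cut_contract hy (Set.disjoint_left.2 fun z hz => (hZ' hz).2)]
    exact h3 Z (hZ'.trans Set.sdiff_subset) hne (by rintro rfl; exact hyZ (hY hy))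
  intro Z hZ hne hp
  by_cases hyZ : y ∈ Z
  · rw [← cut_compl]
    refine key _ Set.sdiff_subset ?_ fun h => h.2 hyZ
    rw [Set.sdiff_nonempty]
    exact fun h => hp (hZ.antisymm h)
  · exact key Z hZ hne hyZ

lemma IsBipCubic.exists_contract (h : IsBipCubic G A B) (hY : IsNontrivialTightCut G Y)
    (hy : y ∈ Y) : ∃ A B, IsBipCubic (CubicGraphs.contract G Y y) A B := by
  obtain ⟨A, B, h, h0, hc⟩ := h.exists_halfCut_eq_empty hY
  exact ⟨_, _, h.isBipCubic_contract hY.subset hy h0 hc⟩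

lemma order_contract (hfin : V(G).Finite) (hY : Y ⊆ V(G)) (hy : y ∈ Y) :
    order (contract G Y y) = (V(G) \ Y).ncard + 1 := by
  rw [order, vertexSet_contract hY hy, Set.ncard_insert_of_notMem (fun h => h.2 hy)
    (hfin.subset Set.sdiff_subset)]

/-- The graph of order two thus never arises from a decomposition step and has to be treated only as
an initial graph. -/
lemma two_lt_order_contract (hfin : V(G).Finite) (hY : IsNontrivialTightCut G Y) (hy : y ∈ Y) :
    2 < order (contract G Y y) := by
  rw [order_contract hfin hY.subset hy]
  have := Set.one_lt_ncard_iff_nontrivial_and_finite.2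
    ⟨hY.nontrivial_compl, hfin.subset Set.sdiff_subset⟩
  omega

lemma order_contract_lt (hfin : V(G).Finite) (hY : IsNontrivialTightCut G Y) (hy : y ∈ Y) :
    order (contract G Y y) < order G := by
  rw [order_contract hfin hY.subset hy, order, Set.ncard_sdiff hY.subset (hfin.subset hY.subset)]
  have h1 := Set.one_lt_ncard_iff_nontrivial_and_finite.2 ⟨hY.nontrivial, hfin.subset hY.subset⟩
  have h2 := Set.ncard_le_ncard hY.subset hfin
  omega

lemma IsBipCubic.six_le_order (h : IsBipCubic G A B) (h3 : IsThreeEdgeConnected G)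
    (hn : 2 < order G) : 6 ≤ order G := by
  have hA := h.order_eq
  have hne : A.Nonempty := by
    rw [Set.nonempty_iff_ne_empty]; rintro rfl; simp at hA; omega
  obtain ⟨a, ha⟩ := hne
  have h1 := h.ncard_nbrs h3 hn (h.bip.left_subset ha)
  have h2 := Set.ncard_le_ncard (h.bip.nbrs_subset ha) h.finite_right
  rw [← h.ncard_eq] at h2
  omega

lemma IsThreeEdgeConnected.isConnected (h3 : IsThreeEdgeConnected G) (hne : V(G).Nonempty) :
    IsConnected G := by
  refine ⟨hne, fun x hx y hy => ?_⟩
  by_contra hxy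
  have hc := h3 {z ∈ V(G) | Relation.ReflTransGen G.Adj x z} (fun z hz => hz.1) ⟨x, hx, .refl⟩
    (fun h => by rw [← h] at hy; exact hxy hy.2)
  have : cut G {z ∈ V(G) | Relation.ReflTransGen G.Adj x z} = ∅ := by
    rw [Set.eq_empty_iff_forall_notMem]
    rintro e ⟨a, b, hl, ha, hb⟩
    exact hb ⟨hl.right_mem, ha.2.tail ⟨e, hl⟩⟩
  rw [this, Set.ncard_empty] at hc
  omega

lemma IsBipCubic.isMatchingCovered (h : IsBipCubic G A B) (h3 : IsThreeEdgeConnected G)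
    (hne : V(G).Nonempty) : IsMatchingCovered G := by
  refine ⟨h3.isConnected hne, ?_, fun e he => h.exists_isPerfectMatching he⟩
  obtain ⟨x, hx⟩ := hne
  obtain ⟨y, hy, hyx⟩ := h.exists_ne hx
  exact ⟨x, hx, y, hy, hyx.symm⟩

lemma vertexSet_nonempty_of_order (hn : 2 < order G) : V(G).Nonempty := by
  rw [Set.nonempty_iff_ne_empty]; intro h; rw [order, h] at hn; simp at hn

/-- The tight cut decomposition procedure can be applied. -/
lemma IsBipCubic.exists_decomposition (h : IsBipCubic G A B) (h3 : IsThreeEdgeConnected G)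
    (hne : V(G).Nonempty) : ∃ L, IsTightCutDecomposition G L := by
  induction hn : order G using Nat.strong_induction_on generalizing G A B with
  | _ n ih =>
    subst hn
    by_cases hfree : ∀ X, ¬ IsNontrivialTightCut G X
    · exact ⟨_, .leaf G (h.isMatchingCovered h3 hne) hfree⟩
    · push Not at hfree
      obtain ⟨X, hX⟩ := hfree
      obtain ⟨x, hx⟩ := hX.nontrivial.nonempty
      obtain ⟨y, hy⟩ := hX.nontrivial_compl.nonempty
      obtain ⟨A₁, B₁, h₁⟩ := h.exists_contract hX.compl hy
      obtain ⟨A₂, B₂, h₂⟩ := h.exists_contract hX hx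
      obtain ⟨L₁, hL₁⟩ := ih _ (order_contract_lt h.finite hX.compl hy) h₁
        (h3.contract Set.sdiff_subset hy)
        (vertexSet_nonempty_of_order (two_lt_order_contract h.finite hX.compl hy)) rfl
      obtain ⟨L₂, hL₂⟩ := ih _ (order_contract_lt h.finite hX hx) h₂ (h3.contract hX.subset hx)
        (vertexSet_nonempty_of_order (two_lt_order_contract h.finite hX hx)) rfl
      exact ⟨_, .node G (h.isMatchingCovered h3 hne) X hX x y hx hy L₁ L₂ hL₁ hL₂⟩

/-- A contraction of a minimal shore of a nontrivial tight cut is free of such cuts. -/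
lemma contract_free_of_minimal (hX : IsNontrivialTightCut G X) (hy : y ∈ V(G) \ X)
    (hmin : ∀ Z ⊂ X, ¬ IsNontrivialTightCut G Z) (Z : Set α) :
    ¬ IsNontrivialTightCut (contract G (V(G) \ X) y) Z := by
  have hV := vertexSet_contract (G := G) (Y := V(G) \ X) Set.sdiff_subset hy
  intro hZ
  wlog hyZ : y ∉ Z generalizing Z
  · exact this _ hZ.compl fun h => hyZ fun h' => h.2 h'
  have hZX : Z ⊆ X := by
    intro z hz
    have := hZ.subset hz
    rw [hV] at this
    rcases this with rfl | h
    · exact absurd hz hyZ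
    · by_contra hzX; exact h.2 ⟨h.1, hzX⟩
  obtain ⟨w, hw, hwy⟩ := hZ.nontrivial_compl.exists_ne y
  have hwX : w ∈ X := by
    have := hw.1
    rw [hV] at this
    rcases this with rfl | h
    · exact absurd rfl hwy
    · by_contra hzX; exact h.2 ⟨h.1, hzX⟩
  have hcut : cut (contract G (V(G) \ X) y) Z = cut G Z :=
    cut_contract hy (Set.disjoint_left.2 fun z hz h => h.2 (hZX hz))
  refine hmin Z ⟨hZX, fun h => hw.2 (h hwX)⟩ ⟨hZX.trans hX.subset, hZ.nontrivial,
    ⟨w, ⟨hX.subset hwX, hw.2⟩, y, ⟨hy.1, hyZ⟩, hwy⟩, fun M hM => ?_⟩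
  -- A perfect matching of `G` restricts to one of the contraction, because tightness of `X` gives
  -- it exactly one edge at `y`. So tight cuts of the contraction are tight in `G`.
  have hM' : IsPerfectMatching (contract G (V(G) \ X) y)
      (M ∩ E(contract G (V(G) \ X) y)) := by
    refine ⟨Set.inter_subset_right, fun z hz => ?_⟩
    rw [degIn, Set.inter_assoc, Set.inter_eq_right.2 (Graph.incidenceSet_subset_edgeSet z)]
    rw [hV] at hz
    rcases hz with rfl | hz
    · rw [incidenceSet_contract_self hy, cut_compl, Set.inter_comm]
      exact hX.tight M hM
    · rw [incidenceSet_contract hy hz.2]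
      exact hM.2 z hz.1
  have := hZ.tight _ hM'
  rwa [Set.inter_comm M, ← Set.inter_assoc, Set.inter_eq_left.2 (cut_subset Z), hcut] at this

end Contraction

/-! ### The two inequalities, and the case of equality in the first. -/

section Counts

variable {α : Type u} {β : Type v} {G : Graph α β} {A B : Set α}

lemma IsBipCubic.exists_mem_left (h : IsBipCubic G A B) {x : α} (hx : x ∈ V(G)) :
    ∃ A B, IsBipCubic G A B ∧ x ∈ A := by
  rcases h.bip.mem_or hx with h1 | h1
  · exact ⟨A, B, h, h1⟩
  · exact ⟨B, A, h.symm, h1⟩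

lemma finite_partners (hfin : V(G).Finite) (x : α) : {w | IsLambdaMatchable G x w}.Finite :=
  hfin.subset fun _ hw => hw.2.1

lemma IsBipCubic.three_le_numPartners (h : IsBipCubic G A B) (h3 : IsThreeEdgeConnected G)
    (hn : 2 < order G) {x : α} (hx : x ∈ V(G)) : 3 ≤ numPartners G x := by
  obtain ⟨A, B, h, hxA⟩ := h.exists_mem_left hx
  rw [← h.ncard_nbrs h3 hn hx]
  exact Set.ncard_le_ncard (fun y hy => h.isLambdaMatchable_of_adj h3 hn hxA hy)
    (finite_partners h.finite x)

lemma IsBipCubic.numPartners_of_free (h : IsBipCubic G A B) (h3 : IsThreeEdgeConnected G)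
    (hn : 2 < order G) (hfree : ∀ X, ¬ IsNontrivialTightCut G X) {x : α} (hx : x ∈ V(G)) :
    2 * numPartners G x = order G := by
  obtain ⟨A, B, h, hxA⟩ := h.exists_mem_left hx
  have : {w | IsLambdaMatchable G x w} = B := by
    ext w
    exact ⟨fun hw => (h.mem_iff_of_isLambdaMatchable hw).1 hxA,
      fun hw => h.isLambdaMatchable_of_free h3 hn hfree hxA hw⟩
  rw [numPartners, this, h.order_eq, h.ncard_eq]

lemma IsBipCubic.rho_of_free (h : IsBipCubic G A B) (h3 : IsThreeEdgeConnected G)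
    (hn : 2 < order G) (hfree : ∀ X, ¬ IsNontrivialTightCut G X) :
    rho G A B = A.ncard * A.ncard := by
  have : {p : α × α | p.1 ∈ A ∧ p.2 ∈ B ∧ IsLambdaMatchable G p.1 p.2} = A ×ˢ B := by
    ext p
    exact ⟨fun hp => ⟨hp.1, hp.2.1⟩, fun hp => ⟨hp.1, hp.2,
      h.isLambdaMatchable_of_free h3 hn hfree hp.1 hp.2⟩⟩
  rw [rho, this, Set.ncard_prod, h.ncard_eq]

/-- The quantity bounding `ρ` from below, up to the summand `-3`. -/
noncomputable def decompWeight (L : Multiset (Graph α β)) : ℚ := bTilde L + 3 * (bPrime L : ℚ)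

lemma decompWeight_add (L₁ L₂ : Multiset (Graph α β)) :
    decompWeight (L₁ + L₂) = decompWeight L₁ + decompWeight L₂ := by
  simp only [decompWeight, bTilde, bPrime, largeBraces, Multiset.filter_add, Multiset.map_add,
    Multiset.sum_add, Multiset.card_add, Nat.cast_add]
  ring

lemma IsBipCubic.isBrace (h : IsBipCubic G A B) (h3 : IsThreeEdgeConnected G)
    (hne : V(G).Nonempty) (hfree : ∀ X, ¬ IsNontrivialTightCut G X) : IsBrace G :=
  ⟨h.isMatchingCovered h3 hne, ⟨A, B, h.bip⟩, hfree⟩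

/-- Order more than two means order at least six here, so a graph without nontrivial tight cuts
counts as a large brace. -/
lemma IsBipCubic.decompWeight_singleton (h : IsBipCubic G A B) (h3 : IsThreeEdgeConnected G)
    (hn : 2 < order G) (hfree : ∀ X, ¬ IsNontrivialTightCut G X) :
    decompWeight {G} = (A.ncard : ℚ) ^ 2 + 3 := by
  have hb := h.isBrace h3 (vertexSet_nonempty_of_order hn) hfree
  have h6 := h.six_le_order h3 hn
  have : largeBraces {G} = {G} := by
    rw [largeBraces, Multiset.filter_singleton, if_pos ⟨hb, h6⟩]
  simp [decompWeight, bTilde, bPrime, this, h.order_eq]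

/-- The inequalities of the theorem, and what equality in the first one means. -/
lemma IsTightCutDecomposition.bounds {L : Multiset (Graph α β)}
    (hL : IsTightCutDecomposition G L) (h : IsBipCubic G A B) (h3 : IsThreeEdgeConnected G)
    (hn : 2 < order G) :
    2 * (decompWeight L - 3) ≤ (numPairs G : ℚ) ∧
      3 * (order G : ℚ) - 9 ≤ decompWeight L - 3 ∧
      ((numPairs G : ℚ) = 2 * (decompWeight L - 3) →
        (∀ X, ¬ IsNontrivialTightCut G X) ∨ numPairs G + 18 = 6 * order G) := by
  induction hL generalizing A B with
  | leaf G hG hfree =>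
    rw [h.decompWeight_singleton h3 hn hfree, h.numPairs_eq, h.rho_of_free h3 hn hfree, h.order_eq]
    push_cast
    -- With `k = A.ncard` the second inequality is `6 * k - 9 ≤ k ^ 2`.
    refine ⟨by nlinarith, by nlinarith [sq_nonneg ((A.ncard : ℚ) - 3)], fun _ => Or.inl hfree⟩
  | node G hG X hX x y hx hy L₁ L₂ _ _ ih₁ ih₂ =>
    obtain ⟨A₁, B₁, h₁⟩ := h.exists_contract hX.compl hy
    obtain ⟨A₂, B₂, h₂⟩ := h.exists_contract hX hx
    have c₁ := h3.contract Set.sdiff_subset hy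
    have c₂ := h3.contract hX.subset hx
    have n₁ := two_lt_order_contract h.finite hX.compl hy
    have n₂ := two_lt_order_contract h.finite hX hx
    have hgl := isGluing_contract hX.subset hx hy
    have hR := hgl.numPairs_eq h₁ h₂
    have hO := hgl.order_add_two h₁.finite h₂.finite
    obtain ⟨a₁, b₁, e₁⟩ := ih₁ h₁ c₁ n₁
    obtain ⟨a₂, b₂, e₂⟩ := ih₂ h₂ c₂ n₂
    have r₁ := h₁.three_le_numPartners c₁ n₁ hgl.mem₁
    have r₂ := h₂.three_le_numPartners c₂ n₂ hgl.mem₂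
    -- The data of a part that is a brace are recorded now, so that they are rewritten along with
    -- everything else when the quantities are generalized.
    have p₁ : ∀ hf : ∀ Z, ¬ IsNontrivialTightCut (contract G (V(G) \ X) y) Z, _ :=
      fun hf => And.intro (h₁.numPartners_of_free c₁ n₁ hf hgl.mem₁)
        (And.intro (h₁.rho_of_free c₁ n₁ hf) (And.intro h₁.numPairs_eq h₁.order_eq))
    have p₂ : ∀ hf : ∀ Z, ¬ IsNontrivialTightCut (contract G X x) Z, _ :=
      fun hf => And.intro (h₂.numPartners_of_free c₂ n₂ hf hgl.mem₂)
        (And.intro (h₂.rho_of_free c₂ n₂ hf) (And.intro h₂.numPairs_eq h₂.order_eq))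
    rw [decompWeight_add]
    generalize numPartners (contract G (V(G) \ X) y) y = s₁ at *
    generalize numPartners (contract G X x) x = s₂ at *
    generalize numPairs (contract G (V(G) \ X) y) = R₁ at *
    generalize numPairs (contract G X x) = R₂ at *
    generalize order (contract G (V(G) \ X) y) = o₁ at *
    generalize order (contract G X x) = o₂ at *
    -- In terms of the surpluses `t₁` and `t₂` over three partners, the slack is `4 * t₁ + 4 * t₂ +
    -- 2 * (t₁ * t₂)`. It is nonnegative, and it vanishes only if both surpluses do.
    obtain ⟨t₁, rfl⟩ := Nat.exists_eq_add_of_le r₁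
    obtain ⟨t₂, rfl⟩ := Nat.exists_eq_add_of_le r₂
    have hR' : numPairs G = R₁ + R₂ + 6 + 4 * t₁ + 4 * t₂ + 2 * (t₁ * t₂) := by
      linarith
    have hOq : (order G : ℚ) + 2 = o₁ + o₂ := by exact_mod_cast hO
    have hRq : (numPairs G : ℚ) = R₁ + R₂ + 6 + 4 * t₁ + 4 * t₂ + 2 * (t₁ * t₂) := by
      exact_mod_cast hR'
    have q₁ : (0 : ℚ) ≤ t₁ := by positivity
    have q₂ : (0 : ℚ) ≤ t₂ := by positivity
    have q₃ : (0 : ℚ) ≤ t₁ * t₂ := by positivity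
    refine ⟨by linarith, by linarith, fun heq => Or.inr ?_⟩
    have z₁ : t₁ = 0 := by
      have : (t₁ : ℚ) = 0 := by linarith
      exact_mod_cast this
    have z₂ : t₂ = 0 := by
      have : (t₂ : ℚ) = 0 := by linarith
      exact_mod_cast this
    subst z₁ z₂
    -- Equality is inherited by the parts. A part without tight cuts has half its order equal to its
    -- number of partners, namely three, and so it attains the second bound too.
    have k₁ : R₁ + 18 = 6 * o₁ := by
      rcases e₁ (by linarith) with hf | hk
      · obtain ⟨i1, i2, i3, i4⟩ := p₁ hf
        have : A₁.ncard = 3 := by omega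
        rw [this] at i2 i4
        omega
      · exact hk
    have k₂ : R₂ + 18 = 6 * o₂ := by
      rcases e₂ (by linarith) with hf | hk
      · obtain ⟨i1, i2, i3, i4⟩ := p₂ hf
        have : A₂.ncard = 3 := by omega
        rw [this] at i2 i4
        omega
      · exact hk
    omega

end Counts

/-! ### Transport along isomorphisms. -/

section Isomorphism

universe u₁ v₁ u₂ v₂

/-- An isomorphism of graphs given by functions on the vertex and edge types. -/
structure IsGraphIso {α : Type u} {β : Type v} {α' : Type u₁} {β' : Type v₁} (G : Graph α β)
    (H : Graph α' β') (f : α → α') (g : β → β') : Prop where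
  bijV : Set.BijOn f V(G) V(H)
  bijE : Set.BijOn g E(G) E(H)
  isLink_iff : ∀ e ∈ E(G), ∀ x ∈ V(G), ∀ y ∈ V(G), G.IsLink e x y ↔ H.IsLink (g e) (f x) (f y)

variable {α : Type u} {β : Type v} {α' : Type u₁} {β' : Type v₁} {G : Graph α β}
  {H : Graph α' β'} {f : α → α'} {g : β → β'}

lemma IsIso.symm (h : IsIso G H) : IsIso H G := by
  obtain ⟨f, g, h⟩ := h
  exact ⟨f.symm, g.symm, fun e x y => by rw [h]; simp⟩

lemma IsGraphIso.isIso (h : IsGraphIso G H f g) : IsIso G H :=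
  ⟨h.bijV.equiv, h.bijE.equiv, fun e x y => h.isLink_iff e e.2 x x.2 y y.2⟩

lemma IsIso.exists_isGraphIso [Nonempty α'] [Nonempty β'] (h : IsIso G H) :
    ∃ f g, IsGraphIso G H f g := by
  classical
  obtain ⟨f, g, h⟩ := h
  -- The values off the vertex set and off the edge set are irrelevant.
  refine ⟨fun x => if hx : x ∈ V(G) then f ⟨x, hx⟩ else Classical.arbitrary α',
    fun e => if he : e ∈ E(G) then g ⟨e, he⟩ else Classical.arbitrary β', ⟨?_, ?_, ?_⟩,
    ⟨?_, ?_, ?_⟩, ?_⟩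
  · intro x hx
    simp only [dif_pos hx]; exact (f _).2
  · intro x hx y hy hxy
    simp only [dif_pos hx, dif_pos hy] at hxy
    simpa using f.injective (Subtype.ext hxy)
  · intro y hy
    exact ⟨f.symm ⟨y, hy⟩, (f.symm ⟨y, hy⟩).2, by simp⟩
  · intro x hx
    simp only [dif_pos hx]; exact (g _).2
  · intro x hx y hy hxy
    simp only [dif_pos hx, dif_pos hy] at hxy
    simpa using g.injective (Subtype.ext hxy)
  · intro y hy
    exact ⟨g.symm ⟨y, hy⟩, (g.symm ⟨y, hy⟩).2, by simp⟩
  · intro e he x hx y hy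
    simp only [dif_pos he, dif_pos hx, dif_pos hy]
    exact h ⟨e, he⟩ ⟨x, hx⟩ ⟨y, hy⟩

lemma IsGraphIso.inc_iff (h : IsGraphIso G H f g) {e : β} {x : α} (he : e ∈ E(G))
    (hx : x ∈ V(G)) : G.Inc e x ↔ H.Inc (g e) (f x) := by
  constructor
  · rintro ⟨y, hl⟩
    exact ⟨f y, (h.isLink_iff e he x hx y hl.right_mem).1 hl⟩
  · rintro ⟨y, hl⟩
    obtain ⟨y, hy, rfl⟩ := h.bijV.surjOn hl.right_mem
    exact ⟨y, (h.isLink_iff e he x hx y hy).2 hl⟩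

lemma IsGraphIso.image_incidenceSet (h : IsGraphIso G H f g) {x : α} (hx : x ∈ V(G)) :
    H.incidenceSet (f x) = g '' G.incidenceSet x := by
  ext e
  constructor
  · intro he
    obtain ⟨e, he', rfl⟩ := h.bijE.surjOn (H.incidenceSet_subset_edgeSet _ he)
    exact ⟨e, (h.inc_iff he' hx).2 he, rfl⟩
  · rintro ⟨e, he, rfl⟩
    exact (h.inc_iff (G.incidenceSet_subset_edgeSet _ he) hx).1 he

lemma IsGraphIso.degIn_eq (h : IsGraphIso G H f g) (M : Set β') {x : α} (hx : x ∈ V(G)) :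
    degIn H M (f x) = degIn G (E(G) ∩ g ⁻¹' M) x := by
  rw [degIn, degIn, h.image_incidenceSet hx, ← image_preimage_inter_incidenceSet,
    Set.InjOn.ncard_image (h.bijE.injOn.mono (Set.inter_subset_left.trans Set.inter_subset_left))]

lemma IsGraphIso.preimage_image (h : IsGraphIso G H f g) {M : Set β} (hM : M ⊆ E(G)) :
    E(G) ∩ g ⁻¹' (g '' M) = M := by
  ext e
  constructor
  · rintro ⟨he, e', he', hee⟩
    rwa [← h.bijE.injOn (hM he') he hee]
  · exact fun he => ⟨hM he, e, he, rfl⟩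

lemma IsGraphIso.isLambdaMatchable_iff (h : IsGraphIso G H f g) {a b : α} (ha : a ∈ V(G))
    (hb : b ∈ V(G)) : IsLambdaMatchable G a b ↔ IsLambdaMatchable H (f a) (f b) := by
  constructor
  · rintro ⟨_, _, hab, M, hM, h3, h3', h1⟩
    refine ⟨h.bijV.mapsTo ha, h.bijV.mapsTo hb, fun hf => hab (h.bijV.injOn ha hb hf), g '' M,
      ?_, ?_, ?_, ?_⟩
    · rintro _ ⟨e, he, rfl⟩; exact h.bijE.mapsTo (hM he)
    · rw [h.degIn_eq _ ha, h.preimage_image hM, h3]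
    · rw [h.degIn_eq _ hb, h.preimage_image hM, h3']
    · intro x hx hxa hxb
      obtain ⟨x, hx', rfl⟩ := h.bijV.surjOn hx
      rw [h.degIn_eq _ hx', h.preimage_image hM]
      exact h1 x hx' (by rintro rfl; exact hxa rfl) (by rintro rfl; exact hxb rfl)
  · rintro ⟨_, _, hab, M, hM, h3, h3', h1⟩
    refine ⟨ha, hb, by rintro rfl; exact hab rfl, E(G) ∩ g ⁻¹' M, Set.inter_subset_left, ?_, ?_, ?_⟩
    · rw [← h.degIn_eq _ ha, h3]
    · rw [← h.degIn_eq _ hb, h3']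
    · intro x hx hxa hxb
      rw [← h.degIn_eq _ hx]
      exact h1 _ (h.bijV.mapsTo hx) (fun hf => hxa (h.bijV.injOn hx ha hf))
        (fun hf => hxb (h.bijV.injOn hx hb hf))

lemma IsGraphIso.numPairs_eq (h : IsGraphIso G H f g) : numPairs H = numPairs G := by
  have : {p : α' × α' | IsLambdaMatchable H p.1 p.2} =
      Prod.map f f '' {p : α × α | IsLambdaMatchable G p.1 p.2} := by
    ext ⟨a, b⟩
    constructor
    · intro hm
      obtain ⟨a, ha, rfl⟩ := h.bijV.surjOn hm.1
      obtain ⟨b, hb, rfl⟩ := h.bijV.surjOn hm.2.1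
      exact ⟨(a, b), (h.isLambdaMatchable_iff ha hb).2 hm, rfl⟩
    · rintro ⟨⟨a, b⟩, hm, heq⟩
      cases heq
      exact (h.isLambdaMatchable_iff hm.1 hm.2.1).1 hm
  rw [numPairs, this, Set.InjOn.ncard_image, numPairs]
  rintro p hp q hq hpq
  have h1 := Prod.mk.inj hpq
  exact Prod.ext (h.bijV.injOn hp.1 hq.1 h1.1) (h.bijV.injOn hp.2.1 hq.2.1 h1.2)

lemma IsGraphIso.order_eq (h : IsGraphIso G H f g) : order H = order G := by
  rw [order, ← h.bijV.image_eq, h.bijV.injOn.ncard_image, order]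

lemma IsGraphIso.isBipCubic (h : IsGraphIso G H f g) {A B : Set α'} (hH : IsBipCubic H A B) :
    IsBipCubic G (V(G) ∩ f ⁻¹' A) (V(G) ∩ f ⁻¹' B) := by
  have hb : IsBipartition G (V(G) ∩ f ⁻¹' A) (V(G) ∩ f ⁻¹' B) := by
    refine ⟨?_, ?_, ?_⟩
    · ext x
      constructor
      · rintro (hx | hx) <;> exact hx.1
      · intro hx
        rcases hH.bip.mem_or (h.bijV.mapsTo hx) with h1 | h1
        · exact Or.inl ⟨hx, h1⟩
        · exact Or.inr ⟨hx, h1⟩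
    · rw [Set.disjoint_left]
      exact fun x hx hx' => hH.bip.notMem_right hx.2 hx'.2
    · intro e x y hl
      have := (h.isLink_iff e hl.edge_mem x hl.left_mem y hl.right_mem).1 hl
      rcases hH.bip.isLink _ _ _ this with h1 | h1
      · exact Or.inl ⟨⟨hl.left_mem, h1.1⟩, hl.right_mem, h1.2⟩
      · exact Or.inr ⟨⟨hl.left_mem, h1.1⟩, hl.right_mem, h1.2⟩
  refine ⟨?_, hb, hb.loopless, fun x hx => ?_⟩
  · exact Set.Finite.of_finite_image (h.bijV.image_eq ▸ hH.finite) h.bijV.injOn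
  · rw [degIn, Set.inter_eq_right.2 (G.incidenceSet_subset_edgeSet x),
      ← (h.bijE.injOn.mono (G.incidenceSet_subset_edgeSet x)).ncard_image,
      ← h.image_incidenceSet hx, hH.cubic.ncard_incidenceSet (h.bijV.mapsTo hx)]

lemma isLink_iff_inc_of_loopless (h : G.Loopless) {e : β} {x y : α} :
    G.IsLink e x y ↔ G.Inc e x ∧ G.Inc e y ∧ x ≠ y := by
  constructor
  · intro hl
    exact ⟨hl.inc_left, hl.inc_right, by rintro rfl; exact h.not_isLoopAt e x hl⟩
  · rintro ⟨⟨z, hz⟩, hy, hxy⟩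
    rcases hy.eq_or_eq_of_isLink hz with rfl | rfl
    · exact absurd rfl hxy
    · exact hz

/-- Without loops, the ends of an edge are determined by its incidences, which are easier to compute
in a splicing. -/
lemma isGraphIso_of_inc (hG : G.Loopless) (hH : H.Loopless) (hV : Set.BijOn f V(G) V(H))
    (hE : Set.BijOn g E(G) E(H))
    (hinc : ∀ e ∈ E(G), ∀ x ∈ V(G), G.Inc e x ↔ H.Inc (g e) (f x)) : IsGraphIso G H f g := by
  refine ⟨hV, hE, fun e he x hx y hy => ?_⟩
  rw [isLink_iff_inc_of_loopless hG, isLink_iff_inc_of_loopless hH, hinc e he x hx, hinc e he y hy,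
    hV.injOn.ne_iff hx hy]

end Isomorphism

/-! ### Concrete splicings and gluings are the same up to isomorphism. -/

section Splice

universe u₁ v₁ u₂ v₂

variable {α : Type u} {β : Type v} {α₁ : Type u₁} {β₁ : Type v₁} {α₂ : Type u₂} {β₂ : Type v₂}
  {H : Graph α β} {G : Graph α₁ β₁} {K : Graph α₂ β₂} {a : α₁} {b : α₂} {π : β₁ → β₂}

lemma splice_inc_inl_inl (hK : K.Loopless)
    (hπ : Set.MapsTo π (G.incidenceSet a) (K.incidenceSet b)) {e : β₁} {x : α₁} :
    (splice G K a b π).Inc (Sum.inl e) (Sum.inl x) ↔ G.Inc e x ∧ x ≠ a := by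
  constructor
  · rintro ⟨z, hz⟩
    cases hz with
    | left _ _ y h hx hy => exact ⟨h.inc_left, hx⟩
    | across _ _ y h hx h' hy => exact ⟨h.inc_left, hx⟩
  · rintro ⟨⟨y, hl⟩, hxa⟩
    by_cases hy : y = a
    · subst hy
      obtain ⟨z, hz⟩ := hπ hl.inc_right
      exact ⟨Sum.inr z, .across e x z hl hxa hz.symm
        (by rintro rfl; exact hK.not_isLoopAt _ _ hz)⟩
    · exact ⟨Sum.inl y, .left e x y hl hxa hy⟩

lemma splice_inc_inl_inr (hG : G.Loopless) (hK : K.Loopless) {e : β₁} {y : α₂} :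
    (splice G K a b π).Inc (Sum.inl e) (Sum.inr y) ↔
      G.Inc e a ∧ K.Inc (π e) y ∧ K.Inc (π e) b ∧ y ≠ b := by
  constructor
  · rintro ⟨z, hz⟩
    cases hz with
    | across_symm _ x _ h hx h' hy => exact ⟨h.inc_right, h'.inc_left, h'.inc_right, hy⟩
  · rintro ⟨⟨x, hl⟩, hy, hb, hyb⟩
    exact ⟨Sum.inl x, .across_symm e x y hl.symm (by rintro rfl; exact hG.not_isLoopAt _ _ hl)
      ((isLink_iff_inc_of_loopless hK).2 ⟨hy, hb, hyb⟩) hyb⟩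

lemma splice_inc_inr_inl {e : β₂} {x : α₁} :
    ¬ (splice G K a b π).Inc (Sum.inr e) (Sum.inl x) := by
  rintro ⟨z, hz⟩
  cases hz

lemma splice_inc_inr_inr {e : β₂} {y : α₂} :
    (splice G K a b π).Inc (Sum.inr e) (Sum.inr y) ↔ K.Inc e y ∧ ¬ K.Inc e b := by
  constructor
  · rintro ⟨z, hz⟩
    cases hz with
    | right _ _ z h hy hz =>
      refine ⟨h.inc_left, fun hb => ?_⟩
      rcases hb.eq_or_eq_of_isLink h with rfl | rfl
      · exact hy rfl
      · exact hz rfl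
  · rintro ⟨⟨z, hl⟩, hb⟩
    exact ⟨Sum.inr z, .right e y z hl (by rintro rfl; exact hb hl.inc_left)
      (by rintro rfl; exact hb hl.inc_right)⟩

lemma mem_edgeSet_iff_exists_inc {G : Graph α β} {e : β} : e ∈ E(G) ↔ ∃ x, G.Inc e x := by
  rw [Graph.edge_mem_iff_exists_isLink]; rfl

lemma inl_mem_edgeSet_splice (hG : G.Loopless) (hK : K.Loopless)
    (hπ : Set.MapsTo π (G.incidenceSet a) (K.incidenceSet b)) {e : β₁} :
    Sum.inl e ∈ E(splice G K a b π) ↔ e ∈ E(G) := by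
  rw [mem_edgeSet_iff_exists_inc]
  constructor
  · rintro ⟨x | y, h⟩
    · exact ((splice_inc_inl_inl hK hπ).1 h).1.edge_mem
    · exact ((splice_inc_inl_inr hG hK).1 h).1.edge_mem
  · intro he
    obtain ⟨x, y, hl⟩ := G.exists_isLink_of_mem_edgeSet he
    by_cases hx : x = a
    · refine ⟨Sum.inl y, (splice_inc_inl_inl hK hπ).2 ⟨hl.inc_right, ?_⟩⟩
      rintro rfl; subst hx; exact hG.not_isLoopAt _ _ hl
    · exact ⟨Sum.inl x, (splice_inc_inl_inl hK hπ).2 ⟨hl.inc_left, hx⟩⟩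

lemma inr_mem_edgeSet_splice {e : β₂} :
    Sum.inr e ∈ E(splice G K a b π) ↔ e ∈ E(K) ∧ ¬ K.Inc e b := by
  rw [mem_edgeSet_iff_exists_inc]
  constructor
  · rintro ⟨x | y, h⟩
    · exact absurd h splice_inc_inr_inl
    · have := splice_inc_inr_inr.1 h
      exact ⟨this.1.edge_mem, this.2⟩
  · rintro ⟨he, hb⟩
    obtain ⟨x, y, hl⟩ := K.exists_isLink_of_mem_edgeSet he
    exact ⟨Sum.inr x, splice_inc_inr_inr.2 ⟨hl.inc_left, hb⟩⟩

lemma splice_loopless (hG : G.Loopless) (hK : K.Loopless) : (splice G K a b π).Loopless := by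
  refine ⟨fun e x hl => ?_⟩
  have hl' : SpliceLink G K a b π e x x := hl
  cases hl' with
  | left _ _ _ h _ _ => exact hG.not_isLoopAt _ _ h
  | right _ _ _ h _ _ => exact hK.not_isLoopAt _ _ h

/-- A splicing is a gluing. -/
lemma exists_isGluing_splice (hG : G.Loopless) (hK : K.Loopless) (ha : a ∈ V(G)) (hb : b ∈ V(K))
    (hπ : Set.BijOn π (G.incidenceSet a) (K.incidenceSet b)) :
    ∃ g₂, IsGluing (splice G K a b π) G K a b Sum.inl Sum.inr Sum.inl g₂ := by
  classical
  -- In the splicing an edge of `K` at `b` bears the name of its preimage under `π`; the other edges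
  -- of `K` keep their own names.
  obtain ⟨g₂, hinl, hinr⟩ : ∃ g₂ : β₂ → β₁ ⊕ β₂,
      (∀ e', K.Inc e' b → ∃ e, g₂ e' = Sum.inl e ∧ G.Inc e a ∧ π e = e') ∧
      ∀ e', ¬ K.Inc e' b → g₂ e' = Sum.inr e' := by
    have hsurj : ∀ e', K.Inc e' b → ∃ e, G.Inc e a ∧ π e = e' := fun e' he' => hπ.surjOn he'
    refine ⟨fun e' => if h : K.Inc e' b then Sum.inl (hsurj e' h).choose else Sum.inr e',
      fun e' he' => ⟨_, dif_pos he', (hsurj e' he').choose_spec⟩, fun e' he' => dif_neg he'⟩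
  have hmap := hπ.mapsTo
  have hπg : ∀ e, G.Inc e a → g₂ (π e) = Sum.inl e := by
    intro e he
    obtain ⟨e₁, h1, h2, h3⟩ := hinl (π e) (hmap he)
    rw [h1, hπ.injOn h2 he h3]
  have hg : ∀ e e', g₂ e' = Sum.inl e → G.Inc e a ∧ K.Inc e' b ∧ π e = e' := by
    intro e e' hee
    by_cases hb : K.Inc e' b
    · obtain ⟨e₁, h1, h2, h3⟩ := hinl e' hb
      rw [hee] at h1
      cases h1
      exact ⟨h2, hb, h3⟩
    · rw [hinr e' hb] at hee; cases hee
  have hg' : ∀ e e', g₂ e' = Sum.inr e → e' = e ∧ ¬ K.Inc e b := by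
    intro e e' hee
    by_cases hb : K.Inc e' b
    · obtain ⟨e₁, h1, h2, h3⟩ := hinl e' hb
      rw [hee] at h1; cases h1
    · rw [hinr e' hb] at hee; cases hee
      exact ⟨rfl, hb⟩
  refine ⟨g₂, ha, hb, Sum.inl_injective.injOn, Sum.inr_injective.injOn, ?_, rfl,
    Sum.inl_injective.injOn, ?_, ?_, ?_, ?_, ?_, ?_⟩
  · rintro x _ y _ h; cases h
  · intro e₁ _ e₂ _ h12
    rcases h1 : g₂ e₁ with e | e
    · rw [h1] at h12
      rw [← (hg e e₁ h1).2.2, ← (hg e e₂ h12.symm).2.2]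
    · rw [h1] at h12
      rw [(hg' e e₁ h1).1, (hg' e e₂ h12.symm).1]
  · ext (e | e)
    · rw [inl_mem_edgeSet_splice hG hK hmap]
      constructor
      · intro he; exact Or.inl ⟨e, he, rfl⟩
      · rintro (⟨e', he, h⟩ | ⟨e', he, h⟩)
        · cases h; exact he
        · exact (hg e e' h).1.edge_mem
    · rw [inr_mem_edgeSet_splice]
      constructor
      · rintro ⟨he, hb⟩; exact Or.inr ⟨e, he, hinr e hb⟩
      · rintro (⟨e', he, h⟩ | ⟨e', he, h⟩)
        · cases h
        · obtain ⟨rfl, h1⟩ := hg' e e' h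
          exact ⟨he, h1⟩
  · rintro e _ e' _ h
    exact ⟨(hg e e' h.symm).1, (hg e e' h.symm).2.1⟩
  · ext z
    constructor
    · rintro ⟨e, he, rfl⟩
      exact ⟨π e, hmap he, hπg e he⟩
    · rintro ⟨e', he', rfl⟩
      obtain ⟨e₁, h1, h2, h3⟩ := hinl e' he'
      exact ⟨e₁, h2, h1.symm⟩
  · rintro x ⟨_, hxa⟩
    ext (e | e)
    · rw [Graph.mem_incidenceSet, splice_inc_inl_inl hK hmap]
      constructor
      · rintro ⟨he, _⟩; exact ⟨e, he, rfl⟩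
      · rintro ⟨e', he, h⟩; cases h; exact ⟨he, hxa⟩
    · constructor
      · intro he; exact absurd he splice_inc_inr_inl
      · rintro ⟨e', _, h⟩; cases h
  · rintro y ⟨_, hyb⟩
    ext (e | e)
    · rw [Graph.mem_incidenceSet, splice_inc_inl_inr hG hK]
      constructor
      · rintro ⟨he, hy, _, _⟩; exact ⟨π e, hy, hπg e he⟩
      · rintro ⟨e', he, h⟩
        obtain ⟨h1, h2, rfl⟩ := hg e e' h
        exact ⟨h1, he, h2, hyb⟩
    · rw [Graph.mem_incidenceSet, splice_inc_inr_inr]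
      constructor
      · rintro ⟨he, hb⟩; exact ⟨e, he, hinr e hb⟩
      · rintro ⟨e', he, h⟩
        obtain ⟨rfl, h1⟩ := hg' e e' h
        exact ⟨he, h1⟩

variable {f₁ : α₁ → α} {f₂ : α₂ → α} {g₁ : β₁ → β} {g₂ : β₂ → β}

/-- A gluing is isomorphic to a splicing. -/
lemma IsGluing.exists_isIso_splice (h : IsGluing H G K a b f₁ f₂ g₁ g₂) (hH : H.Loopless)
    (hG : G.Loopless) (hK : K.Loopless) [Nonempty β₂] :
    ∃ π, Set.BijOn π (G.incidenceSet a) (K.incidenceSet b) ∧ IsIso H (splice G K a b π) := by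
  classical
  have hex : ∀ e, G.Inc e a → ∃ e', K.Inc e' b ∧ g₂ e' = g₁ e := by
    intro e he
    have : g₁ e ∈ g₂ '' K.incidenceSet b := by rw [← h.star]; exact ⟨e, he, rfl⟩
    exact this
  obtain ⟨π, hπ⟩ : ∃ π : β₁ → β₂, ∀ e, G.Inc e a → K.Inc (π e) b ∧ g₂ (π e) = g₁ e :=
    ⟨fun e => if he : G.Inc e a then (hex e he).choose else Classical.arbitrary _, fun e he => by
      simp only [dif_pos he]; exact (hex e he).choose_spec⟩
  have hbij : Set.BijOn π (G.incidenceSet a) (K.incidenceSet b) := by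
    refine ⟨fun e he => (hπ e he).1, ?_, ?_⟩
    · intro e he e' he' hee
      refine h.injE₁ (Graph.Inc.edge_mem he) (Graph.Inc.edge_mem he') ?_
      rw [← (hπ e he).2, ← (hπ e' he').2, hee]
    · intro e' he'
      have : g₂ e' ∈ g₁ '' G.incidenceSet a := by rw [h.star]; exact ⟨e', he', rfl⟩
      obtain ⟨e, he, hee⟩ := this
      refine ⟨e, he, h.injE₂ (hπ e he).1.edge_mem (Graph.Inc.edge_mem he') ?_⟩
      rw [(hπ e he).2, hee]
  have hmap := hbij.mapsTo
  -- The isomorphism runs from the splicing to `H`. Although `g₁` and `g₂` agree on the star, the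
  -- edge map is injective there, since the splicing keeps only the copy coming from `G`.
  refine ⟨π, hbij, IsIso.symm (IsGraphIso.isIso (f := Sum.elim f₁ f₂) (g := Sum.elim g₁ g₂)
    (isGraphIso_of_inc (splice_loopless hG hK) hH ⟨?_, ?_, ?_⟩ ⟨?_, ?_, ?_⟩ ?_))⟩
  · rw [h.vertexSet_eq]
    rintro _ (⟨x, hx, rfl⟩ | ⟨x, hx, rfl⟩)
    · exact Or.inl ⟨x, hx, rfl⟩
    · exact Or.inr ⟨x, hx, rfl⟩
  · rintro _ (⟨x, hx, rfl⟩ | ⟨x, hx, rfl⟩) _ (⟨y, hy, rfl⟩ | ⟨y, hy, rfl⟩) hxy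
    · exact congrArg _ (h.injV₁ hx hy hxy)
    · exact absurd hxy (h.ne x hx y hy)
    · exact absurd hxy.symm (h.ne y hy x hx)
    · exact congrArg _ (h.injV₂ hx hy hxy)
  · rw [h.vertexSet_eq]
    rintro _ (⟨x, hx, rfl⟩ | ⟨x, hx, rfl⟩)
    · exact ⟨Sum.inl x, Or.inl ⟨x, hx, rfl⟩, rfl⟩
    · exact ⟨Sum.inr x, Or.inr ⟨x, hx, rfl⟩, rfl⟩
  · rw [h.edgeSet_eq]
    rintro (e | e) he
    · exact Or.inl ⟨e, (inl_mem_edgeSet_splice hG hK hmap).1 he, rfl⟩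
    · exact Or.inr ⟨e, (inr_mem_edgeSet_splice.1 he).1, rfl⟩
  · rintro (e | e) he (e' | e') he' hee
    · exact congrArg _ (h.injE₁ ((inl_mem_edgeSet_splice hG hK hmap).1 he)
        ((inl_mem_edgeSet_splice hG hK hmap).1 he') hee)
    · exact absurd (h.inc_of_eq e ((inl_mem_edgeSet_splice hG hK hmap).1 he) e'
        (inr_mem_edgeSet_splice.1 he').1 hee).2 (inr_mem_edgeSet_splice.1 he').2
    · exact absurd (h.inc_of_eq e' ((inl_mem_edgeSet_splice hG hK hmap).1 he') e
        (inr_mem_edgeSet_splice.1 he).1 hee.symm).2 (inr_mem_edgeSet_splice.1 he).2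
    · exact congrArg _ (h.injE₂ (inr_mem_edgeSet_splice.1 he).1
        (inr_mem_edgeSet_splice.1 he').1 hee)
  · rw [h.edgeSet_eq]
    rintro _ (⟨e, he, rfl⟩ | ⟨e, he, rfl⟩)
    · exact ⟨Sum.inl e, (inl_mem_edgeSet_splice hG hK hmap).2 he, rfl⟩
    · by_cases hb : K.Inc e b
      · obtain ⟨e', he', rfl⟩ := hbij.surjOn hb
        exact ⟨Sum.inl e', (inl_mem_edgeSet_splice hG hK hmap).2 (Graph.Inc.edge_mem he'),
          (hπ e' he').2.symm⟩
      · exact ⟨Sum.inr e, inr_mem_edgeSet_splice.2 ⟨he, hb⟩, rfl⟩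
  · rintro (e | e) he _ (⟨x, hx, rfl⟩ | ⟨x, hx, rfl⟩)
    · have he' := (inl_mem_edgeSet_splice hG hK hmap).1 he
      rw [splice_inc_inl_inl hK hmap, Sum.elim_inl, Sum.elim_inl, ← Graph.mem_incidenceSet (G := H),
        h.inc₁ x hx]
      constructor
      · rintro ⟨hi, _⟩; exact ⟨e, hi, rfl⟩
      · rintro ⟨e₁, h1, h2⟩
        rw [← h.injE₁ (Graph.Inc.edge_mem h1) he' h2]
        exact ⟨h1, hx.2⟩
    · have he' := (inl_mem_edgeSet_splice hG hK hmap).1 he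
      rw [splice_inc_inl_inr hG hK, Sum.elim_inl, Sum.elim_inr, ← Graph.mem_incidenceSet (G := H),
        h.inc₂ x hx]
      constructor
      · rintro ⟨hi, hy, _, _⟩; exact ⟨π e, hy, (hπ e hi).2⟩
      · rintro ⟨e₁, h1, h2⟩
        have h3 := h.inc_of_eq e he' e₁ (Graph.Inc.edge_mem h1) h2.symm
        have h4 : π e = e₁ := h.injE₂ (hπ e h3.1).1.edge_mem (Graph.Inc.edge_mem h1)
          ((hπ e h3.1).2.trans h2.symm)
        rw [h4]
        exact ⟨h3.1, h1, h3.2, hx.2⟩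
    · have he' := inr_mem_edgeSet_splice.1 he
      refine iff_of_false splice_inc_inr_inl ?_
      rw [Sum.elim_inl, Sum.elim_inr, ← Graph.mem_incidenceSet (G := H), h.inc₁ x hx]
      rintro ⟨e₁, h1, h2⟩
      exact he'.2 (h.inc_of_eq e₁ (Graph.Inc.edge_mem h1) e he'.1 h2).2
    · have he' := inr_mem_edgeSet_splice.1 he
      rw [splice_inc_inr_inr, Sum.elim_inr, Sum.elim_inr, ← Graph.mem_incidenceSet (G := H),
        h.inc₂ x hx]
      constructor
      · rintro ⟨hi, _⟩; exact ⟨e, hi, rfl⟩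
      · rintro ⟨e₁, h1, h2⟩
        rw [← h.injE₂ (Graph.Inc.edge_mem h1) he'.1 h2]
        exact ⟨h1, by rw [h.injE₂ (Graph.Inc.edge_mem h1) he'.1 h2]; exact he'.2⟩

/-- The second part of a gluing may be replaced by an isomorphic graph. -/
lemma IsGluing.comp_isGraphIso {α₃ : Type*} {β₃ : Type*} {K' : Graph α₃ β₃} {b' : α₃}
    {φ : α₃ → α₂} {ψ : β₃ → β₂} (h : IsGluing H G K a (φ b') f₁ f₂ g₁ g₂)
    (hi : IsGraphIso K' K φ ψ) (hb' : b' ∈ V(K')) :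
    IsGluing H G K' a b' f₁ (f₂ ∘ φ) g₁ (g₂ ∘ ψ) := by
  have hmem : ∀ {x}, x ∈ V(K') \ {b'} → φ x ∈ V(K) \ {φ b'} := fun {x} hx =>
    ⟨hi.bijV.mapsTo hx.1, fun hf => hx.2 (hi.bijV.injOn hx.1 hb' hf)⟩
  refine ⟨h.mem₁, hb', h.injV₁, ?_, ?_, ?_, h.injE₁, ?_, ?_, ?_, ?_, h.inc₁, ?_⟩
  · exact h.injV₂.comp (hi.bijV.injOn.mono Set.sdiff_subset) fun x hx => hmem hx
  · exact fun x hx y hy => h.ne x hx _ (hmem hy)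
  · have : V(K) \ {φ b'} = φ '' (V(K') \ {b'}) := by
      ext x
      constructor
      · rintro ⟨hx, hxb⟩
        obtain ⟨x, hx', rfl⟩ := hi.bijV.surjOn hx
        exact ⟨x, ⟨hx', fun hf => hxb (congrArg φ hf)⟩, rfl⟩
      · rintro ⟨x, hx, rfl⟩; exact hmem hx
    rw [h.vertexSet_eq, this, Set.image_comp]
  · exact h.injE₂.comp hi.bijE.injOn hi.bijE.mapsTo
  · rw [h.edgeSet_eq, ← hi.bijE.image_eq, Set.image_comp]
  · intro e he e' he' hee
    have := h.inc_of_eq e he _ (hi.bijE.mapsTo he') hee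
    exact ⟨this.1, (hi.inc_iff he' hb').2 this.2⟩
  · rw [h.star, hi.image_incidenceSet hb', Set.image_comp]
  · intro x hx
    rw [Function.comp, h.inc₂ _ (hmem hx), hi.image_incidenceSet hx.1, Set.image_comp]

end Splice

/-! ### The graph `K33`. -/

section K33

lemma K33_isLink_iff {e : Sym2 (Fin 3 ⊕ Fin 3)} {x y : Fin 3 ⊕ Fin 3} :
    K33.IsLink e x y ↔ e = s(x, y) ∧ x.isLeft ≠ y.isLeft := by
  rw [K33, Graph.ofSimpleGraph_isLink]
  constructor
  · rintro ⟨rfl, h⟩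
    rw [SimpleGraph.mem_edgeSet] at h
    refine ⟨rfl, ?_⟩
    rcases x with x | x <;> rcases y with y | y <;> simp at h ⊢
  · rintro ⟨rfl, h⟩
    rw [SimpleGraph.mem_edgeSet]
    refine ⟨rfl, ?_⟩
    rcases x with x | x <;> rcases y with y | y <;> simp at h ⊢

lemma K33_inc_iff {e : Sym2 (Fin 3 ⊕ Fin 3)} {x : Fin 3 ⊕ Fin 3} :
    K33.Inc e x ↔ ∃ y, y.isLeft ≠ x.isLeft ∧ s(x, y) = e := by
  constructor
  · rintro ⟨y, hl⟩
    rw [K33_isLink_iff] at hl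
    exact ⟨y, hl.2.symm, hl.1.symm⟩
  · rintro ⟨y, hl, rfl⟩
    exact ⟨y, K33_isLink_iff.2 ⟨rfl, hl.symm⟩⟩

lemma mem_vertexSet_K33 (x : Fin 3 ⊕ Fin 3) : x ∈ V(K33) := Set.mem_univ x

lemma isBipCubic_K33 : IsBipCubic K33 (Set.range Sum.inl) (Set.range Sum.inr) := by
  have hb : IsBipartition K33 (Set.range Sum.inl) (Set.range Sum.inr) := by
    refine ⟨Set.range_inl_union_range_inr, Set.isCompl_range_inl_range_inr.disjoint, ?_⟩
    intro e x y hl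
    rw [K33_isLink_iff] at hl
    rcases x with x | x <;> rcases y with y | y <;> simp at hl ⊢
  refine ⟨Set.toFinite _, hb, hb.loopless, fun x _ => ?_⟩
  have h1 : K33.incidenceSet x = (fun y => s(x, y)) '' {y | y.isLeft ≠ x.isLeft} := by
    ext e
    rw [Graph.mem_incidenceSet, K33_inc_iff]
    rfl
  rw [degIn, Set.inter_eq_right.2 (Graph.incidenceSet_subset_edgeSet x), h1,
    Set.ncard_image_of_injective _ (fun y z h => Sym2.congr_right.1 h)]
  rcases x with x | x
  · have : {y : Fin 3 ⊕ Fin 3 | y.isLeft ≠ (Sum.inl x : Fin 3 ⊕ Fin 3).isLeft} =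
        Set.range Sum.inr := by
      ext (y | y) <;> simp
    rw [this, ← Set.image_univ, Set.ncard_image_of_injective _ Sum.inr_injective]
    simp [Set.ncard_univ]
  · have : {y : Fin 3 ⊕ Fin 3 | y.isLeft ≠ (Sum.inr x : Fin 3 ⊕ Fin 3).isLeft} =
        Set.range Sum.inl := by
      ext (y | y) <;> simp
    rw [this, ← Set.image_univ, Set.ncard_image_of_injective _ Sum.inl_injective]
    simp [Set.ncard_univ]

/-- The union of the stars of `x` and `y` is the required subgraph, because each other vertex is
adjacent to exactly one of them. -/
lemma isLambdaMatchable_K33 {x y : Fin 3 ⊕ Fin 3} (hxy : x.isLeft ≠ y.isLeft) :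
    IsLambdaMatchable K33 x y := by
  have hd : ∀ x : Fin 3 ⊕ Fin 3, ∀ M, K33.incidenceSet x ⊆ M → degIn K33 M x = 3 := by
    intro x M hM
    rw [degIn, Set.inter_eq_right.2 hM,
      isBipCubic_K33.cubic.ncard_incidenceSet (mem_vertexSet_K33 x)]
  have key : ∀ x y z : Fin 3 ⊕ Fin 3, x.isLeft ≠ y.isLeft → z ≠ x → z ≠ y → z.isLeft ≠ y.isLeft →
      degIn K33 (K33.incidenceSet x ∪ K33.incidenceSet y) z = 1 := by
    intro x y z hxy hzx hzy hz
    rw [degIn, Set.ncard_eq_one]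
    refine ⟨s(z, y), ?_⟩
    ext e
    simp only [Set.mem_inter_iff, Set.mem_union, Graph.mem_incidenceSet, Set.mem_singleton_iff,
      K33_inc_iff]
    constructor
    · rintro ⟨⟨w, hw, rfl⟩ | ⟨w, hw, rfl⟩, w', hw', h⟩
      · rw [Sym2.eq_iff] at h
        rcases h with ⟨rfl, rfl⟩ | ⟨rfl, rfl⟩
        · exact absurd rfl hzx
        · exfalso
          revert hw hxy hz
          cases z.isLeft <;> cases w'.isLeft <;> cases y.isLeft <;> simp
      · rw [Sym2.eq_iff] at h
        rcases h with ⟨rfl, rfl⟩ | ⟨rfl, rfl⟩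
        · exact absurd rfl hzy
        · exact Sym2.eq_swap
    · rintro rfl
      exact ⟨Or.inr ⟨z, hz, Sym2.eq_swap⟩, y, hz.symm, rfl⟩
  refine ⟨mem_vertexSet_K33 x, mem_vertexSet_K33 y, by rintro rfl; exact hxy rfl,
    K33.incidenceSet x ∪ K33.incidenceSet y,
    Set.union_subset (Graph.incidenceSet_subset_edgeSet x) (Graph.incidenceSet_subset_edgeSet y),
    hd x _ Set.subset_union_left, hd y _ Set.subset_union_right, ?_⟩
  intro z _ hzx hzy
  by_cases hz : z.isLeft = y.isLeft
  · rw [Set.union_comm]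
    exact key y x z hxy.symm hzy hzx (hz ▸ hxy.symm)
  · exact key x y z hxy hzx hzy hz

lemma isLambdaMatchable_K33_iff {x y : Fin 3 ⊕ Fin 3} :
    IsLambdaMatchable K33 x y ↔ x.isLeft ≠ y.isLeft := by
  refine ⟨fun h => ?_, isLambdaMatchable_K33⟩
  have := isBipCubic_K33.mem_iff_of_isLambdaMatchable h
  rcases x with x | x <;> rcases y with y | y <;> simp at this ⊢

lemma numPartners_K33 (x : Fin 3 ⊕ Fin 3) : numPartners K33 x = 3 := by
  have : {w | IsLambdaMatchable K33 x w} =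
      ((Finset.univ.filter fun w : Fin 3 ⊕ Fin 3 => x.isLeft ≠ w.isLeft : Finset _) : Set _) := by
    ext w; simp [isLambdaMatchable_K33_iff]
  rw [numPartners, this, Set.ncard_coe_finset]
  clear this
  revert x; decide

lemma numPairs_K33 : numPairs K33 = 18 := by
  have : {p : (Fin 3 ⊕ Fin 3) × (Fin 3 ⊕ Fin 3) | IsLambdaMatchable K33 p.1 p.2} =
      ((Finset.univ.filter fun p : (Fin 3 ⊕ Fin 3) × (Fin 3 ⊕ Fin 3) =>
        p.1.isLeft ≠ p.2.isLeft : Finset _) : Set _) := by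
    ext w; simp [isLambdaMatchable_K33_iff]
  rw [numPairs, this, Set.ncard_coe_finset]
  decide

lemma order_K33 : order K33 = 6 := by
  rw [order, show V(K33) = Set.univ from rfl, Set.ncard_univ]
  simp

variable {α : Type u} {β : Type v} {G : Graph α β} {A B : Set α}

/-- Three distinct neighbors in a color class of size three are the whole class, and there are no
parallel edges. -/
lemma IsBipCubic.exists_isGraphIso_K33 (h : IsBipCubic G A B) (h3 : IsThreeEdgeConnected G)
    (hn : order G = 6) : ∃ f g, IsGraphIso K33 G f g := by
  have hA : A.ncard = 3 := by have := h.order_eq; omega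
  have hB : B.ncard = 3 := by rw [← h.ncard_eq, hA]
  have : Finite A := h.finite_left
  have : Finite B := h.finite_right
  let eA := (Finite.equivFinOfCardEq (α := A) (by rw [Nat.card_coe_set_eq, hA])).symm
  let eB := (Finite.equivFinOfCardEq (α := B) (by rw [Nat.card_coe_set_eq, hB])).symm
  set f : Fin 3 ⊕ Fin 3 → α := Sum.elim (fun i => (eA i : α)) (fun i => (eB i : α)) with hf
  have hfV : ∀ x, f x ∈ V(G) := by
    rintro (x | x)
    · exact h.bip.left_subset (eA x).2
    · exact h.bip.right_subset (eB x).2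
  have hinj : Function.Injective f := by
    rintro (x | x) (y | y) hxy
    · exact congrArg _ (eA.injective (Subtype.ext hxy))
    · have hxy' : (eA x : α) = eB y := hxy
      exact absurd (eB y).2 (hxy' ▸ h.bip.notMem_right (eA x).2)
    · have hxy' : (eB x : α) = eA y := hxy
      exact absurd (eB x).2 (hxy' ▸ h.bip.notMem_right (eA y).2)
    · exact congrArg _ (eB.injective (Subtype.ext hxy))
  have hadj : ∀ a ∈ A, ∀ b ∈ B, G.Adj a b := by
    intro a ha b hb
    have h1 : nbrs G a = B := Set.eq_of_subset_of_ncard_le (h.bip.nbrs_subset ha)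
      (by rw [hB, h.ncard_nbrs h3 (by omega) (h.bip.left_subset ha)]) h.finite_right
    rw [← h1] at hb; exact hb
  have hadj' : ∀ x y : Fin 3 ⊕ Fin 3, x.isLeft ≠ y.isLeft → G.Adj (f x) (f y) := by
    rintro (x | x) (y | y) hxy
    · simp at hxy
    · exact hadj _ (eA x).2 _ (eB y).2
    · exact (hadj _ (eA y).2 _ (eB x).2).symm
    · simp at hxy
  -- The image edge must serve both orientations of the unordered pair `e`.
  have hg : ∀ e ∈ E(K33), ∃ e', ∀ x y, e = s(x, y) → G.IsLink e' (f x) (f y) := by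
    intro e he
    obtain ⟨x, y, hl⟩ := Graph.exists_isLink_of_mem_edgeSet he
    rw [K33_isLink_iff] at hl
    obtain ⟨e', he'⟩ := hadj' x y hl.2
    refine ⟨e', fun p q hpq => ?_⟩
    rw [hl.1, Sym2.eq_iff] at hpq
    rcases hpq with ⟨rfl, rfl⟩ | ⟨rfl, rfl⟩
    · exact he'
    · exact he'.symm
  have : Nonempty β := by
    obtain ⟨e, _⟩ := hadj' (Sum.inl 0) (Sum.inr 0) (by simp)
    exact ⟨e⟩
  choose! g hg using hg
  have hloop := isBipCubic_K33.cubic.loopless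
  have heq : ∀ e ∈ E(K33), ∀ x y, G.IsLink (g e) (f x) (f y) → e = s(x, y) := by
    intro e he x y hl
    obtain ⟨p, q, hpq⟩ := Graph.exists_isLink_of_mem_edgeSet he
    rw [K33_isLink_iff] at hpq
    rcases (hg e he p q hpq.1).eq_and_eq_or_eq_and_eq hl with ⟨h1, h2⟩ | ⟨h1, h2⟩
    · rw [hpq.1, hinj h1, hinj h2]
    · rw [hpq.1, hinj h1, hinj h2, Sym2.eq_swap]
  refine ⟨f, g, ⟨fun x _ => hfV x, hinj.injOn, ?_⟩, ⟨?_, ?_, ?_⟩, ?_⟩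
  · intro x hx
    rcases h.bip.mem_or hx with h1 | h1
    · exact ⟨Sum.inl (eA.symm ⟨x, h1⟩), mem_vertexSet_K33 _, by simp [hf]⟩
    · exact ⟨Sum.inr (eB.symm ⟨x, h1⟩), mem_vertexSet_K33 _, by simp [hf]⟩
  · intro e he
    obtain ⟨x, y, hl⟩ := Graph.exists_isLink_of_mem_edgeSet he
    exact (hg e he x y (K33_isLink_iff.1 hl).1).edge_mem
  · intro e he e' he' hee
    obtain ⟨x, y, hl⟩ := Graph.exists_isLink_of_mem_edgeSet he
    have h1 := (K33_isLink_iff.1 hl).1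
    have h2 := hg e he x y h1
    rw [hee] at h2
    rw [h1, heq e' he' x y h2]
  · intro e he
    obtain ⟨a, ha, b, hb, hl⟩ := h.bip.exists_isLink he
    have hE : K33.IsLink s(Sum.inl (eA.symm ⟨a, ha⟩), Sum.inr (eB.symm ⟨b, hb⟩))
        (Sum.inl (eA.symm ⟨a, ha⟩)) (Sum.inr (eB.symm ⟨b, hb⟩)) :=
      K33_isLink_iff.2 ⟨rfl, by simp⟩
    have h1 := hg _ hE.edge_mem _ _ rfl
    simp only [hf, Sum.elim_inl, Sum.elim_inr, Equiv.apply_symm_apply] at h1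
    exact ⟨_, hE.edge_mem, h.eq_of_isLink h3 (by omega) h1 hl⟩
  · intro e he x _ y _
    constructor
    · intro hl
      exact hg e he x y (K33_isLink_iff.1 hl).1
    · intro hl
      have h1 := heq e he x y hl
      refine K33_isLink_iff.2 ⟨h1, fun h2 => ?_⟩
      obtain ⟨p, q, hpq⟩ := Graph.exists_isLink_of_mem_edgeSet he
      rw [K33_isLink_iff, h1, Sym2.eq_iff] at hpq
      rcases hpq with ⟨⟨rfl, rfl⟩ | ⟨rfl, rfl⟩, h3⟩
      · exact h3 h2
      · exact h3 h2.symm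

end K33

/-! ### Characterization of the family 𝒦. -/

section FamilyK

/-- The members of `𝒦` are bipartite and cubic, with as few `λ`-matchable pairs as possible. -/
lemma FamilyK.exists_isBipCubic {α : Type u} {β : Type v} {G : Graph α β} (h : FamilyK G) :
    (∃ A B, IsBipCubic G A B) ∧ numPairs G + 18 = 6 * order G := by
  induction h with
  | base G hiso =>
    have : Nonempty (Sym2 (Fin 3 ⊕ Fin 3)) := ⟨s(Sum.inl 0, Sum.inl 0)⟩
    obtain ⟨f, g, h⟩ := hiso.exists_isGraphIso
    refine ⟨⟨_, _, h.isBipCubic isBipCubic_K33⟩, ?_⟩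
    rw [← h.numPairs_eq, ← h.order_eq, numPairs_K33, order_K33]
  | step G hG a ha ha3 b hb π hπ J hJ ih =>
    have : Nonempty (Sym2 (Fin 3 ⊕ Fin 3)) := ⟨s(Sum.inl 0, Sum.inl 0)⟩
    obtain ⟨⟨A₀, B₀, h₀⟩, hR⟩ := ih
    obtain ⟨B₁, A₁, h₁, haB⟩ := h₀.exists_mem_left ha
    obtain ⟨A₂, B₂, h₂, hbA⟩ := isBipCubic_K33.exists_mem_left hb
    obtain ⟨f, g, h⟩ := hJ.exists_isGraphIso
    obtain ⟨g₂, hgl⟩ := exists_isGluing_splice h₁.cubic.loopless h₂.cubic.loopless ha hb hπ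
    refine ⟨⟨_, _, h.isBipCubic (hgl.isBipCubic h₁.symm h₂ haB hbA)⟩, ?_⟩
    have h1 := hgl.numPairs_eq h₁ h₂
    have h2 := hgl.order_add_two h₁.finite h₂.finite
    rw [numPartners_K33, ha3, numPairs_K33, h.numPairs_eq] at h1
    rw [order_K33, h.order_eq] at h2
    omega

variable {α : Type u} {β : Type v} {G : Graph α β} {A B : Set α}

/-- The two bounds combined no longer mention a decomposition, so they apply to each contraction
separately. -/
lemma IsBipCubic.six_mul_order_le (h : IsBipCubic G A B) (h3 : IsThreeEdgeConnected G)
    (hn : 2 < order G) : 6 * order G ≤ numPairs G + 18 := by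
  obtain ⟨L, hL⟩ := h.exists_decomposition h3 (vertexSet_nonempty_of_order hn)
  obtain ⟨h1, h2, _⟩ := hL.bounds h h3 hn
  have : (6 * order G : ℚ) ≤ numPairs G + 18 := by linarith
  exact_mod_cast this

/-- A graph with as few `λ`-matchable pairs as possible is in `𝒦`. -/
lemma IsBipCubic.familyK (h : IsBipCubic G A B) (h3 : IsThreeEdgeConnected G)
    (hn : 2 < order G) (hR : numPairs G + 18 = 6 * order G) : FamilyK G := by
  induction ho : order G using Nat.strong_induction_on generalizing G A B with
  | _ n ih =>
    subst ho
    -- For a brace of order `2 * k`, equality reads `(k - 3) ^ 2 = 0`.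
    have six_of_free : ∀ {G : Graph α β} {A B : Set α}, IsBipCubic G A B →
        IsThreeEdgeConnected G → 2 < order G → numPairs G + 18 = 6 * order G →
        (∀ X, ¬ IsNontrivialTightCut G X) → order G = 6 := by
      intro G A B h h3 hn hR hfree
      rw [h.numPairs_eq, h.rho_of_free h3 hn hfree, h.order_eq] at hR
      have hz : ((A.ncard : ℤ) - 3) * ((A.ncard : ℤ) - 3) = 0 := by
        have : 2 * ((A.ncard : ℤ) * A.ncard) + 18 = 6 * (2 * A.ncard) := by exact_mod_cast hR
        linarith
      have := mul_self_eq_zero.1 hz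
      have := h.order_eq
      omega
    by_cases hfree : ∀ X, ¬ IsNontrivialTightCut G X
    · obtain ⟨f, g, hi⟩ := h.exists_isGraphIso_K33 h3 (six_of_free h h3 hn hR hfree)
      exact .base G hi.isIso.symm
    · push Not at hfree
      -- A smallest shore is chosen, so that contracting its complement leaves a graph without
      -- nontrivial tight cuts.
      have hex : ∃ k, ∃ X, IsNontrivialTightCut G X ∧ X.ncard = k := by
        obtain ⟨X, hX⟩ := hfree; exact ⟨_, X, hX, rfl⟩
      classical
      obtain ⟨X, hX, hXk⟩ := Nat.find_spec hex
      have hmin : ∀ Z ⊂ X, ¬ IsNontrivialTightCut G Z := by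
        intro Z hZ hZt
        refine Nat.find_min hex ?_ ⟨Z, hZt, rfl⟩
        rw [← hXk]
        exact Set.ncard_lt_ncard hZ (h.finite.subset hX.subset)
      obtain ⟨x, hx⟩ := hX.nontrivial.nonempty
      obtain ⟨y, hy⟩ := hX.nontrivial_compl.nonempty
      obtain ⟨A₁, B₁, h₁⟩ := h.exists_contract hX.compl hy
      obtain ⟨A₂, B₂, h₂⟩ := h.exists_contract hX hx
      have c₁ := h3.contract Set.sdiff_subset hy
      have c₂ := h3.contract hX.subset hx
      have n₁ := two_lt_order_contract h.finite hX.compl hy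
      have n₂ := two_lt_order_contract h.finite hX hx
      have hgl := isGluing_contract hX.subset hx hy
      have hN := hgl.numPairs_eq h₁ h₂
      have hO := hgl.order_add_two h₁.finite h₂.finite
      have r₁ := h₁.three_le_numPartners c₁ n₁ hgl.mem₁
      have r₂ := h₂.three_le_numPartners c₂ n₂ hgl.mem₂
      have b₁ := h₁.six_mul_order_le c₁ n₁
      have b₂ := h₂.six_mul_order_le c₂ n₂
      -- The lower bounds for the two parts and for their numbers of partners already add up to the
      -- value attained by `G`, so each is attained.
      have hR₂ : numPairs (contract G (V(G) \ X) y) + 18 = 6 * order (contract G (V(G) \ X) y) ∧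
          numPairs (contract G X x) + 18 = 6 * order (contract G X x) ∧
          numPartners (contract G X x) x = 3 := by
        obtain ⟨t₁, ht₁⟩ := Nat.exists_eq_add_of_le r₁
        obtain ⟨t₂, ht₂⟩ := Nat.exists_eq_add_of_le r₂
        rw [ht₁, ht₂] at hN
        have hN' : numPairs G = numPairs (contract G (V(G) \ X) y) + numPairs (contract G X x) +
            6 + 4 * t₁ + 4 * t₂ + 2 * (t₁ * t₂) := by linarith
        refine ⟨?_, ?_, ?_⟩ <;> omega
      have h6 := six_of_free h₁ c₁ n₁ hR₂.1 (contract_free_of_minimal hX hy hmin)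
      obtain ⟨f, g, hi⟩ := h₁.exists_isGraphIso_K33 c₁ h6
      obtain ⟨b, hb, rfl⟩ := hi.bijV.surjOn hgl.mem₁
      have : Nonempty (Sym2 (Fin 3 ⊕ Fin 3)) := ⟨s(Sum.inl 0, Sum.inl 0)⟩
      -- The gluing is reversed because `K33` must be the second graph of the splicing.
      obtain ⟨π, hπ, hiso⟩ := (hgl.symm.comp_isGraphIso hi hb).exists_isIso_splice
        h.cubic.loopless h₂.cubic.loopless isBipCubic_K33.cubic.loopless
      exact .step _ (ih _ (order_contract_lt h.finite hX hx) h₂ c₂ n₂ hR₂.2.1 rfl) x hgl.mem₂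
        hR₂.2.2 b hb π hπ G hiso

end FamilyK

/-! ### From 3-connectivity to 3-edge-connectivity. -/

section Connectivity

variable {α : Type u} {β : Type v} {G : Graph α β}

/-- The first step of a walk out of `X`. -/
lemma IsWalk.exists_cut_step {X : Set α} {x y : α} {w : List (β × α)} (h : IsWalk G x w y)
    (hx : x ∈ X) (hy : y ∉ X) :
    ∃ w₁ e q w₂ p, w = w₁ ++ (e, q) :: w₂ ∧ G.IsLink e p q ∧ p ∈ X ∧ q ∉ X ∧
      ((w₁ = [] ∧ p = x) ∨ ∃ w₁' e', w₁ = w₁' ++ [(e', p)]) := by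
  induction h with
  | nil x _ => exact absurd hx hy
  | cons x y z e w he hw ih =>
    by_cases hyX : y ∈ X
    · obtain ⟨w₁, e₁, q, w₂, p, rfl, hl, hp, hq, h1⟩ := ih hyX hy
      refine ⟨(e, y) :: w₁, e₁, q, w₂, p, rfl, hl, hp, hq, Or.inr ?_⟩
      rcases h1 with ⟨rfl, rfl⟩ | ⟨w₁', e', rfl⟩
      · exact ⟨[], e, rfl⟩
      · exact ⟨(e, y) :: w₁', e', rfl⟩
    · exact ⟨[], e, y, w, x, rfl, he, hx, hyX, Or.inl ⟨rfl, rfl⟩⟩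

lemma IsWalk.map_snd_eq {x y : α} {w : List (β × α)} (h : IsWalk G x w y) (hw : w ≠ []) :
    w.map Prod.snd = internalVertices w ++ [y] := by
  induction h with
  | nil x _ => exact absurd rfl hw
  | cons x y z e w he hwalk ih =>
    rcases w with _ | ⟨s, w⟩
    · cases hwalk; rfl
    · have := ih (by simp)
      simp only [internalVertices, List.map_cons] at this ⊢
      rw [List.dropLast_cons_of_ne_nil (by simp), List.cons_append, ← this]

/-- A `k`-connected graph has no small cuts. -/
lemma IsKConnected.le_ncard_cut {k : ℕ} (h : IsKConnected G k) (hE : E(G).Finite) {X : Set α}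
    (hX : X ⊆ V(G)) (hne : X.Nonempty) (hp : X ≠ V(G)) : k ≤ (cut G X).ncard := by
  obtain ⟨x, hx⟩ := hne
  obtain ⟨y, hyV, hy⟩ := Set.exists_of_ssubset (hX.ssubset_of_ne hp)
  have hxy : x ≠ y := by rintro rfl; exact hy hx
  obtain ⟨P, hinj, hP, hdisj⟩ := h.2 x (hX hx) y hyV hxy
  choose w₁ e q w₂ p heq hl hpX hqX hstart using fun i => (hP i).1.exists_cut_step hx hy
  have hne : ∀ i, P i ≠ [] := fun i => by rw [heq]; simp
  have hlast := fun i => (hP i).1.map_snd_eq (hne i)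
  have hyint : ∀ i, y ∉ internalVertices (P i) := by
    intro i hi
    have := (hP i).2
    rw [hlast, List.nodup_cons, List.nodup_append] at this
    exact this.2.2.2 y hi y (by simp) rfl
  have hxint : ∀ i, x ∉ internalVertices (P i) := by
    intro i hi
    have := (hP i).2
    rw [hlast, List.nodup_cons] at this
    exact this.1 (by simp [hi])
  -- The ends of the crossing edge are internal unless the crossing is the first step (for `p i`) or
  -- the last step (for `q i`).
  have hpint : ∀ i, (w₁ i = [] ∧ p i = x) ∨ p i ∈ internalVertices (P i) := by
    intro i
    rcases hstart i with h1 | ⟨w₁', e', h1⟩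
    · exact Or.inl h1
    · right
      rw [internalVertices, heq, h1]
      simp
  have hqint : ∀ i, (w₂ i = [] ∧ q i = y) ∨ q i ∈ internalVertices (P i) := by
    intro i
    rcases h2 : w₂ i with _ | ⟨s, t⟩
    · left
      have := hlast i
      rw [heq, h2, List.map_append, List.map_cons, List.map_nil] at this
      exact ⟨rfl, (List.append_inj' this rfl).2 |> List.cons.inj |>.1⟩
    · right
      rw [internalVertices, heq, h2]
      simp
  -- If two paths cross by the same edge, its ends are internal to neither path, so they are `x` and
  -- `y`. Both paths then consist of this edge alone, contradicting their distinctness.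
  have hinj' : Function.Injective e := by
    intro i j hij
    by_contra hne
    have hl' := hl j
    rw [← hij] at hl'
    obtain ⟨hpp, hqq⟩ : p i = p j ∧ q i = q j := by
      rcases (hl i).eq_and_eq_or_eq_and_eq hl' with h1 | h1
      · exact h1
      · exact absurd (h1.1 ▸ hpX i) (hqX j)
    have h1 : w₁ i = [] ∧ w₁ j = [] := by
      rcases hpint i with h1 | h1 <;> rcases hpint j with h2 | h2
      · exact ⟨h1.1, h2.1⟩
      · rw [← hpp, h1.2] at h2; exact absurd h2 (hxint j)
      · rw [hpp, h2.2] at h1; exact absurd h1 (hxint i)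
      · rw [← hpp] at h2; exact absurd h2 (hdisj i j hne h1)
    have h2 : w₂ i = [] ∧ w₂ j = [] := by
      rcases hqint i with h1 | h1 <;> rcases hqint j with h2 | h2
      · exact ⟨h1.1, h2.1⟩
      · rw [← hqq, h1.2] at h2; exact absurd h2 (hyint j)
      · rw [hqq, h2.2] at h1; exact absurd h1 (hyint i)
      · rw [← hqq] at h2; exact absurd h2 (hdisj i j hne h1)
    apply hne
    apply hinj
    rw [heq i, heq j, h1.1, h1.2, h2.1, h2.2, hij, hqq]
  calc k = (Set.range e).ncard := by
        rw [← Set.image_univ, Set.ncard_image_of_injective _ hinj', Set.ncard_univ, Nat.card_fin]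
    _ ≤ (cut G X).ncard := by
        refine Set.ncard_le_ncard ?_ (hE.subset (cut_subset X))
        rintro _ ⟨i, rfl⟩
        exact ⟨p i, q i, hl i, hpX i, hqX i⟩

end Connectivity

/-! ### Graphs of order two, and the theorem. -/

section Main

variable {α : Type u} {β : Type v} {G : Graph α β} {A B : Set α}

lemma IsBipCubic.simple (h : IsBipCubic G A B) (h3 : IsThreeEdgeConnected G) (hn : 2 < order G) :
    G.Simple where
  not_isLoopAt := h.cubic.loopless.not_isLoopAt
  eq_of_isLink _ _ _ _ he hf := h.eq_of_isLink h3 hn he hf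

lemma IsTightCutDecomposition.eq_singleton {L : Multiset (Graph α β)}
    (hL : IsTightCutDecomposition G L) (hfree : ∀ X, ¬ IsNontrivialTightCut G X) : L = {G} := by
  cases hL with
  | leaf => rfl
  | node _ _ X hX => exact absurd hX (hfree X)

lemma IsBipCubic.free_of_order_le (h : IsBipCubic G A B) (hn : order G ≤ 2) (X : Set α) :
    ¬ IsNontrivialTightCut G X := by
  intro hX
  obtain ⟨x, hx⟩ := hX.nontrivial.nonempty
  have h1 := order_contract_lt h.finite hX hx
  have h2 := two_lt_order_contract h.finite hX hx
  omega

/-- On two vertices the three edges at a vertex would be parallel. -/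
lemma two_lt_order_of_simple (h : IsBipCubic G A B) (hs : G.Simple) (hne : V(G).Nonempty) :
    2 < order G := by
  by_contra! hn
  obtain ⟨x, hx⟩ := hne
  obtain ⟨y, hy, hyx⟩ := h.exists_ne hx
  have hV : V(G) = {x, y} := by
    symm
    refine Set.eq_of_subset_of_ncard_le (by simp [Set.insert_subset_iff, hx, hy]) ?_ h.finite
    rw [Set.ncard_pair hyx.symm]; exact hn
  have h3 := h.cubic.ncard_incidenceSet hx
  have hle : (G.incidenceSet x).ncard ≤ 1 := by
    rw [Set.ncard_le_one (h.cubic.finite_incidenceSet hx)]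
    have : ∀ e, G.Inc e x → G.IsLink e x y := by
      rintro e ⟨z, hz⟩
      have hzV := hz.right_mem
      rw [hV] at hzV
      rcases hzV with rfl | rfl
      · exact absurd rfl (h.bip.ne_of_isLink hz)
      · exact hz
    exact fun e he f hf => hs.eq_of_isLink (this e he) (this f hf)
  omega

end Main

end CubicGraphs

theorem theorem2p11 {α : Type u} {β : Type v} (H : Graph α β) (A B : Set α)
    (hfin : V(H).Finite) (hbip : IsBipartition H A B) (hcubic : IsCubic H)
    (h3 : IsKConnected H 3) :
    (∃ L : Multiset (Graph α β), IsTightCutDecomposition H L) ∧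
    ∀ L : Multiset (Graph α β), IsTightCutDecomposition H L →
      ((rho H A B : ℚ) ≥ bTilde L + 3 * (bPrime L : ℚ) - 3 ∧
        bTilde L + 3 * (bPrime L : ℚ) - 3 ≥ 3 * (order H : ℚ) - 9) ∧
      ((rho H A B : ℚ) = bTilde L + 3 * (bPrime L : ℚ) - 3 ↔ FamilyJ H ∨ FamilyK H) ∧
      (((rho H A B : ℚ) = bTilde L + 3 * (bPrime L : ℚ) - 3 ∧
        bTilde L + 3 * (bPrime L : ℚ) - 3 = 3 * (order H : ℚ) - 9) ↔ FamilyK H) := by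
  have h : IsBipCubic H A B := ⟨hfin, hbip, hcubic⟩
  have hc : IsThreeEdgeConnected H := fun X hX hne hp =>
    h3.le_ncard_cut h.finite_edgeSet hX hne hp
  have hne : V(H).Nonempty := h3.1.nonempty
  refine ⟨h.exists_decomposition hc hne, fun L hL => ?_⟩
  have hw : bTilde L + 3 * (bPrime L : ℚ) = decompWeight L := rfl
  rw [hw]
  -- Members of 𝒦 attain the outer bound. Since `b̃ + 3b' - 3` lies in between, both inequalities
  -- are equalities for them.
  have hK : FamilyK H → (rho H A B : ℚ) + 9 = 3 * order H := by
    intro hk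
    have h1 := hk.exists_isBipCubic.2
    rw [h.numPairs_eq] at h1
    have h2 : rho H A B + 9 = 3 * order H := by omega
    exact_mod_cast h2
  by_cases hn : 2 < order H
  · obtain ⟨b1, b2, b3⟩ := hL.bounds h hc hn
    have hK' : numPairs H + 18 = 6 * order H → FamilyK H := h.familyK hc hn
    have hRq : (numPairs H : ℚ) = 2 * rho H A B := by exact_mod_cast h.numPairs_eq
    rw [hRq] at b1 b3
    refine ⟨⟨by linarith, b2⟩, ⟨fun heq => ?_, ?_⟩, ⟨fun heq => ?_, fun hk => ?_⟩⟩
    · rcases b3 (by linarith) with hf | hk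
      · exact Or.inl ⟨h.simple hc hn, hcubic, h.isBrace hc hne hf⟩
      · exact Or.inr (hK' hk)
    · rintro (hj | hk)
      · rw [hL.eq_singleton hj.brace.free, h.decompWeight_singleton hc hn hj.brace.free,
          h.rho_of_free hc hn hj.brace.free]
        push_cast; ring
      · have := hK hk
        linarith
    · apply hK'
      have : (numPairs H : ℚ) + 18 = 6 * order H := by rw [hRq]; linarith [heq.1, heq.2]
      exact_mod_cast this
    · have := hK hk
      constructor <;> linarith
  -- What remains is the graph with two vertices and three parallel edges. It has no large brace, so
  -- both lower bounds equal `-3`, while `rho` is nonnegative. The first inequality is strict, and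
  -- the graph is in neither family.
  · have hfree := h.free_of_order_le (not_lt.1 hn)
    have ho : order H = 2 := by
      have h1 := h.order_eq
      have h2 : 0 < order H := (Set.ncard_pos hfin).2 hne
      omega
    have h0 : decompWeight L = 0 := by
      rw [hL.eq_singleton hfree]
      have : largeBraces {H} = 0 := by
        rw [largeBraces, Multiset.filter_singleton, if_neg (by rw [ho]; omega)]
        rfl
      simp [decompWeight, bTilde, bPrime, this]
    have hr : (0 : ℚ) ≤ rho H A B := by positivity
    have hoq : (order H : ℚ) = 2 := by exact_mod_cast ho
    have hnK : ¬ FamilyK H := fun hk => by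
      have := hK hk
      linarith
    have hnJ : ¬ FamilyJ H := fun hj => hn (two_lt_order_of_simple h hj.simple hne)
    rw [h0, hoq]
    refine ⟨⟨by linarith, by norm_num⟩, iff_of_false (fun heq => by linarith) ?_,
      iff_of_false (fun heq => by linarith [heq.1]) hnK⟩
    rintro (hj | hk)
    · exact hnJ hj
    · exact hnK hk
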